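/- **Setting.** Let $\mathcal P$ be a probability distribution over a measurable space $\mathcal X$ of items, $v^*:\mathcal X\to[0,H]$ a measurable valuation and $h:\mathcal X\to[n]$ an arbitrary measurable mask. Let $Q$ be a probability distribution over price functions $\psi:[n]\to[0,H]$. None of $\mathcal P,Q,v^*,h$ is known to the buyer. In each round $t=1,\dots,T$, independently of all other rounds, an item $x_t\sim\mathcal P$ and, independently of it, a price function $\psi_t\sim Q$ are drawn. The buyer sees $h(x_t)$ and the price $p_t=\psi_t(h(x_t))$, takes a decision $b_t\in\{0,1\}$ and receives (and observes) the utility $u_t=b_t(v^*(x_t)-p_t)$. **Algorithm** (inputs $T$ and $\delta\in(0,1)$). Put $\tau=\left\lceil\sqrt{Tn\log\frac{eT}{n}+\log\frac2\delta}\,\right\rceil$, where the square root of a negative number is read as $0$. In the rounds $t\le\tau$ draw $b_t\sim\mathrm{Bern}(1/2)$. Then let $\mathcal V_i=\{0\}\cup\{p_t: t\le\tau,\ h(x_t)=i\}$, $\mathcal V=\prod_{i=1}^n\mathcal V_i$, $\gamma=\sqrt{\frac{\log|\mathcal V|}{2(T-\tau)}}$ and $w_{\tau+1}^{\mathbf v}=1$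 for $\mathbf v\in\mathcal V$. In each round $t=\tau+1,\dots,T$, for $\mathbf v\in\mathcal V$ let $\pi_{\mathbf v}=\mathbb I(\mathbf v[h(x_t)]\ge p_t)$, $\xi_t^{\mathbf v}=(1-\pi_{\mathbf v},\pi_{\mathbf v})$ and $$\bar\xi_t[b]=(1-2\gamma)\sum_{\mathbf v\in\mathcal V}\frac{w_t^{\mathbf v}\,\xi_t^{\mathbf v}[b]}{\sum_{\mathbf v'\in\mathcal V}w_t^{\mathbf v'}}+\gamma\qquad(b\in\{0,1\}).$$ Draw $b_t\sim\mathrm{Bern}(\bar\xi_t[1])$ (with the parameter clipped to $[0,1]$), put $\hat r_t=(0,\ b_tu_t/\bar\xi_t[1])$ and update $$w_{t+1}^{\mathbf v}=w_t^{\mathbf v}\exp\left(\frac\gamma2\left(\xi_t^{\mathbf v}\cdot\hat r_t+\sum_{b=0}^1\frac{\xi_t^{\mathbf v}[b]}{\bar\xi_t[b]}\sqrt{\frac{\log(|\mathcal V|/\delta)}{2(T-\tau)}}\right)\right),$$ where $0/0=0$. (If $\tau\ge T$, only the initialization phase is run, for $T$ rounds.) **Regret.** Let $s^*:[n]\times\mathbb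 R\to\{0,1\}$ be an optimal strategy of the myopic oracle that knows $\mathcal P$ and $h$: for every $i$ with $\Pr[h(x)=i]>0$ and every $p$, the decision $s^*(i,p)$ maximizes $s\mapsto\mathbb E_{x\sim\mathcal P}[(v^*(x)-p)s\mid h(x)=i]$ over $s\in\{0,1\}$. Let $\rho_t=(v^*(x_t)-p_t)\,(s^*(h(x_t),p_t)-b_t)$. The realized regret is $\sum_{t=1}^T\rho_t$, and the expected regret given the buyer's observations is $\sum_{t=1}^T\mathbb E[\rho_t\mid\mathcal H_{t-1}]$, where $\mathcal H_{t-1}$ is the buyer's information (masks, prices, decisions, utilities) from the rounds before $t$. **Theorem.** For all $H\ge0$ and $A>0$ there is a constant $C=C(H,A)>0$ such that for all $n$, all $T\ge2$, all $\delta\in(0,1)$ with $\delta\ge T^{-A}$, and all $\mathcal X,\mathcal P,Q,v^*,h,s^*$ as above, with probability at least $1-\delta$ the realized regret and the expected regret given the observations are both at most $$C\sqrt{T\left(n\log T+\log\tfrac1\delta\right)}.$$ -/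

import Mathlib

open MeasureTheory ProbabilityTheory

noncomputable section

namespace PartialAuction

/-- The number `0` or `1` coded by a decision (`true` means: buy). -/
def ind (b : Bool) : ℝ := if b then 1 else 0

/-- A one-round purchase rule: it sees the mask value and the posted price. -/
abbrev Strategy (n : ℕ) := Fin n → ℝ → Bool

/-- `E[(v(x) - p) s(i, p) | h(x) = i]` for an item `x` with law `P`.  (For a mask value of
probability zero the conditional law is the zero measure, so every decision has utility `0`.) -/
def expectedUtility {X : Type*} [MeasurableSpace X] {n : ℕ} (P : Measure X) (h : X → Fin n)
    (v : X → ℝ) (s : Strategy n) (i : Fin n) (p : ℝ) : ℝ :=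
  ∫ x, (v x - p) * ind (s i p) ∂P[|h ⁻¹' {i}]

/-- `s` is an optimal strategy of the myopic buyer who knows the item law `P` and the mask `h`,
but not the realized item. -/
def IsOptimal {X : Type*} [MeasurableSpace X] {n : ℕ} (P : Measure X) (h : X → Fin n)
    (v : X → ℝ) (s : Strategy n) : Prop :=
  ∀ (s' : Strategy n) (i : Fin n) (p : ℝ),
    expectedUtility P h v s' i p ≤ expectedUtility P h v s i p

/-! ### The algorithm -/

/-- What the buyer has learned by the end of a round.  The utility is `0` without a purchase. -/
structure Observation (n : ℕ) where
  mask : Fin n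
  price : ℝ
  bought : Bool
  utility : ℝ

/-- The observations of all rounds so far, the most recent one first. -/
abbrev History (n : ℕ) := List (Observation n)

/-- The policy `π_v`: buy if and only if `v[i] ≥ p`. -/
def policy {n : ℕ} (v : Fin n → ℝ) : Strategy n := fun i p => decide (p ≤ v i)

/-- The length `τ` of the initialization phase, rounded up to an integer. -/
def initLength (n T : ℕ) (δ : ℝ) : ℕ :=
  ⌈Real.sqrt ((T : ℝ) * n * Real.log (Real.exp 1 * T / n) + Real.log (2 / δ))⌉₊

/-- The set `𝒱_i`: zero and the prices seen with mask value `i` in the first `τ` rounds. -/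
def thresholds {n : ℕ} (τ : ℕ) (past : History n) (i : Fin n) : Finset ℝ :=
  insert 0 ((((past.reverse.take τ).filter (fun o => o.mask = i)).map
    (fun o => o.price)).toFinset)

/-- The set `𝒱 = ∏ i, 𝒱_i` that indexes the representative policies. -/
def policySet {n : ℕ} (τ : ℕ) (past : History n) : Finset (Fin n → ℝ) :=
  Fintype.piFinset (thresholds τ past)

/-- The exploration rate `γ`, for `N` policies. -/
def explorationRate (T τ N : ℕ) : ℝ :=
  Real.sqrt (Real.log N / (2 * ((T : ℝ) - τ)))

/-- The confidence width `√(log (N / δ) / (2 (T - τ)))`, for `N` policies. -/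
def confidenceWidth (T τ N : ℕ) (δ : ℝ) : ℝ :=
  Real.sqrt (Real.log (N / δ) / (2 * ((T : ℝ) - τ)))

/-- The advice `ξ^v[b]` of the policy `π_v`; `b = false` is the arm "no purchase" and `b = true`
is the arm "purchase". -/
def advice {n : ℕ} (v : Fin n → ℝ) (i : Fin n) (p : ℝ) (b : Bool) : ℝ :=
  if policy v i p = b then 1 else 0

/-- The mixed advice `ξ̄[b]` for the weights `w` on the finite set `V`. -/
def mixedAdvice {n : ℕ} (γ : ℝ) (V : Finset (Fin n → ℝ)) (w : (Fin n → ℝ) → ℝ)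
    (i : Fin n) (p : ℝ) (b : Bool) : ℝ :=
  (1 - 2 * γ) * ∑ v ∈ V, w v * advice v i p b / (∑ v' ∈ V, w v') + γ

/-- The importance-weighted reward `r̂[b]` after the observation `o`, where `q` is the mixed
advice of that round: zero for "no purchase", and `b_t u_t / ξ̄[1]` for "purchase". -/
def estimatedReward {n : ℕ} (q : Bool → ℝ) (o : Observation n) (b : Bool) : ℝ :=
  if b then ind o.bought * o.utility / q true else 0

/-- The multiplicative weights `w^v` after a given history: all equal to `1` up to the end of the
initialization phase, and `w_{t+1}^v = w_t^v exp C_t^v` afterwards. -/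
def weight {n : ℕ} (T τ : ℕ) (δ : ℝ) : History n → (Fin n → ℝ) → ℝ
  | [], _ => 1
  | o :: past, v =>
    if past.length < τ then 1 else
      let V := policySet τ past
      let γ := explorationRate T τ V.card
      let q := mixedAdvice γ V (weight T τ δ past) o.mask o.price
      let C := γ / 2 *
        (∑ b : Bool, advice v o.mask o.price b * estimatedReward q o b
          + ∑ b : Bool, advice v o.mask o.price b / q b * confidenceWidth T τ V.card δ)
      weight T τ δ past v * Real.exp C

/-- The probability with which the algorithm buys in the next round, after the history `past`,
if the mask value is `i` and the price is `p`. -/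
def buyProb {n : ℕ} (T : ℕ) (δ : ℝ) (past : History n) (i : Fin n) (p : ℝ) : ℝ :=
  let τ := initLength n T δ
  let V := policySet τ past
  if past.length < τ then 1 / 2
  else mixedAdvice (explorationRate T τ V.card) V (weight T τ δ past) i p true

/-! ### The interaction -/

/-- The randomness of one round: the item, the price function of the seller (which depends on the
item through its mask value only) and the buyer's random seed. -/
abbrev Round (X : Type*) (n : ℕ) := X × (Fin n → ℝ) × unitInterval

/-- The law of one round: the item has law `P`, the price function has law `Q`, the seed is
uniform on `[0, 1]`, and the three are independent. -/
def roundLaw {X : Type*} [MeasurableSpace X] {n : ℕ} (P : Measure X) (Q : Measure (Fin n → ℝ)) :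
    Measure (Round X n) :=
  P.prod (Q.prod volume)

instance {X : Type*} [MeasurableSpace X] {n : ℕ} (P : Measure X) (Q : Measure (Fin n → ℝ))
    [IsProbabilityMeasure P] [IsProbabilityMeasure Q] : IsProbabilityMeasure (roundLaw P Q) := by
  unfold roundLaw
  infer_instance

/-- The law of the whole interaction: the rounds are independent and identically distributed. -/
def gameLaw {X : Type*} [MeasurableSpace X] {n : ℕ} (P : Measure X) (Q : Measure (Fin n → ℝ))
    [IsProbabilityMeasure P] [IsProbabilityMeasure Q] : Measure (ℕ → Round X n) :=
  Measure.infinitePi (fun _ : ℕ => roundLaw P Q)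

/-- The price posted in the round `z`. -/
def postedPrice {X : Type*} {n : ℕ} (h : X → Fin n) (z : Round X n) : ℝ := z.2.1 (h z.1)

/-- The algorithm's decision in the round `z`: a Bernoulli variable with the probability
`buyProb`, realized through the uniform seed. -/
def decision {X : Type*} {n : ℕ} (h : X → Fin n) (T : ℕ) (δ : ℝ) (past : History n)
    (z : Round X n) : Bool :=
  decide ((z.2.2 : ℝ) < buyProb T δ past (h z.1) (postedPrice h z))

/-- What the buyer observes in the round `z`. -/
def observe {X : Type*} {n : ℕ} (h : X → Fin n) (v : X → ℝ) (T : ℕ) (δ : ℝ) (past : History n)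
    (z : Round X n) : Observation n where
  mask := h z.1
  price := postedPrice h z
  bought := decision h T δ past z
  utility := (v z.1 - postedPrice h z) * ind (decision h T δ past z)

/-- The history after the first `t` rounds of `ω`. -/
def history {X : Type*} {n : ℕ} (h : X → Fin n) (v : X → ℝ) (T : ℕ) (δ : ℝ)
    (ω : ℕ → Round X n) : ℕ → History n
  | 0 => []
  | t + 1 => observe h v T δ (history h v T δ ω t) (ω t) :: history h v T δ ω t

/-- The regret of the round `z` with respect to the strategy `s`. -/
def roundRegret {X : Type*} {n : ℕ} (h : X → Fin n) (v : X → ℝ) (s : Strategy n) (T : ℕ) (δ : ℝ)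
    (past : History n) (z : Round X n) : ℝ :=
  (v z.1 - postedPrice h z) * ind (s (h z.1) (postedPrice h z))
    - (v z.1 - postedPrice h z) * ind (decision h T δ past z)

/-- The realized regret of the algorithm over `T` rounds. -/
def realizedRegret {X : Type*} {n : ℕ} (h : X → Fin n) (v : X → ℝ) (s : Strategy n) (T : ℕ)
    (δ : ℝ) (ω : ℕ → Round X n) : ℝ :=
  ∑ t ∈ Finset.range T, roundRegret h v s T δ (history h v T δ ω t) (ω t)

/-- The expected regret over `T` rounds, where the expectation in each round is taken over that
round's item, price and decision, given the buyer's observations from the earlier rounds. -/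
def conditionalRegret {X : Type*} [MeasurableSpace X] {n : ℕ} (P : Measure X)
    (Q : Measure (Fin n → ℝ)) (h : X → Fin n) (v : X → ℝ) (s : Strategy n) (T : ℕ) (δ : ℝ)
    (ω : ℕ → Round X n) : ℝ :=
  ∑ t ∈ Finset.range T, ∫ z, roundRegret h v s T δ (history h v T δ ω t) z ∂(roundLaw P Q)

end PartialAuction

end

/-!
The proof compares the algorithm with one random member of its policy set, the `comparator`: for
each mask value `i` its threshold is the largest price of the initialization phase that does not
exceed `m i = E[v(x) | h(x) = i]` (`condMean`).  The optimal strategy buys exactly when the price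
is below `m i` (`IsOptimal.eq_regularize`), so it beats the comparator only at prices between the
two thresholds.  No initialization round has such a price, and `measure_exists_unseen_le` shows that
then the probability of such a price is at most of the order `(n + log (1 / δ)) / τ`.  Here the
comparator is random, and there are infinitely many candidates; the union bound runs over the masses
of the `n` price intervals rounded to multiples of `2 / τ`, which costs a geometric series per
interval and no covering number.

Put `Λ = √(T n log T)`.  If `n log T` is not small against `T`, the bound exceeds `K T`, where
`K = H + 1`.  Otherwise (`Regime`), the regret against the comparator is bounded by a potential
argument for the logarithm of the share of the comparator in the total weight
(`log_share_cons_ge`, `log_share_comparator_ge`).  The error terms are sums over the rounds that are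
controlled by exponential supermartingales and Ville's inequality (`measure_exists_sum_ge_le`),
simultaneously for all times: the importance weights `b / q` (`weightExcess`), where `q` is the
purchase probability, and the upper confidence bounds of the comparator (`confidenceGap`).  The
latter form a supermartingale of scale `θ` only in the rounds with `q ≥ θ`, and the error is of the
order `log (1 / δ) / θ`.

There are two cases for `N`, the number of policies.  If `log N` is at least a multiple of
`log T / n`, the exploration rate `γ` itself can serve as `θ`, since `log T / γ` is of the order
`Λ`.  If there are fewer policies, `γ` is too small, and `θ` is the confidence width `w`.
Then `q ≥ w` has to be shown whenever the comparator buys, by induction on time.  The comparator is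
nearly optimal, so the algorithm can never have gained more than a multiple of `Λ` on it; as
`γ Λ` is at most a small multiple of `log T`, the potential argument keeps the share of the
comparator above `T ^ (-1 / 8)`, which exceeds `2 w` (`sum_comparatorGain_le`).  With a single
policy the algorithm coincides with the comparator.

The Azuma-Hoeffding inequality (`measure_exists_compensator_ge_le`) then passes from the realized
regret against the comparator to the expected one, hence to the conditional regret against the
optimal strategy, and from there to the realized regret.  All processes are functions of the
history, and the histories are dealt with as lists of random observations whose length is not
random (`IsRandomHistory`), which is what makes every quantity of the algorithm measurable.
-/

noncomputable section

namespace PartialAuction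

/-! ### Exponential supermartingales of an i.i.d. sequence -/

section Iid

variable {E : Type*}

/-- The process `f` is adapted: `f s` does not look at the coordinates after `s`. -/
def Adapted (f : ℕ → (ℕ → E) → ℝ) : Prop :=
  ∀ (s t : ℕ) (ω : ℕ → E) (z : E), s < t → f s (Function.update ω t z) = f s ω

lemma Adapted.sum_update {f : ℕ → (ℕ → E) → ℝ} (hf : Adapted f) {s t : ℕ} (hst : s ≤ t)
    (ω : ℕ → E) (z : E) :
    ∑ r ∈ Finset.range s, f r (Function.update ω t z) = ∑ r ∈ Finset.range s, f r ω :=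
  Finset.sum_congr rfl fun r hr => hf r t ω z (lt_of_lt_of_le (Finset.mem_range.1 hr) hst)

variable [MeasurableSpace E]

lemma measurable_update_prod (t : ℕ) :
    Measurable (fun y : (ℕ → E) × E => Function.update y.1 t y.2) := by
  rw [measurable_pi_iff]
  intro s
  by_cases hs : s = t
  · subst hs
    simpa using measurable_snd
  · simp only [Function.update_of_ne hs]
    exact (measurable_pi_apply s).comp measurable_fst

variable (ν : Measure E) [IsProbabilityMeasure ν]

/-- Resampling one coordinate of an i.i.d. sequence does not change its law. -/
lemma infinitePi_map_update (t : ℕ) :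
    ((Measure.infinitePi (fun _ : ℕ => ν)).prod ν).map
      (fun y : (ℕ → E) × E => Function.update y.1 t y.2)
      = Measure.infinitePi (fun _ : ℕ => ν) := by
  refine Measure.eq_infinitePi (fun _ : ℕ => ν) fun s B hB => ?_
  rw [Measure.map_apply (measurable_update_prod t)
    (MeasurableSet.pi s.countable_toSet fun i _ => hB i)]
  have hpre : (fun y : (ℕ → E) × E => Function.update y.1 t y.2) ⁻¹' (Set.pi s B)
      = (Set.pi (s.erase t : Finset ℕ) B) ×ˢ (if t ∈ s then B t else Set.univ) := by
    ext ⟨ω, z⟩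
    simp only [Set.mem_preimage, Set.mem_pi, Finset.mem_coe, Set.mem_prod, Finset.mem_erase]
    constructor
    · intro hy
      refine ⟨fun i hi => by simpa [Function.update_of_ne hi.1] using hy i hi.2, ?_⟩
      split_ifs with ht
      · simpa using hy t ht
      · trivial
    · rintro ⟨h1, h2⟩ i hi
      by_cases hit : i = t
      · subst hit
        simpa [hi] using h2
      · simpa [Function.update_of_ne hit] using h1 i ⟨hit, hi⟩
  rw [hpre, Measure.prod_prod, Measure.infinitePi_pi _ (fun i _ => hB i)]
  split_ifs with ht
  · exact Finset.prod_erase_mul s (fun i => ν (B i)) ht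
  · rw [Finset.erase_eq_of_notMem ht, measure_univ, mul_one]

variable {ν}

/-- If the conditional exponential moments of the increments are at most one, so is the exponential
moment of their sum. -/
lemma lintegral_exp_sum_le_one {f : ℕ → (ℕ → E) → ℝ} (hf : ∀ t, Measurable (f t))
    (hA : Adapted f)
    (hE : ∀ t ω, ∫⁻ z, ENNReal.ofReal (Real.exp (f t (Function.update ω t z))) ∂ν ≤ 1) (t : ℕ) :
    ∫⁻ ω, ENNReal.ofReal (Real.exp (∑ s ∈ Finset.range t, f s ω))
      ∂(Measure.infinitePi (fun _ : ℕ => ν)) ≤ 1 := by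
  induction t with
  | zero => simp
  | succ t ih =>
    have hm : ∀ t, Measurable fun ω : ℕ → E =>
        ENNReal.ofReal (Real.exp (∑ s ∈ Finset.range t, f s ω)) := fun t =>
      (Real.measurable_exp.comp (Finset.measurable_sum _ fun s _ => hf s)).ennreal_ofReal
    have hu := measurable_update_prod (E := E) t
    calc ∫⁻ ω, ENNReal.ofReal (Real.exp (∑ s ∈ Finset.range (t + 1), f s ω))
          ∂(Measure.infinitePi (fun _ : ℕ => ν))
        = ∫⁻ ω, ENNReal.ofReal (Real.exp (∑ s ∈ Finset.range (t + 1), f s ω))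
            ∂(((Measure.infinitePi (fun _ : ℕ => ν)).prod ν).map
              (fun y : (ℕ → E) × E => Function.update y.1 t y.2)) := by
          rw [infinitePi_map_update]
      _ = ∫⁻ ω, ∫⁻ z, ENNReal.ofReal (Real.exp
            (∑ s ∈ Finset.range (t + 1), f s (Function.update ω t z))) ∂ν
            ∂(Measure.infinitePi (fun _ : ℕ => ν)) := by
          rw [lintegral_map (hm _) hu]
          exact lintegral_prod _ ((hm (t + 1)).comp hu).aemeasurable
      _ = ∫⁻ ω, ENNReal.ofReal (Real.exp (∑ s ∈ Finset.range t, f s ω)) *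
            ∫⁻ z, ENNReal.ofReal (Real.exp (f t (Function.update ω t z))) ∂ν
            ∂(Measure.infinitePi (fun _ : ℕ => ν)) := by
          refine lintegral_congr fun ω => ?_
          rw [← lintegral_const_mul']
          · refine lintegral_congr fun z => ?_
            rw [Finset.sum_range_succ, hA.sum_update le_rfl, Real.exp_add,
              ENNReal.ofReal_mul (Real.exp_pos _).le]
          · exact ENNReal.ofReal_ne_top
      _ ≤ ∫⁻ ω, ENNReal.ofReal (Real.exp (∑ s ∈ Finset.range t, f s ω)) * 1
            ∂(Measure.infinitePi (fun _ : ℕ => ν)) := by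
          gcongr with ω
          exact hE t ω
      _ ≤ 1 := by simpa using ih

/-- Ville's maximal inequality for the exponential supermartingale `exp (∑ s < t, f s)`. -/
theorem measure_exists_sum_ge_le {f : ℕ → (ℕ → E) → ℝ} (hf : ∀ t, Measurable (f t))
    (hA : Adapted f)
    (hE : ∀ t ω, ∫⁻ z, ENNReal.ofReal (Real.exp (f t (Function.update ω t z))) ∂ν ≤ 1)
    (a : ℝ) (T : ℕ) :
    Measure.infinitePi (fun _ : ℕ => ν)
      {ω | ∃ t ≤ T, a ≤ ∑ s ∈ Finset.range t, f s ω} ≤ ENNReal.ofReal (Real.exp (-a)) := by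
  classical
  -- The process `f`, frozen as soon as its sum has reached the level `a`.
  let g : ℕ → (ℕ → E) → ℝ := fun t ω =>
    if ∃ s ∈ Finset.range (t + 1), a ≤ ∑ r ∈ Finset.range s, f r ω then 0 else f t ω
  have hset : ∀ t, MeasurableSet
      {ω : ℕ → E | ∃ s ∈ Finset.range (t + 1), a ≤ ∑ r ∈ Finset.range s, f r ω} := by
    intro t
    have : {ω : ℕ → E | ∃ s ∈ Finset.range (t + 1), a ≤ ∑ r ∈ Finset.range s, f r ω}
        = ⋃ s ∈ Finset.range (t + 1), {ω | a ≤ ∑ r ∈ Finset.range s, f r ω} := by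
      ext ω; simp
    rw [this]
    exact Finset.measurableSet_biUnion _ fun s _ =>
      measurableSet_le measurable_const (Finset.measurable_sum _ fun r _ => hf r)
  have hgm : ∀ t, Measurable (g t) := fun t => Measurable.ite (hset t) measurable_const (hf t)
  have hpassed : ∀ (s t : ℕ) (ω : ℕ → E) (z : E), s ≤ t →
      ((∃ s' ∈ Finset.range (s + 1), a ≤ ∑ r ∈ Finset.range s', f r (Function.update ω t z)) ↔
        ∃ s' ∈ Finset.range (s + 1), a ≤ ∑ r ∈ Finset.range s', f r ω) := by
    intro s t ω z hst
    refine exists_congr fun s' => and_congr_right fun hs' => ?_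
    rw [hA.sum_update (by have := Finset.mem_range.1 hs'; omega)]
  have hgA : Adapted g := by
    intro s t ω z hst
    by_cases hc : ∃ s' ∈ Finset.range (s + 1), a ≤ ∑ r ∈ Finset.range s', f r ω
    · have hc' := (hpassed s t ω z hst.le).2 hc
      simp only [g]
      rw [if_pos hc, if_pos hc']
    · have hc' := (hpassed s t ω z hst.le).not.2 hc
      simp only [g]
      rw [if_neg hc, if_neg hc', hA s t ω z hst]
  have hgE : ∀ t ω, ∫⁻ z, ENNReal.ofReal (Real.exp (g t (Function.update ω t z))) ∂ν ≤ 1 := by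
    intro t ω
    by_cases hc : ∃ s ∈ Finset.range (t + 1), a ≤ ∑ r ∈ Finset.range s, f r ω
    · simp only [g, hpassed t t ω _ le_rfl, if_pos hc]
      simp
    · simp only [g, hpassed t t ω _ le_rfl, if_neg hc]
      exact hE t ω
  have hsub : {ω | ∃ t ≤ T, a ≤ ∑ s ∈ Finset.range t, f s ω} ⊆
      {ω | ENNReal.ofReal (Real.exp a) ≤
        ENNReal.ofReal (Real.exp (∑ s ∈ Finset.range T, g s ω))} := by
    intro ω hω
    have hω' : ∃ t, t ≤ T ∧ a ≤ ∑ s ∈ Finset.range t, f s ω := hω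
    set t₀ := Nat.find hω' with ht₀
    obtain ⟨h1, h2⟩ := Nat.find_spec hω'
    have hlt : ∀ s < t₀, ¬ a ≤ ∑ r ∈ Finset.range s, f r ω := fun s hs hc =>
      Nat.find_min hω' hs ⟨hs.le.trans h1, hc⟩
    have e1 : ∑ s ∈ Finset.range t₀, g s ω = ∑ s ∈ Finset.range t₀, f s ω := by
      refine Finset.sum_congr rfl fun s hs => if_neg ?_
      rintro ⟨s', hs', hc⟩
      exact hlt s' (by have := Finset.mem_range.1 hs; have := Finset.mem_range.1 hs'; omega) hc
    have e2 : ∑ s ∈ Finset.range T, g s ω = ∑ s ∈ Finset.range t₀, g s ω := by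
      symm
      refine Finset.sum_subset (Finset.range_mono h1) fun s _ hs => if_pos ⟨t₀, ?_, h2⟩
      have : ¬ s < t₀ := fun hc => hs (Finset.mem_range.2 hc)
      exact Finset.mem_range.2 (by omega)
    refine ENNReal.ofReal_le_ofReal (Real.exp_le_exp.2 ?_)
    rw [e2, e1]
    exact h2
  have hmark := mul_meas_ge_le_lintegral (μ := Measure.infinitePi (fun _ : ℕ => ν))
    (f := fun ω : ℕ → E => ENNReal.ofReal (Real.exp (∑ s ∈ Finset.range T, g s ω)))
    ((Real.measurable_exp.comp (Finset.measurable_sum _ fun s _ => hgm s)).ennreal_ofReal)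
    (ENNReal.ofReal (Real.exp a))
  have hpos : ENNReal.ofReal (Real.exp a) ≠ 0 := by
    simpa using Real.exp_pos a
  calc _ ≤ _ := measure_mono hsub
    _ ≤ (ENNReal.ofReal (Real.exp a))⁻¹ := by
      rw [ENNReal.le_inv_iff_mul_le, mul_comm]
      exact hmark.trans (lintegral_exp_sum_le_one hgm hgA hgE T)
    _ = ENNReal.ofReal (Real.exp (-a)) := by
      rw [Real.exp_neg, ENNReal.ofReal_inv_of_pos (Real.exp_pos a)]

/-- The Azuma-Hoeffding inequality, uniformly in time, for the predictable compensator of an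
adapted process with values in `[-K, K]`. -/
theorem measure_exists_compensator_ge_le {d : ℕ → (ℕ → E) → ℝ} {K lam a : ℝ} (hK : 0 ≤ K)
    (hd : ∀ t, Measurable (d t)) (hA : Adapted d)
    (hb : ∀ t ω, ∀ᵐ z ∂ν, d t (Function.update ω t z) ∈ Set.Icc (-K) K) (T : ℕ) :
    Measure.infinitePi (fun _ : ℕ => ν)
      {ω | ∃ t ≤ T, a + t * (K ^ 2 * lam ^ 2 / 2) ≤
        lam * (∑ s ∈ Finset.range t, d s ω
          - ∑ s ∈ Finset.range t, ∫ z, d s (Function.update ω s z) ∂ν)}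
      ≤ ENNReal.ofReal (Real.exp (-a)) := by
  let f : ℕ → (ℕ → E) → ℝ := fun t ω =>
    lam * (d t ω - ∫ z, d t (Function.update ω t z) ∂ν) - K ^ 2 * lam ^ 2 / 2
  have hdu : ∀ t, Measurable fun y : (ℕ → E) × E => d t (Function.update y.1 t y.2) :=
    fun t => (hd t).comp (measurable_update_prod t)
  have hfm : ∀ t, Measurable (f t) := fun t =>
    (((hd t).sub (hdu t).stronglyMeasurable.integral_prod_right.measurable).const_mul _).sub_const _
  have hup : ∀ (s t : ℕ) (ω : ℕ → E) (z : E), s ≤ t →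
      (∫ z', d s (Function.update (Function.update ω t z) s z') ∂ν)
        = ∫ z', d s (Function.update ω s z') ∂ν := by
    intro s t ω z hst
    rcases hst.eq_or_lt with rfl | hlt
    · simp
    · congr 1 with z'
      rw [Function.update_comm hlt.ne', hA s t _ _ hlt]
  have hfA : Adapted f := by
    intro s t ω z hst
    simp only [f]
    rw [hA s t ω z hst, hup s t ω z hst.le]
  have hfE : ∀ t ω, ∫⁻ z, ENNReal.ofReal (Real.exp (f t (Function.update ω t z))) ∂ν ≤ 1 := by
    intro t ω
    have hmz : Measurable fun z => d t (Function.update ω t z) :=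
      (hdu t).comp (measurable_const.prodMk measurable_id)
    have hs := hasSubgaussianMGF_of_mem_Icc (μ := ν) hmz.aemeasurable (hb t ω)
    have h1 := hs.mgf_le lam
    have hc : (((‖K - -K‖₊ / 2) ^ 2 : NNReal) : ℝ) = K ^ 2 := by
      have : ((‖K - -K‖₊ : NNReal) : ℝ) = 2 * K := by
        rw [coe_nnnorm, Real.norm_eq_abs, abs_of_nonneg (by linarith)]; ring
      rw [NNReal.coe_pow, NNReal.coe_div, this]
      push_cast
      ring
    rw [hc] at h1
    have h2 := hs.integrable_exp_mul lam
    have : ∀ z, Real.exp (f t (Function.update ω t z)) = Real.exp (-(K ^ 2 * lam ^ 2 / 2)) *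
        Real.exp (lam * (d t (Function.update ω t z) - ∫ z, d t (Function.update ω t z) ∂ν)) := by
      intro z
      rw [← Real.exp_add]
      simp only [f, hup t t ω z le_rfl]
      congr 1
      ring
    simp only [this]
    rw [← ofReal_integral_eq_lintegral_ofReal (h2.const_mul _)
      (Filter.Eventually.of_forall fun z => by positivity), integral_const_mul]
    rw [ENNReal.ofReal_le_one]
    calc _ ≤ Real.exp (-(K ^ 2 * lam ^ 2 / 2)) * Real.exp (K ^ 2 * lam ^ 2 / 2) := by
          gcongr
          exact h1
      _ = 1 := by rw [← Real.exp_add]; simp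
  refine (measure_mono ?_).trans (measure_exists_sum_ge_le hfm hfA hfE a T)
  rintro ω ⟨t, ht, hω⟩
  refine ⟨t, ht, ?_⟩
  simp only [f]
  rw [Finset.sum_sub_distrib, ← Finset.mul_sum, Finset.sum_sub_distrib]
  simp only [Finset.sum_const, Finset.card_range, nsmul_eq_mul]
  linarith

/-- The probability that none of the first `τ` coordinates lies in `D`. -/
lemma infinitePi_forall_lt_notMem {D : Set E} (hD : MeasurableSet D) (τ : ℕ) :
    Measure.infinitePi (fun _ : ℕ => ν) {ω | ∀ t < τ, ω t ∉ D} = (ν Dᶜ) ^ τ := by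
  have : {ω : ℕ → E | ∀ t < τ, ω t ∉ D} = Set.pi (Finset.range τ) (fun _ => Dᶜ) := by
    ext ω; simp [Set.mem_pi]
  rw [this, Measure.infinitePi_pi _ (fun _ _ => hD.compl)]
  simp

/-- A null set of the one-round law is almost surely never met. -/
lemma ae_infinitePi_of_ae {p : E → Prop} (hp : ∀ᵐ z ∂ν, p z) :
    ∀ᵐ ω ∂(Measure.infinitePi (fun _ : ℕ => ν)), ∀ t, p (ω t) := by
  rw [ae_all_iff]
  intro t
  exact (measurePreserving_eval_infinitePi (fun _ : ℕ => ν) t).quasiMeasurePreserving.ae hp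

end Iid

/-! ### Measurability of the algorithm -/

section Measurability

variable {Ω Ω' : Type*} [MeasurableSpace Ω] [MeasurableSpace Ω'] {n : ℕ}

/-- A random observation: all four components are measurable. -/
structure IsRandomObservation (o : Ω → Observation n) : Prop where
  mask : Measurable fun ω => (o ω).mask
  price : Measurable fun ω => (o ω).price
  bought : Measurable fun ω => (o ω).bought
  utility : Measurable fun ω => (o ω).utility

/-- A random history: a history of fixed length whose entries are random observations. -/
def IsRandomHistory (L : Ω → History n) : Prop :=
  ∃ l : List (Ω → Observation n), (∀ o ∈ l, IsRandomObservation o) ∧ ∀ ω, L ω = l.map (fun o => o ω)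

lemma IsRandomHistory.nil : IsRandomHistory (fun _ : Ω => ([] : History n)) :=
  ⟨[], by simp, by simp⟩

lemma IsRandomHistory.cons {L : Ω → History n} {o : Ω → Observation n} (hL : IsRandomHistory L)
    (ho : IsRandomObservation o) : IsRandomHistory (fun ω => o ω :: L ω) := by
  obtain ⟨l, hl, hlL⟩ := hL
  refine ⟨o :: l, ?_, by simp [hlL]⟩
  intro o' ho'
  rcases List.mem_cons.1 ho' with rfl | h
  · exact ho
  · exact hl _ h

lemma IsRandomHistory.comp {L : Ω → History n} (hL : IsRandomHistory L) {φ : Ω' → Ω}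
    (hφ : Measurable φ) : IsRandomHistory (fun ω => L (φ ω)) := by
  obtain ⟨l, hl, hlL⟩ := hL
  refine ⟨l.map (fun o => o ∘ φ), ?_, fun ω => ?_⟩
  · intro o' ho'
    obtain ⟨o, ho, rfl⟩ := List.mem_map.1 ho'
    exact ⟨(hl o ho).mask.comp hφ, (hl o ho).price.comp hφ, (hl o ho).bought.comp hφ,
      (hl o ho).utility.comp hφ⟩
  · simp only [hlL, List.map_map]
    rfl

lemma IsRandomHistory.take_reverse {L : Ω → History n} (hL : IsRandomHistory L) (τ : ℕ) :
    IsRandomHistory (fun ω => (L ω).reverse.take τ) := by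
  obtain ⟨l, hl, hlL⟩ := hL
  refine ⟨l.reverse.take τ, fun o ho => hl o ?_, fun ω => ?_⟩
  · exact List.mem_reverse.1 (List.mem_of_mem_take ho)
  · simp only [hlL, List.map_take, List.map_reverse]

/-- Evaluating a measurable family at a measurable index. -/
lemma measurable_apply_index {f : Ω → Fin n → ℝ} (hf : Measurable f) {i : Ω → Fin n}
    (hi : Measurable i) : Measurable fun ω => f ω (i ω) := by
  have h1 : Measurable fun y : Ω × Fin n => f y.1 y.2 :=
    measurable_from_prod_countable_left fun k => measurable_pi_iff.1 hf k
  exact h1.comp (measurable_id.prodMk hi)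

lemma measurable_ind : Measurable ind := measurable_of_countable _

lemma measurable_decide {p : Ω → Prop} [DecidablePred p] (hp : MeasurableSet {ω | p ω}) :
    Measurable fun ω => decide (p ω) := by
  refine measurable_to_countable' fun b => ?_
  cases b
  · convert hp.compl using 1
    ext ω; simp
  · convert hp using 1
    ext ω; simp

lemma mem_thresholds {τ : ℕ} {past : History n} {i : Fin n} {x : ℝ} :
    x ∈ thresholds τ past i ↔
      x = 0 ∨ ∃ o ∈ past.reverse.take τ, o.mask = i ∧ o.price = x := by
  simp [thresholds, and_assoc]

/-- A random finite set: the image of a fixed finite index set under measurable maps. -/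
def IsRandomFinset (V : Ω → Finset (Fin n → ℝ)) : Prop :=
  ∃ (m : ℕ) (e : Fin m → Ω → Fin n → ℝ), (∀ j, Measurable (e j)) ∧
    ∀ ω, V ω = Finset.univ.image (fun j => e j ω)

/-- A sum over a random finite set is measurable.  Points that are hit by several indices are
counted once, so each index gets the reciprocal of the multiplicity as a weight. -/
lemma IsRandomFinset.measurable_sum {V : Ω → Finset (Fin n → ℝ)} (hV : IsRandomFinset V)
    {g : Ω → (Fin n → ℝ) → ℝ}
    (hg : ∀ e : Ω → Fin n → ℝ, Measurable e → Measurable fun ω => g ω (e ω)) :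
    Measurable fun ω => ∑ v ∈ V ω, g ω v := by
  classical
  obtain ⟨m, e, he, hVe⟩ := hV
  have key : ∀ ω, ∑ v ∈ V ω, g ω v
      = ∑ j, g ω (e j ω) / ∑ j', if e j' ω = e j ω then (1 : ℝ) else 0 := by
    intro ω
    rw [hVe]
    refine (Finset.sum_image' _ fun j _ => ?_)
    have hc : ∑ j', (if e j' ω = e j ω then (1 : ℝ) else 0)
        = ((Finset.univ.filter fun j' => e j' ω = e j ω).card : ℝ) := by
      rw [Finset.sum_boole]
    have hpos : 0 < (Finset.univ.filter fun j' => e j' ω = e j ω).card :=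
      Finset.card_pos.2 ⟨j, by simp⟩
    rw [Finset.sum_congr rfl (g := fun _ => g ω (e j ω) /
      ((Finset.univ.filter fun j' => e j' ω = e j ω).card : ℝ))]
    · rw [Finset.sum_const, nsmul_eq_mul]
      field_simp
    · intro k hk
      rw [(Finset.mem_filter.1 hk).2, hc]
  simp only [key]
  refine Finset.measurable_sum _ fun j _ => (hg _ (he j)).div ?_
  refine Finset.measurable_sum _ fun j' _ => ?_
  exact Measurable.ite (measurableSet_eq_fun (he j') (he j)) measurable_const measurable_const

lemma IsRandomHistory.policySet {L : Ω → History n} (hL : IsRandomHistory L) (τ : ℕ) :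
    IsRandomFinset fun ω => policySet τ (L ω) := by
  classical
  obtain ⟨l, hl, hlL⟩ := hL.take_reverse τ
  simp only at hlL
  let e : (Fin n → Option (Fin l.length)) → Ω → Fin n → ℝ := fun j ω i =>
    match j i with
    | none => 0
    | some k => if ((l.get k) ω).mask = i then ((l.get k) ω).price else 0
  have he : ∀ j, Measurable (e j) := by
    intro j
    rw [measurable_pi_iff]
    intro i
    simp only [e]
    cases j i with
    | none => exact measurable_const
    | some k =>
      have ho := hl (l.get k) (List.get_mem l k)
      exact Measurable.ite (ho.mask (measurableSet_singleton i)) ho.price measurable_const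
  let φ := (Fintype.equivFin (Fin n → Option (Fin l.length))).symm
  refine ⟨_, fun j => e (φ j), fun j => he _, fun ω => ?_⟩
  ext v
  simp only [PartialAuction.policySet, Fintype.mem_piFinset, mem_thresholds, hlL, Finset.mem_image,
    Finset.mem_univ, true_and]
  constructor
  · intro hv
    have : ∀ i, ∃ k : Option (Fin l.length), v i = match k with
        | none => 0
        | some k => if ((l.get k) ω).mask = i then ((l.get k) ω).price else 0 := by
      intro i
      rcases hv i with h0 | ⟨o, ho, h1, h2⟩
      · exact ⟨none, h0⟩
      · obtain ⟨o', ho', rfl⟩ := List.mem_map.1 ho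
        obtain ⟨k, rfl⟩ := List.get_of_mem ho'
        exact ⟨some k, by simp only [h1, if_true, h2]⟩
    choose k hk using this
    refine ⟨φ.symm k, ?_⟩
    ext i
    simp only [φ, Equiv.symm_symm, Equiv.symm_apply_apply]
    exact (hk i).symm
  · rintro ⟨j, rfl⟩ i
    simp only [e]
    cases φ j i with
    | none => exact Or.inl rfl
    | some k =>
      by_cases hk : ((l.get k) ω).mask = i
      · right
        refine ⟨(l.get k) ω, List.mem_map.2 ⟨_, List.get_mem l k, rfl⟩, hk, ?_⟩
        simp only [hk, if_true]
      · left
        simp only [hk, if_false]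

lemma IsRandomFinset.measurable_card {V : Ω → Finset (Fin n → ℝ)} (hV : IsRandomFinset V) :
    Measurable fun ω => ((V ω).card : ℝ) := by
  have := hV.measurable_sum (g := fun _ _ => 1) (fun _ _ => measurable_const)
  simpa using this

lemma measurable_advice {v : Ω → Fin n → ℝ} (hv : Measurable v) {i : Ω → Fin n}
    (hi : Measurable i) {p : Ω → ℝ} (hp : Measurable p) (b : Bool) :
    Measurable fun ω => advice (v ω) (i ω) (p ω) b := by
  unfold advice policy
  have hd := measurable_decide (measurableSet_le hp (measurable_apply_index hv hi))
  exact Measurable.ite (hd (measurableSet_singleton b)) measurable_const measurable_const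

lemma IsRandomHistory.measurable_explorationRate {L : Ω → History n} (hL : IsRandomHistory L)
    (T τ : ℕ) : Measurable fun ω => explorationRate T τ (PartialAuction.policySet τ (L ω)).card :=
  ((Real.measurable_log.comp (hL.policySet τ).measurable_card).div_const _).sqrt

lemma IsRandomHistory.measurable_confidenceWidth {L : Ω → History n} (hL : IsRandomHistory L)
    (T τ : ℕ) (δ : ℝ) :
    Measurable fun ω => confidenceWidth T τ (PartialAuction.policySet τ (L ω)).card δ :=
  ((Real.measurable_log.comp ((hL.policySet τ).measurable_card.div_const _)).div_const _).sqrt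

lemma measurable_mixedAdvice {γ : Ω → ℝ} (hγ : Measurable γ) {V : Ω → Finset (Fin n → ℝ)}
    (hV : IsRandomFinset V) {w : Ω → (Fin n → ℝ) → ℝ}
    (hw : ∀ e : Ω → Fin n → ℝ, Measurable e → Measurable fun ω => w ω (e ω))
    {i : Ω → Fin n} (hi : Measurable i) {p : Ω → ℝ} (hp : Measurable p) (b : Bool) :
    Measurable fun ω => mixedAdvice (γ ω) (V ω) (w ω) (i ω) (p ω) b := by
  unfold mixedAdvice
  have h2 : Measurable fun ω => ∑ v ∈ V ω, w ω v := hV.measurable_sum hw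
  have h1 : Measurable fun ω => ∑ v ∈ V ω, w ω v * advice v (i ω) (p ω) b / ∑ v' ∈ V ω, w ω v' :=
    hV.measurable_sum fun e he => ((hw e he).mul (measurable_advice he hi hp b)).div h2
  have h3 : Measurable fun ω => 1 - 2 * γ ω := measurable_const.sub (hγ.const_mul 2)
  exact (h3.mul h1).add hγ

lemma IsRandomHistory.measurable_weight {L : Ω → History n} (hL : IsRandomHistory L) (T τ : ℕ)
    (δ : ℝ) {e : Ω → Fin n → ℝ} (he : Measurable e) :
    Measurable fun ω => weight T τ δ (L ω) (e ω) := by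
  obtain ⟨l, hl, hlL⟩ := hL
  simp only [hlL]
  clear hlL
  induction l generalizing e with
  | nil => simp [weight]
  | cons o l ih =>
    have ho : IsRandomObservation o := hl o (by simp)
    have hl' : ∀ o ∈ l, IsRandomObservation o := fun o' h => hl o' (by simp [h])
    have hR : IsRandomHistory fun ω => l.map (fun o => o ω) := ⟨l, hl', fun _ => rfl⟩
    simp only [List.map_cons, weight, List.length_map]
    by_cases hlen : l.length < τ
    · simpa only [hlen, if_true] using measurable_const
    · simp only [hlen, if_false]
      have hγ := hR.measurable_explorationRate T τ
      have hw := hR.measurable_confidenceWidth T τ δ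
      have hq : ∀ b, Measurable _ := measurable_mixedAdvice hγ (hR.policySet τ)
        (w := fun ω => weight T τ δ (l.map (fun o => o ω))) (fun e he => ih he hl') ho.mask ho.price
      refine (ih he hl').mul
        (Real.measurable_exp.comp ((hγ.div_const 2).mul (Measurable.add ?_ ?_)))
      · refine Finset.measurable_sum _ fun b _ => (measurable_advice he ho.mask ho.price b).mul ?_
        unfold estimatedReward
        cases b
        · simp
        · simp only [if_true]
          exact ((measurable_ind.comp ho.bought).mul ho.utility).div (hq true)
      · exact Finset.measurable_sum _ fun b _ =>
          ((measurable_advice he ho.mask ho.price b).div (hq b)).mul hw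

/-- The mixed advice `ξ̄[b]` of the algorithm after the history `past`. -/
def mix (T τ : ℕ) (δ : ℝ) (past : History n) (i : Fin n) (p : ℝ) (b : Bool) : ℝ :=
  mixedAdvice (explorationRate T τ (policySet τ past).card) (policySet τ past)
    (weight T τ δ past) i p b

lemma IsRandomHistory.measurable_mix {L : Ω → History n} (hL : IsRandomHistory L) (T τ : ℕ)
    (δ : ℝ) {i : Ω → Fin n} (hi : Measurable i) {p : Ω → ℝ} (hp : Measurable p) (b : Bool) :
    Measurable fun ω => mix T τ δ (L ω) (i ω) (p ω) b :=
  measurable_mixedAdvice (hL.measurable_explorationRate T τ) (hL.policySet τ)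
    (fun _ he => hL.measurable_weight T τ δ he) hi hp b

lemma IsRandomHistory.measurable_buyProb {L : Ω → History n} (hL : IsRandomHistory L) (T : ℕ)
    (δ : ℝ) {i : Ω → Fin n} (hi : Measurable i) {p : Ω → ℝ} (hp : Measurable p) :
    Measurable fun ω => buyProb T δ (L ω) (i ω) (p ω) := by
  have hm := hL.measurable_mix T (initLength n T δ) δ hi hp true
  obtain ⟨l, hl, hlL⟩ := hL
  unfold buyProb
  have hlen : ∀ ω, (L ω).length = l.length := fun ω => by rw [hlL, List.length_map]
  simp only [hlen]
  split_ifs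
  · exact measurable_const
  · exact hm

variable {X : Type*} {h : X → Fin n} {v : X → ℝ}

lemma history_length (h : X → Fin n) (v : X → ℝ) (T : ℕ) (δ : ℝ) (ω : ℕ → Round X n) (t : ℕ) :
    (history h v T δ ω t).length = t := by
  induction t with
  | zero => rfl
  | succ t ih => simp [history, ih]

lemma history_update (h : X → Fin n) (v : X → ℝ) (T : ℕ) (δ : ℝ) {s t : ℕ} (hst : s ≤ t)
    (ω : ℕ → Round X n) (z : Round X n) :
    history h v T δ (Function.update ω t z) s = history h v T δ ω s := by
  induction s with
  | zero => rfl
  | succ s ih =>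
    simp only [history, ih (by omega), Function.update_of_ne (show s ≠ t by omega)]

variable [MeasurableSpace X]

lemma measurable_postedPrice (hh : Measurable h) :
    Measurable (postedPrice h : Round X n → ℝ) :=
  measurable_apply_index (f := fun z : Round X n => z.2.1) (measurable_fst.comp measurable_snd)
    (hh.comp measurable_fst)

lemma IsRandomHistory.measurable_decision {L : Ω → History n} (hL : IsRandomHistory L)
    (hh : Measurable h) (T : ℕ) (δ : ℝ) {z : Ω → Round X n} (hz : Measurable z) :
    Measurable fun ω => decision h T δ (L ω) (z ω) := by
  unfold decision
  refine measurable_decide (measurableSet_lt ?_ ?_)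
  · exact measurable_subtype_coe.comp (measurable_snd.comp (measurable_snd.comp hz))
  · exact hL.measurable_buyProb T δ (hh.comp (measurable_fst.comp hz))
      ((measurable_postedPrice hh).comp hz)

lemma isRandomHistory_history (hh : Measurable h) (hv : Measurable v) (T : ℕ) (δ : ℝ) (t : ℕ) :
    IsRandomHistory fun ω : ℕ → Round X n => history h v T δ ω t := by
  induction t with
  | zero => exact IsRandomHistory.nil
  | succ t ih =>
    have hz : Measurable fun ω : ℕ → Round X n => ω t := measurable_pi_apply t
    have hp : Measurable fun ω : ℕ → Round X n => postedPrice h (ω t) :=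
      (measurable_postedPrice hh).comp hz
    have hd := ih.measurable_decision hh T δ hz
    refine ih.cons ⟨hh.comp (measurable_fst.comp hz), hp, hd, ?_⟩
    exact ((hv.comp (measurable_fst.comp hz)).sub hp).mul (measurable_ind.comp hd)

end Measurability

/-! ### The potential of the exponential weights -/

lemma exp_le_one_add_add_sq {x K : ℝ} (hK : 0 ≤ K) (hx : x ≤ K) :
    Real.exp x ≤ 1 + x + Real.exp K * x ^ 2 := by
  have hK1 : 1 ≤ Real.exp K := Real.one_le_exp hK
  rcases le_or_gt |x| 1 with h1 | h1
  · have := (abs_le.1 (Real.abs_exp_sub_one_sub_id_le h1)).2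
    nlinarith [sq_nonneg x]
  · have hx2 : 1 ≤ x ^ 2 := by
      rw [← sq_abs]; nlinarith
    rcases le_or_gt 0 x with h0 | h0
    · have := Real.exp_le_exp.2 hx
      nlinarith
    · have h2 : Real.exp x ≤ 1 := Real.exp_le_one_iff.2 h0.le
      rw [abs_of_neg h0] at h1
      nlinarith

/-- The average of the second-order expansions of the weight updates, for a fraction `ρ` of the
weight that advises a purchase and the purchase probability `q` that results from it. -/
lemma average_update_le {γ w K y b q ρ : ℝ}
    (hγ : 0 < γ) (hγ4 : γ ≤ 1 / 4) (hw : 0 ≤ w) (hK : 1 ≤ K)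
    (hb : b = 0 ∨ b = 1) (hy : |y| ≤ K * b) (hρ0 : 0 ≤ ρ) (hρ1 : ρ ≤ 1)
    (hq : q = (1 - 2 * γ) * ρ + γ) :
    ρ * (γ / 2 * ((y + w) / q) + Real.exp K * (γ / 2 * ((y + w) / q)) ^ 2)
      + (1 - ρ) * (γ / 2 * (w / (1 - q)) + Real.exp K * (γ / 2 * (w / (1 - q))) ^ 2)
      ≤ γ / 2 * (y + 4 * w + 3 * Real.exp K * w ^ 2
          + 4 * K ^ 2 * Real.exp K * (γ * (b / q))) := by
  have hqγ : γ ≤ q := by rw [hq]; nlinarith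
  have hqγ' : γ ≤ 1 - q := by rw [hq]; nlinarith
  have hq0 : 0 < q := hγ.trans_le hqγ
  have hq0' : 0 < 1 - q := hγ.trans_le hqγ'
  have hρq : ρ ≤ 2 * q := by rw [hq]; nlinarith
  have hρq' : 1 - ρ ≤ 2 * (1 - q) := by rw [hq]; nlinarith
  have hρabs : |ρ - q| ≤ γ := by
    rw [hq, abs_le]
    constructor <;> nlinarith
  clear hq
  have heK : 1 ≤ Real.exp K := Real.one_le_exp (by linarith)
  have hb0 : 0 ≤ b := by rcases hb with h | h <;> simp [h]
  obtain ⟨A, hA⟩ : ∃ A, A = (y + w) / q := ⟨_, rfl⟩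
  obtain ⟨B, hB⟩ : ∃ B, B = w / (1 - q) := ⟨_, rfl⟩
  rw [← hA, ← hB]
  have hZ : 0 ≤ b / q := div_nonneg hb0 hq0.le
  have hy2 : y ^ 2 ≤ K ^ 2 * b := by
    rcases hb with h | h
    · rw [h, mul_zero] at hy
      rw [abs_nonpos_iff.1 hy, h]; simp
    · rw [h, mul_one] at hy
      rw [h, mul_one, ← sq_abs]
      gcongr
  have a1 : ρ * A ≤ y + K * (γ * (b / q)) + 2 * w := by
    have e : ρ * A = y + y * (ρ - q) / q + ρ / q * w := by
      rw [hA]; field_simp; ring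
    have e1 : y * (ρ - q) / q ≤ K * (γ * (b / q)) := by
      have : y * (ρ - q) ≤ K * b * γ := by
        refine (le_abs_self _).trans ?_
        rw [abs_mul]
        exact mul_le_mul hy hρabs (abs_nonneg _) (by positivity)
      calc y * (ρ - q) / q ≤ K * b * γ / q := by gcongr
        _ = _ := by ring
    have e2 : ρ / q * w ≤ 2 * w := by
      gcongr
      rwa [div_le_iff₀ hq0]
    linarith
  have a2 : (1 - ρ) * B ≤ 2 * w := by
    rw [hB, ← mul_div_assoc, div_le_iff₀ hq0']
    nlinarith
  have a3 : ρ * (γ * A ^ 2) ≤ 4 * K ^ 2 * (γ * (b / q)) + 4 * w ^ 2 := by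
    have h1 : ρ * (γ * A ^ 2) ≤ 2 * q * (γ * A ^ 2) := by gcongr
    have h2 : 2 * q * (γ * A ^ 2) = 2 * γ * (y + w) ^ 2 / q := by
      rw [hA]; field_simp
    have h3 : 2 * γ * (y + w) ^ 2 / q ≤ 2 * γ * (2 * (K ^ 2 * b) + 2 * w ^ 2) / q := by
      gcongr
      nlinarith [sq_nonneg (y - w)]
    have h4 : 2 * γ * (2 * (K ^ 2 * b) + 2 * w ^ 2) / q
        = 4 * K ^ 2 * (γ * (b / q)) + 4 * w ^ 2 * (γ / q) := by ring
    have h5 : γ / q ≤ 1 := by rwa [div_le_one hq0]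
    have h6 : 4 * w ^ 2 * (γ / q) ≤ 4 * w ^ 2 * 1 := by gcongr
    linarith
  have a4 : (1 - ρ) * (γ * B ^ 2) ≤ 2 * w ^ 2 := by
    have h1 : (1 - ρ) * (γ * B ^ 2) ≤ 2 * (1 - q) * (γ * B ^ 2) := by gcongr
    have h2 : 2 * (1 - q) * (γ * B ^ 2) = 2 * w ^ 2 * (γ / (1 - q)) := by
      rw [hB]; field_simp
    have h5 : γ / (1 - q) ≤ 1 := by rwa [div_le_one hq0']
    have h6 : 2 * w ^ 2 * (γ / (1 - q)) ≤ 2 * w ^ 2 * 1 := by gcongr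
    linarith
  have e : ρ * (γ / 2 * A + Real.exp K * (γ / 2 * A) ^ 2)
      + (1 - ρ) * (γ / 2 * B + Real.exp K * (γ / 2 * B) ^ 2)
      = γ / 2 * (ρ * A + (1 - ρ) * B
        + Real.exp K / 2 * (ρ * (γ * A ^ 2) + (1 - ρ) * (γ * B ^ 2))) := by ring
  rw [e]
  refine mul_le_mul_of_nonneg_left ?_ (by positivity)
  have a5 : Real.exp K / 2 * (ρ * (γ * A ^ 2) + (1 - ρ) * (γ * B ^ 2))
      ≤ Real.exp K / 2 * (4 * K ^ 2 * (γ * (b / q)) + 6 * w ^ 2) := by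
    refine mul_le_mul_of_nonneg_left ?_ (by positivity)
    linarith
  have a6 : K * (γ * (b / q)) ≤ 2 * K ^ 2 * Real.exp K * (γ * (b / q)) := by
    refine mul_le_mul_of_nonneg_right ?_ (by positivity)
    have h1 : K ≤ K ^ 2 := by nlinarith
    have h2 : K ^ 2 * 1 ≤ K ^ 2 * Real.exp K := by gcongr
    have h3 : 0 ≤ K ^ 2 := sq_nonneg K
    linarith
  have a7 : Real.exp K / 2 * (4 * K ^ 2 * (γ * (b / q)) + 6 * w ^ 2)
      = 2 * K ^ 2 * Real.exp K * (γ * (b / q)) + 3 * Real.exp K * w ^ 2 := by ring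
  linarith

/-- One step of the potential argument, for the total weight: `y` is the observed reward, `b` the
decision and `q` the probability of a purchase. -/
lemma sum_weight_mul_exp_le {ι : Type*} (V : Finset ι) (wt π : ι → ℝ) {γ w K y b q : ℝ}
    (hγ : 0 < γ) (hγ4 : γ ≤ 1 / 4) (hw : 0 ≤ w) (hw1 : w ≤ 1) (hK : 1 ≤ K)
    (hb : b = 0 ∨ b = 1) (hy : |y| ≤ K * b) (hwt : ∀ v ∈ V, 0 ≤ wt v) (hW : 0 < ∑ v ∈ V, wt v)
    (hπ : ∀ v ∈ V, π v = 0 ∨ π v = 1)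
    (hq : q = (1 - 2 * γ) * ((∑ v ∈ V, wt v * π v) / ∑ v ∈ V, wt v) + γ) :
    ∑ v ∈ V, wt v * Real.exp (γ / 2 * (π v * (y / q + w / q) + (1 - π v) * (w / (1 - q))))
      ≤ (∑ v ∈ V, wt v) * Real.exp (γ / 2 * (y + 4 * w + 3 * Real.exp K * w ^ 2
          + 4 * K ^ 2 * Real.exp K * (γ * (b / q)))) := by
  set W := ∑ v ∈ V, wt v with hWdef
  set ρ := (∑ v ∈ V, wt v * π v) / W with hρ
  have hρ0 : 0 ≤ ρ := div_nonneg (Finset.sum_nonneg fun v hv => mul_nonneg (hwt v hv)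
    (by rcases hπ v hv with h | h <;> simp [h])) hW.le
  have hρ1 : ρ ≤ 1 := by
    rw [hρ, div_le_one hW]
    refine Finset.sum_le_sum fun v hv => ?_
    have := hwt v hv
    rcases hπ v hv with h | h <;> simp [h, this]
  have hqγ : γ ≤ q := by rw [hq]; nlinarith
  have hqγ' : γ ≤ 1 - q := by rw [hq]; nlinarith
  have hq0 : 0 < q := hγ.trans_le hqγ
  have hq0' : 0 < 1 - q := hγ.trans_le hqγ'
  have heK : 1 ≤ Real.exp K := Real.one_le_exp (by linarith)
  have hb0 : 0 ≤ b := by rcases hb with h | h <;> simp [h]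
  have hb1 : b ≤ 1 := by rcases hb with h | h <;> simp [h]
  set A := (y + w) / q with hA
  set B := w / (1 - q) with hB
  have hyK : y ≤ K := (le_abs_self y).trans (hy.trans (by nlinarith))
  have hCA : γ / 2 * A ≤ K := by
    rw [hA, ← mul_div_assoc, div_le_iff₀ hq0]
    nlinarith
  have hCB : γ / 2 * B ≤ K := by
    rw [hB, ← mul_div_assoc, div_le_iff₀ hq0']
    nlinarith
  have hpt : ∀ v ∈ V, wt v * Real.exp (γ / 2 * (π v * (y / q + w / q) + (1 - π v) * B))
      ≤ wt v + wt v * π v * (γ / 2 * A + Real.exp K * (γ / 2 * A) ^ 2)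
        + (wt v - wt v * π v) * (γ / 2 * B + Real.exp K * (γ / 2 * B) ^ 2) := by
    intro v hv
    have h1 := exp_le_one_add_add_sq (by linarith) hCA
    have h2 := exp_le_one_add_add_sq (by linarith) hCB
    have h0 := hwt v hv
    rw [← add_div, ← hA]
    rcases hπ v hv with h | h
    · simp only [h, zero_mul, zero_add, sub_zero, one_mul, mul_zero]
      nlinarith
    · simp only [h, sub_self, zero_mul, one_mul, add_zero, mul_one]
      nlinarith
  have hsum := Finset.sum_le_sum hpt
  have hWρ : ∑ v ∈ V, wt v * π v = W * ρ := by
    rw [hρ]; field_simp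
  rw [Finset.sum_add_distrib, Finset.sum_add_distrib, ← Finset.sum_mul, ← Finset.sum_mul,
    Finset.sum_sub_distrib, ← hWdef, hWρ] at hsum
  refine hsum.trans ?_
  have hfin := average_update_le hγ hγ4 hw hK hb hy hρ0 hρ1 hq
  rw [← hA, ← hB] at hfin
  calc W + W * ρ * (γ / 2 * A + Real.exp K * (γ / 2 * A) ^ 2)
      + (W - W * ρ) * (γ / 2 * B + Real.exp K * (γ / 2 * B) ^ 2)
      = W * (ρ * (γ / 2 * A + Real.exp K * (γ / 2 * A) ^ 2)
      + (1 - ρ) * (γ / 2 * B + Real.exp K * (γ / 2 * B) ^ 2) + 1) := by ring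
    _ ≤ W * (γ / 2 * (y + 4 * w + 3 * Real.exp K * w ^ 2
          + 4 * K ^ 2 * Real.exp K * (γ * (b / q))) + 1) := by gcongr
    _ ≤ _ := by
      refine mul_le_mul_of_nonneg_left (Real.add_one_le_exp _) hW.le

section Weights

variable {n : ℕ} {T τ : ℕ} {δ : ℝ} {past : History n}

lemma policySet_nonempty (τ : ℕ) (past : History n) : (policySet τ past).Nonempty :=
  Fintype.piFinset_nonempty.2 fun _ => Finset.insert_nonempty _ _

lemma one_le_card_policySet (τ : ℕ) (past : History n) : 1 ≤ (policySet τ past).card :=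
  (policySet_nonempty τ past).card_pos

lemma card_policySet_le (τ : ℕ) (past : History n) : (policySet τ past).card ≤ (τ + 1) ^ n := by
  unfold policySet
  rw [Fintype.card_piFinset]
  calc ∏ i, (thresholds τ past i).card ≤ ∏ _i : Fin n, (τ + 1) := by
        refine Finset.prod_le_prod' fun i _ => ?_
        unfold thresholds
        refine (Finset.card_insert_le _ _).trans ?_
        refine Nat.add_le_add_right ((List.toFinset_card_le _).trans ?_) 1
        rw [List.length_map]
        exact (List.length_filter_le _ _).trans (List.length_take_le _ _)
    _ = (τ + 1) ^ n := by simp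

lemma policySet_cons (o : Observation n) (h : τ ≤ past.length) :
    policySet τ (o :: past) = policySet τ past := by
  have : (o :: past).reverse.take τ = past.reverse.take τ := by
    rw [List.reverse_cons, List.take_append_of_le_length (by simpa using h)]
  unfold policySet thresholds
  rw [this]

lemma weight_pos (T τ : ℕ) (δ : ℝ) (past : History n) (v : Fin n → ℝ) :
    0 < weight T τ δ past v := by
  induction past with
  | nil => simp [weight]
  | cons o past ih =>
    simp only [weight]
    split_ifs
    · exact one_pos
    · exact mul_pos ih (Real.exp_pos _)

lemma sum_weight_pos (T τ : ℕ) (δ : ℝ) (past : History n) :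
    0 < ∑ v ∈ policySet τ past, weight T τ δ past v :=
  Finset.sum_pos (fun v _ => weight_pos T τ δ past v) (policySet_nonempty τ past)

lemma weight_of_length_eq (h : past.length = τ) (v : Fin n → ℝ) : weight T τ δ past v = 1 := by
  cases past with
  | nil => rfl
  | cons o past => simp [weight, ← h]

lemma advice_true_eq (v : Fin n → ℝ) (i : Fin n) (p : ℝ) :
    advice v i p true = 0 ∨ advice v i p true = 1 := by
  unfold advice; split_ifs <;> simp

lemma advice_false (v : Fin n → ℝ) (i : Fin n) (p : ℝ) :
    advice v i p false = 1 - advice v i p true := by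
  unfold advice; cases policy v i p <;> simp

lemma mix_eq (i : Fin n) (p : ℝ) (b : Bool) : mix T τ δ past i p b =
    (1 - 2 * explorationRate T τ (policySet τ past).card) *
      ((∑ v ∈ policySet τ past, weight T τ δ past v * advice v i p b) /
        ∑ v ∈ policySet τ past, weight T τ δ past v)
      + explorationRate T τ (policySet τ past).card := by
  unfold mix mixedAdvice
  rw [Finset.sum_div]

lemma mix_false (i : Fin n) (p : ℝ) : mix T τ δ past i p false = 1 - mix T τ δ past i p true := by
  rw [mix_eq, mix_eq]
  simp only [advice_false, mul_sub, mul_one, Finset.sum_sub_distrib]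
  rw [sub_div, div_self (sum_weight_pos T τ δ past).ne']
  ring

/-- The share of the policy `v` in the total weight. -/
def share (T τ : ℕ) (δ : ℝ) (past : History n) (v : Fin n → ℝ) : ℝ :=
  weight T τ δ past v / ∑ v' ∈ policySet τ past, weight T τ δ past v'

lemma share_pos (T τ : ℕ) (δ : ℝ) (past : History n) (v : Fin n → ℝ) :
    0 < share T τ δ past v :=
  div_pos (weight_pos _ _ _ _ _) (sum_weight_pos _ _ _ _)

lemma share_le_one {v : Fin n → ℝ} (hv : v ∈ policySet τ past) : share T τ δ past v ≤ 1 := by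
  unfold share
  rw [div_le_one (sum_weight_pos _ _ _ _)]
  exact Finset.single_le_sum (f := fun v => weight T τ δ past v)
    (fun v _ => (weight_pos T τ δ past v).le) hv

lemma share_of_length_eq (h : past.length = τ) (v : Fin n → ℝ) :
    share T τ δ past v = ((policySet τ past).card : ℝ)⁻¹ := by
  unfold share
  simp [weight_of_length_eq h]

/-- The fraction of the weight that advises a purchase. -/
lemma averageAdvice_mem (T τ : ℕ) (δ : ℝ) (past : History n) (i : Fin n) (p : ℝ) :
    (∑ v ∈ policySet τ past, weight T τ δ past v * advice v i p true) /
        ∑ v ∈ policySet τ past, weight T τ δ past v ∈ Set.Icc (0 : ℝ) 1 := by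
  have hW := sum_weight_pos T τ δ past
  constructor
  · refine div_nonneg (Finset.sum_nonneg fun v _ => ?_) hW.le
    have := (weight_pos T τ δ past v).le
    rcases advice_true_eq v i p with h | h <;> simp [h, this]
  · rw [div_le_one hW]
    refine Finset.sum_le_sum fun v _ => ?_
    have := (weight_pos T τ δ past v).le
    rcases advice_true_eq v i p with h | h <;> simp [h, this]

lemma explorationRate_nonneg (T τ N : ℕ) : 0 ≤ explorationRate T τ N := Real.sqrt_nonneg _

lemma confidenceWidth_nonneg (T τ N : ℕ) (δ : ℝ) : 0 ≤ confidenceWidth T τ N δ :=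
  Real.sqrt_nonneg _

lemma mix_mem (hγ : explorationRate T τ (policySet τ past).card ≤ 1 / 4) (i : Fin n) (p : ℝ) :
    mix T τ δ past i p true ∈ Set.Icc (explorationRate T τ (policySet τ past).card)
      (1 - explorationRate T τ (policySet τ past).card) := by
  obtain ⟨h0, h1⟩ := averageAdvice_mem T τ δ past i p
  have hγ0 := explorationRate_nonneg T τ (policySet τ past).card
  rw [mix_eq]
  constructor <;> nlinarith

/-- A policy that advises a purchase contributes half of its share to the purchase probability. -/
lemma share_le_mix (hγ : explorationRate T τ (policySet τ past).card ≤ 1 / 4) {v : Fin n → ℝ}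
    (hv : v ∈ policySet τ past) {i : Fin n} {p : ℝ} (hp : advice v i p true = 1) :
    share T τ δ past v / 2 ≤ mix T τ δ past i p true := by
  have hW := sum_weight_pos T τ δ past
  have hγ0 := explorationRate_nonneg T τ (policySet τ past).card
  have hs0 := (share_pos T τ δ past v).le
  have : share T τ δ past v ≤ (∑ v ∈ policySet τ past, weight T τ δ past v * advice v i p true) /
        ∑ v ∈ policySet τ past, weight T τ δ past v := by
    unfold share
    gcongr
    have := Finset.single_le_sum (f := fun v => weight T τ δ past v * advice v i p true)
      (fun v _ => mul_nonneg (weight_pos T τ δ past v).le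
        (by rcases advice_true_eq v i p with h | h <;> simp [h])) hv
    simpa [hp] using this
  rw [mix_eq]
  nlinarith

/-- If there is only one policy, the algorithm follows it. -/
lemma mix_of_card_eq_one (h1 : (policySet τ past).card = 1) {v : Fin n → ℝ}
    (hv : v ∈ policySet τ past) (i : Fin n) (p : ℝ) :
    mix T τ δ past i p true = advice v i p true := by
  obtain ⟨v', hv'⟩ := Finset.card_eq_one.1 h1
  rw [hv', Finset.mem_singleton] at hv
  subst hv
  rw [mix_eq, hv']
  have := (weight_pos T τ δ past v).ne'
  simp [explorationRate]
  field_simp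

/-- One step of the potential argument, for the share of one policy. -/
lemma log_share_cons_ge {K : ℝ} {o : Observation n} (hlen : τ ≤ past.length) (hK : 1 ≤ K)
    (hγ0 : 0 < explorationRate T τ (policySet τ past).card)
    (hγ : explorationRate T τ (policySet τ past).card ≤ 1 / 4)
    (hw : confidenceWidth T τ (policySet τ past).card δ ≤ 1)
    (ho : |ind o.bought * o.utility| ≤ K * ind o.bought) (v : Fin n → ℝ) :
    Real.log (share T τ δ past v) + explorationRate T τ (policySet τ past).card / 2 *
      (advice v o.mask o.price true * (ind o.bought * o.utility / mix T τ δ past o.mask o.price true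
          + confidenceWidth T τ (policySet τ past).card δ / mix T τ δ past o.mask o.price true)
        - (ind o.bought * o.utility + 4 * confidenceWidth T τ (policySet τ past).card δ
          + 3 * Real.exp K * confidenceWidth T τ (policySet τ past).card δ ^ 2
          + 4 * K ^ 2 * Real.exp K * (explorationRate T τ (policySet τ past).card *
            (ind o.bought / mix T τ δ past o.mask o.price true))))
      ≤ Real.log (share T τ δ (o :: past) v) := by
  set γ := explorationRate T τ (policySet τ past).card with hγdef
  set w := confidenceWidth T τ (policySet τ past).card δ with hwdef
  set q := mix T τ δ past o.mask o.price true with hqdef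
  set y := ind o.bought * o.utility with hydef
  set W := ∑ v' ∈ policySet τ past, weight T τ δ past v' with hW
  have hWpos : 0 < W := sum_weight_pos T τ δ past
  have hw0 : 0 ≤ w := confidenceWidth_nonneg _ _ _ _
  have hq := mix_mem (T := T) (δ := δ) hγ o.mask o.price
  have hstep : ∀ v', weight T τ δ (o :: past) v' = weight T τ δ past v' * Real.exp (γ / 2 *
      (advice v' o.mask o.price true * (y / q + w / q)
        + (1 - advice v' o.mask o.price true) * (w / (1 - q)))) := by
    intro v'
    have hf : mixedAdvice γ (policySet τ past) (weight T τ δ past) o.mask o.price false = 1 - q :=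
      mix_false _ _
    have ht : mixedAdvice γ (policySet τ past) (weight T τ δ past) o.mask o.price true = q := rfl
    simp only [weight, not_lt.2 hlen, if_false, Fintype.sum_bool, estimatedReward, if_true,
      ← hγdef, ← hwdef, advice_false, ← hydef, Bool.false_eq_true, hf, ht]
    congr 2
    ring
  have htot : ∑ v' ∈ policySet τ (o :: past), weight T τ δ (o :: past) v' ≤ W *
      Real.exp (γ / 2 * (y + 4 * w + 3 * Real.exp K * w ^ 2
          + 4 * K ^ 2 * Real.exp K * (γ * (ind o.bought / q)))) := by
    rw [policySet_cons o hlen]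
    simp only [hstep]
    refine sum_weight_mul_exp_le _ _ _ hγ0 hγ hw0 hw hK ?_ ho
      (fun v _ => (weight_pos T τ δ past v).le) hWpos (fun v _ => advice_true_eq v _ _)
      (mix_eq _ _ _)
    cases o.bought <;> simp [ind]
  have hpi : 0 ≤ (1 - advice v o.mask o.price true) * (w / (1 - q)) := by
    refine mul_nonneg ?_ (div_nonneg hw0 (by linarith [hq.2]))
    rcases advice_true_eq v o.mask o.price with h | h <;> simp [h]
  have hWpos' := sum_weight_pos T τ δ (o :: past)
  have hwp := weight_pos T τ δ past v
  unfold share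
  rw [hstep v, Real.log_div (by positivity) hWpos'.ne', Real.log_mul hwp.ne' (Real.exp_pos _).ne',
    Real.log_exp, Real.log_div hwp.ne' hWpos.ne']
  have := Real.log_le_log hWpos' htot
  rw [Real.log_mul hWpos.ne' (Real.exp_pos _).ne', Real.log_exp] at this
  nlinarith [mul_nonneg hγ0.le hpi]

end Weights

/-! ### Integrals over one round -/

lemma volume_coe_lt {q : ℝ} (hq0 : 0 ≤ q) (hq1 : q ≤ 1) :
    (volume : Measure unitInterval) {u | (u : ℝ) < q} = ENNReal.ofReal q := by
  have : {u : unitInterval | (u : ℝ) < q} = Set.Iio (⟨q, hq0, hq1⟩ : unitInterval) := by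
    ext u
    exact Iff.rfl
  rw [this, unitInterval.volume_Iio]

/-- A function of the seed that takes one value if the algorithm buys, which has probability `q`,
and another value if it does not. -/
lemma lintegral_exp_seed_le_one {q a b : ℝ} {f : unitInterval → ℝ} (hq0 : 0 ≤ q) (hq1 : q ≤ 1)
    (hf : ∀ u, f u = if (u : ℝ) < q then a else b)
    (hab : q * Real.exp a + (1 - q) * Real.exp b ≤ 1) :
    ∫⁻ u, ENNReal.ofReal (Real.exp (f u)) ≤ 1 := by
  have hm : MeasurableSet {u : unitInterval | (u : ℝ) < q} :=
    measurableSet_lt measurable_subtype_coe measurable_const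
  have hc : (volume : Measure unitInterval) {u | (u : ℝ) < q}ᶜ = ENNReal.ofReal (1 - q) := by
    rw [prob_compl_eq_one_sub hm, volume_coe_lt hq0 hq1, ENNReal.ofReal_sub _ hq0,
      ENNReal.ofReal_one]
  rw [← lintegral_add_compl _ hm]
  have h1 : ∫⁻ u in {u : unitInterval | (u : ℝ) < q}, ENNReal.ofReal (Real.exp (f u))
      = ENNReal.ofReal (Real.exp a) * ENNReal.ofReal q := by
    rw [setLIntegral_congr_fun hm (g := fun _ => ENNReal.ofReal (Real.exp a)),
      setLIntegral_const, volume_coe_lt hq0 hq1]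
    intro u hu
    simp only [hf, if_pos (show (u : ℝ) < q from hu)]
  have h2 : ∫⁻ u in {u : unitInterval | (u : ℝ) < q}ᶜ, ENNReal.ofReal (Real.exp (f u))
      = ENNReal.ofReal (Real.exp b) * ENNReal.ofReal (1 - q) := by
    rw [setLIntegral_congr_fun hm.compl (g := fun _ => ENNReal.ofReal (Real.exp b)),
      setLIntegral_const, hc]
    intro u hu
    simp only [hf, if_neg (show ¬ (u : ℝ) < q from hu)]
  rw [h1, h2, ← ENNReal.ofReal_mul (Real.exp_pos _).le, ← ENNReal.ofReal_mul (Real.exp_pos _).le,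
    ← ENNReal.ofReal_add (by positivity) (mul_nonneg (Real.exp_pos _).le (by linarith)),
    ENNReal.ofReal_le_one]
  linarith

/-- The exponential moment behind the concentration of the importance weights. -/
lemma exp_moment_importanceWeight {γ q : ℝ} (hγ : 0 ≤ γ) (hγq : γ ≤ q) :
    q * Real.exp (γ * (1 / q) - 2 * γ) + (1 - q) * Real.exp (γ * (0 / q) - 2 * γ) ≤ 1 := by
  rcases eq_or_lt_of_le (hγ.trans hγq) with h0 | h0
  · subst h0
    have : γ = 0 := le_antisymm hγq hγ
    simp [this]
  have h1 : γ * (1 / q) ≤ 1 := by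
    rw [mul_one_div, div_le_one h0]; exact hγq
  have h2 : Real.exp (γ * (1 / q)) ≤ 1 + 2 * (γ * (1 / q)) := by
    have h3 : 0 ≤ γ * (1 / q) := by positivity
    have := (abs_le.1 (Real.abs_exp_sub_one_sub_id_le (abs_le.2 ⟨by linarith, h1⟩))).2
    nlinarith
  have h3 : q * Real.exp (γ * (1 / q)) + (1 - q) ≤ 1 + 2 * γ := by
    have : q * Real.exp (γ * (1 / q)) ≤ q * (1 + 2 * (γ * (1 / q))) := by gcongr
    have e : q * (1 + 2 * (γ * (1 / q))) = q + 2 * γ := by field_simp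
    linarith
  have h4 : 1 + 2 * γ ≤ Real.exp (2 * γ) := by linarith [Real.add_one_le_exp (2 * γ)]
  rw [zero_div, mul_zero, zero_sub, sub_eq_add_neg, Real.exp_add, ← mul_assoc, ← add_mul,
    Real.exp_neg, ← div_eq_mul_inv, div_le_one (Real.exp_pos _)]
  linarith

/-- The exponential moment behind the confidence bound: the bonus `w / q` pays for the variance
of the importance-weighted reward. -/
lemma exp_moment_confidence {lam K w q r : ℝ} (hlam : 0 ≤ lam) (hq : 0 < q)
    (hr : |r| ≤ K) (hlq : lam * K ≤ q) (hlw : lam * K ^ 2 ≤ w) :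
    q * Real.exp (lam * (r - 1 * r / q - w / q))
      + (1 - q) * Real.exp (lam * (r - 0 * r / q - w / q)) ≤ 1 := by
  have hx : |-(lam * r / q)| ≤ 1 := by
    rw [abs_neg, abs_div, abs_mul, abs_of_nonneg hlam, abs_of_pos hq, div_le_one hq]
    exact (mul_le_mul_of_nonneg_left hr hlam).trans hlq
  have h1 := (abs_le.1 (Real.abs_exp_sub_one_sub_id_le hx)).2
  have h2 : q * Real.exp (-(lam * r / q)) + (1 - q)
      ≤ Real.exp (-(lam * r) + lam ^ 2 * r ^ 2 / q) := by
    have h3 : q * Real.exp (-(lam * r / q)) ≤ q * (1 + -(lam * r / q) + (-(lam * r / q)) ^ 2) := by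
      refine mul_le_mul_of_nonneg_left ?_ hq.le
      linarith
    have e : q * (1 + -(lam * r / q) + (-(lam * r / q)) ^ 2)
        = q + (-(lam * r) + lam ^ 2 * r ^ 2 / q) := by
      field_simp
      ring
    linarith [Real.add_one_le_exp (-(lam * r) + lam ^ 2 * r ^ 2 / q)]
  have h4 : lam ^ 2 * r ^ 2 / q ≤ lam * w / q := by
    have : r ^ 2 ≤ K ^ 2 := by rw [← sq_abs]; gcongr
    have h5 : lam * (lam * r ^ 2) ≤ lam * w := by
      refine mul_le_mul_of_nonneg_left ?_ hlam
      exact (mul_le_mul_of_nonneg_left this hlam).trans hlw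
    refine div_le_div_of_nonneg_right ?_ hq.le
    linarith
  calc q * Real.exp (lam * (r - 1 * r / q - w / q))
      + (1 - q) * Real.exp (lam * (r - 0 * r / q - w / q))
      = Real.exp (lam * r - lam * w / q) * (q * Real.exp (-(lam * r / q)) + (1 - q)) := by
        rw [mul_add, mul_left_comm, ← Real.exp_add, mul_comm (Real.exp _) (1 - q)]
        congr 3 <;> ring_nf
    _ ≤ Real.exp (lam * r - lam * w / q) * Real.exp (-(lam * r) + lam ^ 2 * r ^ 2 / q) := by
        gcongr
    _ ≤ 1 := by
        rw [← Real.exp_add, Real.exp_le_one_iff]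
        linarith

section Round

variable {X : Type*} [MeasurableSpace X] {n : ℕ} {P : Measure X} {Q : Measure (Fin n → ℝ)}
  {h : X → Fin n} {v : X → ℝ} {H : ℝ}

lemma ae_roundLaw_of_ae_price {p : (Fin n → ℝ) → Prop} (hp : ∀ᵐ ψ ∂Q, p ψ) :
    ∀ᵐ z ∂(roundLaw P Q), p (z : Round X n).2.1 := by
  have h1 : ∀ᵐ y ∂(Q.prod (volume : Measure unitInterval)), p y.1 :=
    Measure.quasiMeasurePreserving_fst.ae hp
  exact Measure.quasiMeasurePreserving_snd.ae h1

variable (P h v) in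
/-- The conditional mean `E[v(x) | h(x) = i]`; it is `0` for a mask value of probability zero. -/
def condMean (i : Fin n) : ℝ := ∫ x, v x ∂P[|h ⁻¹' {i}]

lemma condMean_nonneg (hv : ∀ x, v x ∈ Set.Icc 0 H) (i : Fin n) :
    0 ≤ condMean P h v i := integral_nonneg fun x => (hv x).1

lemma ae_roundLaw_seed_lt_one : ∀ᵐ z ∂(roundLaw P Q), ((z : Round X n).2.2 : ℝ) < 1 := by
  have h0 : ∀ᵐ u : unitInterval ∂volume, (u : ℝ) < 1 := by
    have h2 := volume_coe_lt zero_le_one le_rfl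
    rw [ENNReal.ofReal_one] at h2
    have hm : MeasurableSet {u : unitInterval | (u : ℝ) < 1} :=
      measurableSet_lt measurable_subtype_coe measurable_const
    exact (mem_ae_iff_prob_eq_one hm).2 h2
  have h1 : ∀ᵐ y ∂(Q.prod (volume : Measure unitInterval)), (y.2 : ℝ) < 1 :=
    Measure.quasiMeasurePreserving_snd.ae (p := fun u : unitInterval => (u : ℝ) < 1) h0
  exact Measure.quasiMeasurePreserving_snd.ae
    (p := fun y : (Fin n → ℝ) × unitInterval => (y.2 : ℝ) < 1) h1

variable [IsProbabilityMeasure P] [IsProbabilityMeasure Q]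

lemma lintegral_exp_round_le_one {f : Round X n → ℝ} (hf : Measurable f)
    (hE : ∀ᵐ ψ ∂Q, ∀ x, ∫⁻ u, ENNReal.ofReal (Real.exp (f (x, ψ, u))) ≤ 1) :
    ∫⁻ z, ENNReal.ofReal (Real.exp (f z)) ∂(roundLaw P Q) ≤ 1 := by
  have hm : Measurable fun z => ENNReal.ofReal (Real.exp (f z)) :=
    (Real.measurable_exp.comp hf).ennreal_ofReal
  unfold roundLaw
  rw [lintegral_prod _ hm.aemeasurable]
  calc ∫⁻ x, ∫⁻ y, ENNReal.ofReal (Real.exp (f (x, y))) ∂(Q.prod volume) ∂P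
      ≤ ∫⁻ _x, 1 ∂P := by
        refine lintegral_mono fun x => ?_
        have hx : Measurable fun y => ENNReal.ofReal (Real.exp (f (x, y))) :=
          hm.comp measurable_prodMk_left
        rw [lintegral_prod _ hx.aemeasurable]
        calc ∫⁻ ψ, (∫⁻ u, ENNReal.ofReal (Real.exp (f (x, ψ, u)))) ∂Q ≤ ∫⁻ _ψ, 1 ∂Q := by
              refine lintegral_mono_ae ?_
              filter_upwards [hE] with ψ hψ using hψ x
          _ = 1 := by simp
    _ = 1 := by simp

lemma integrable_of_mem_Icc (hvm : Measurable v) (hv : ∀ x, v x ∈ Set.Icc 0 H)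
    (μ : Measure X) [IsFiniteMeasure μ] : Integrable v μ :=
  Integrable.of_bound hvm.aestronglyMeasurable H <| Filter.Eventually.of_forall fun x => by
    rw [Real.norm_eq_abs, abs_of_nonneg (hv x).1]; exact (hv x).2

lemma setIntegral_sub_condMean (hh : Measurable h) (hvm : Measurable v)
    (hv : ∀ x, v x ∈ Set.Icc 0 H) (i : Fin n) :
    ∫ x in h ⁻¹' {i}, (v x - condMean P h v i) ∂P = 0 := by
  have hms : MeasurableSet (h ⁻¹' {i}) := hh (measurableSet_singleton i)
  by_cases h0 : P (h ⁻¹' {i}) = 0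
  · rw [Measure.restrict_eq_zero.2 h0, integral_zero_measure]
  · rw [integral_sub (integrable_of_mem_Icc hvm hv _) (integrable_const _), setIntegral_const,
      condMean, ProbabilityTheory.cond, integral_smul_measure, smul_eq_mul, smul_eq_mul,
      Measure.real, ENNReal.toReal_inv, mul_inv_cancel_left₀, sub_self]
    exact ENNReal.toReal_ne_zero.2 ⟨h0, measure_ne_top _ _⟩

/-- The tower property: against a function of mask, prices and seed, the valuation may be replaced
by its conditional mean given the mask. -/
lemma integral_sub_condMean_mul (hh : Measurable h) (hvm : Measurable v)
    (hv : ∀ x, v x ∈ Set.Icc 0 H) {G : Round X n → ℝ} (hG : Measurable G) (hG1 : ∀ z, |G z| ≤ 1)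
    (hGh : ∀ x x' y, h x = h x' → G (x, y) = G (x', y)) :
    ∫ z, (v z.1 - condMean P h v (h z.1)) * G z ∂(roundLaw P Q) = 0 := by
  have hmm : Measurable fun x => condMean P h v (h x) :=
    (measurable_of_countable (condMean P h v)).comp hh
  have hint : ∀ (Y : Type _) [MeasurableSpace Y] (μ : Measure Y) [IsFiniteMeasure μ] (φ : Y → X)
      (g : Y → ℝ), Measurable φ → Measurable g → (∀ y, |g y| ≤ 1) →
      Integrable (fun y => (v (φ y) - condMean P h v (h (φ y))) * g y) μ := by
    intro Y _ μ _ φ g hφ hg hg1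
    refine Integrable.bdd_mul (c := 1) ?_ hg.aestronglyMeasurable ?_ |>.congr
      (Filter.Eventually.of_forall fun y => mul_comm _ _)
    · have h1 : Integrable (fun y => v (φ y)) μ :=
        Integrable.of_bound (hvm.comp hφ).aestronglyMeasurable H <|
          Filter.Eventually.of_forall fun y => by
            rw [Real.norm_eq_abs, abs_of_nonneg (hv _).1]; exact (hv _).2
      have h2 : Integrable (fun y => condMean P h v (h (φ y))) μ := by
        refine Integrable.of_bound (hmm.comp hφ).aestronglyMeasurable
          (∑ i, |condMean P h v i|) <| Filter.Eventually.of_forall fun y => ?_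
        rw [Real.norm_eq_abs]
        exact Finset.single_le_sum (f := fun i => |condMean P h v i|)
          (fun i _ => abs_nonneg _) (Finset.mem_univ _)
      exact h1.sub h2
    · exact Filter.Eventually.of_forall hg1
  unfold roundLaw
  rw [integral_prod_symm]
  · refine integral_eq_zero_of_ae (Filter.Eventually.of_forall fun y => ?_)
    have hGy : Measurable fun x => G (x, y) := hG.comp measurable_prodMk_right
    have hI := hint X P (fun x => x) (fun x => G (x, y)) measurable_id hGy (fun x => hG1 _)
    have hU : (⋃ i ∈ (Finset.univ : Finset (Fin n)), h ⁻¹' {i}) = Set.univ := by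
      ext x; simp
    simp only [Pi.zero_apply]
    rw [← setIntegral_univ, ← hU, integral_biUnion_finset]
    · refine Finset.sum_eq_zero fun i _ => ?_
      by_cases hne : ∃ x₀, h x₀ = i
      · obtain ⟨x₀, hx₀⟩ := hne
        rw [setIntegral_congr_fun (g := fun x => (v x - condMean P h v i) * G (x₀, y))
          (hh (measurableSet_singleton i)), integral_mul_const,
          setIntegral_sub_condMean hh hvm hv, zero_mul]
        intro x hx
        have hx' : h x = i := hx
        simp only [hx', hGh x x₀ y (by rw [hx', hx₀])]
      · have : h ⁻¹' {i} = ∅ := by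
          ext x
          simpa using fun hx => hne ⟨x, hx⟩
        simp [this]
    · exact fun i _ => hh (measurableSet_singleton i)
    · intro i _ j _ hij
      exact Disjoint.preimage h (by simpa using hij)
    · exact fun i _ => hI.integrableOn
  · exact hint (Round X n) (P.prod (Q.prod volume)) (fun z => z.1) G measurable_fst hG hG1

end Round

/-! ### Coverage of the prices by the initialization phase -/

section Coverage

variable {E : Type*} [MeasurableSpace E]

/-- Among the sets `B ∩ {a < p}` of measure at least `x` there is a smallest one, up to the
boundary point: a set `D` of measure at least `x` that is contained in all of them. -/
lemma exists_subset_of_le_measureReal (μ : Measure E) [IsFiniteMeasure μ] {B : Set E}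
    (hB : MeasurableSet B) {p : E → ℝ} (hp : Measurable p) {m : ℝ} (hm : ∀ z ∈ B, p z ≤ m)
    (x : ℝ) :
    ∃ D, MeasurableSet D ∧ D ⊆ B ∧
      ∀ a, x ≤ μ.real (B ∩ {z | a < p z}) → D ⊆ {z | a < p z} ∧ x ≤ μ.real D := by
  rcases le_or_gt x 0 with hx | hx
  · exact ⟨∅, MeasurableSet.empty, Set.empty_subset _, fun a _ => ⟨Set.empty_subset _, by simpa⟩⟩
  set A : Set ℝ := {a | x ≤ μ.real (B ∩ {z | a < p z})} with hA
  have hbdd : BddAbove A := by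
    refine ⟨m, fun a ha => ?_⟩
    by_contra hc
    have : B ∩ {z | a < p z} = ∅ := by
      ext z
      simp only [Set.mem_inter_iff, Set.mem_ofPred_eq, Set.mem_empty_iff_false, iff_false, not_and,
        not_lt]
      intro hz
      exact (hm z hz).trans (not_le.1 hc).le
    have ha' : x ≤ μ.real (B ∩ {z | a < p z}) := ha
    rw [this, measureReal_empty] at ha'
    linarith
  rcases A.eq_empty_or_nonempty with hne | hne
  · refine ⟨∅, MeasurableSet.empty, Set.empty_subset _, fun a ha => ?_⟩
    have : a ∈ A := ha
    rw [hne] at this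
    exact this.elim
  by_cases hs : sSup A ∈ A
  · refine ⟨B ∩ {z | sSup A < p z}, hB.inter (measurableSet_lt measurable_const hp),
      Set.inter_subset_left, fun a ha => ⟨?_, hs⟩⟩
    rintro z ⟨_, hz⟩
    exact lt_of_le_of_lt (le_csSup hbdd ha) hz
  · refine ⟨B ∩ {z | sSup A ≤ p z}, hB.inter (measurableSet_le measurable_const hp),
      Set.inter_subset_left, fun a ha => ⟨?_, ?_⟩⟩
    · rintro z ⟨_, hz⟩
      have h1 : a ≤ sSup A := le_csSup hbdd ha
      have h2 : a ≠ sSup A := by rintro rfl; exact hs ha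
      exact lt_of_lt_of_le (lt_of_le_of_ne h1 h2) hz
    · obtain ⟨u, hu, htend, huA⟩ := exists_seq_tendsto_sSup hne hbdd
      have hI : B ∩ {z | sSup A ≤ p z} = ⋂ k, B ∩ {z | u k < p z} := by
        ext z
        simp only [Set.mem_inter_iff, Set.mem_ofPred_eq, Set.mem_iInter]
        constructor
        · rintro ⟨h1, h2⟩ k
          refine ⟨h1, lt_of_lt_of_le (lt_of_le_of_ne (le_csSup hbdd (huA k)) ?_) h2⟩
          intro he
          exact hs (he ▸ huA k)
        · intro hz
          exact ⟨(hz 0).1, le_of_tendsto' htend fun k => (hz k).2.le⟩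
      have hanti : Antitone fun k => B ∩ {z | u k < p z} := fun k l hkl z hz =>
        ⟨hz.1, lt_of_le_of_lt (hu hkl) hz.2⟩
      have ht := tendsto_measure_iInter_atTop (μ := μ) (s := fun k => B ∩ {z | u k < p z})
        (fun k => (hB.inter (measurableSet_lt measurable_const hp)).nullMeasurableSet) hanti
        ⟨0, measure_ne_top _ _⟩
      rw [← hI] at ht
      have ht' := (ENNReal.tendsto_toReal (measure_ne_top μ _)).comp ht
      exact ge_of_tendsto' ht' fun k => huA k

lemma sum_exp_neg_le (n K : ℕ) :
    ∑ k ∈ Fintype.piFinset (fun _ : Fin n => Finset.range K), Real.exp (-∑ i, (k i : ℝ))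
      ≤ Real.exp n := by
  have h1 : ∀ k : Fin n → ℕ, Real.exp (-∑ i, (k i : ℝ)) = ∏ i, Real.exp (-1) ^ (k i) := by
    intro k
    rw [← Finset.sum_neg_distrib, Real.exp_sum]
    refine Finset.prod_congr rfl fun i _ => ?_
    rw [← Real.exp_nat_mul]
    ring_nf
  simp only [h1]
  rw [← Finset.prod_univ_sum (fun _ : Fin n => Finset.range K) (fun _ k => Real.exp (-1) ^ k),
    Finset.prod_const, Finset.card_univ, Fintype.card_fin]
  have he : Real.exp (-1) < 1 := by rw [Real.exp_lt_one_iff]; norm_num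
  have hg : ∑ k ∈ Finset.range K, Real.exp (-1) ^ k ≤ Real.exp 1 := by
    refine (Summable.sum_le_tsum _ (fun _ _ => by positivity)
      (summable_geometric_of_lt_one (Real.exp_pos _).le he)).trans ?_
    rw [tsum_geometric_of_lt_one (Real.exp_pos _).le he, inv_le_iff_one_le_mul₀ (by linarith),
      mul_sub, mul_one, ← Real.exp_add]
    have := Real.add_one_le_exp 1
    norm_num
    linarith
  calc (∑ k ∈ Finset.range K, Real.exp (-1) ^ k) ^ n ≤ Real.exp 1 ^ n := by
        gcongr
    _ = Real.exp n := by rw [← Real.exp_nat_mul, mul_one]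

/-- With high probability, every union of one upper interval of prices per cell `B i` that has not
been hit by the first `τ` samples has small mass.  The masses are rounded down to multiples of
`2 / τ`, and the union bound over the rounded masses costs only a geometric series per cell. -/
theorem measure_exists_unseen_le (ν : Measure E) [IsProbabilityMeasure ν] {n : ℕ}
    {B : Fin n → Set E} (hB : ∀ i, MeasurableSet (B i)) (hd : Pairwise (Function.onFun Disjoint B))
    {p : E → ℝ} (hp : Measurable p) {m : Fin n → ℝ} (hm : ∀ i, ∀ z ∈ B i, p z ≤ m i) {τ : ℕ}
    (hτ : 0 < τ) (a : ℝ) :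
    Measure.infinitePi (fun _ : ℕ => ν)
      {ω | ∃ c : Fin n → ℝ, (∀ t < τ, ∀ i, ω t ∉ B i ∩ {z | c i < p z}) ∧
        (4 * n + 2 * a) / τ < ∑ i, ν.real (B i ∩ {z | c i < p z})}
      ≤ ENNReal.ofReal (Real.exp (-a)) := by
  classical
  have hτR : (0 : ℝ) < τ := by exact_mod_cast hτ
  choose D hDm hDB hD using fun (i : Fin n) (x : ℝ) =>
    exists_subset_of_le_measureReal ν (hB i) hp (hm i) x
  let Dk : (Fin n → ℕ) → Set E := fun k => ⋃ i, D i (k i * (2 / τ))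
  let S : Finset (Fin n → ℕ) := (Fintype.piFinset fun _ : Fin n => Finset.range (τ + 1)).filter
    fun k => (n + a < ∑ i, (k i : ℝ)) ∧ ∀ i, k i * (2 / τ) ≤ ν.real (D i (k i * (2 / τ)))
  have hsub : {ω : ℕ → E | ∃ c : Fin n → ℝ, (∀ t < τ, ∀ i, ω t ∉ B i ∩ {z | c i < p z}) ∧
        (4 * n + 2 * a) / τ < ∑ i, ν.real (B i ∩ {z | c i < p z})}
      ⊆ ⋃ k ∈ S, {ω | ∀ t < τ, ω t ∉ Dk k} := by
    rintro ω ⟨c, hc, hsum⟩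
    set k : Fin n → ℕ := fun i => ⌊ν.real (B i ∩ {z | c i < p z}) * (τ / 2)⌋₊ with hk
    have hfl : ∀ i, (k i : ℝ) ≤ ν.real (B i ∩ {z | c i < p z}) * (τ / 2) := fun i =>
      Nat.floor_le (by positivity)
    have hfl' : ∀ i, ν.real (B i ∩ {z | c i < p z}) * (τ / 2) < k i + 1 := fun i =>
      Nat.lt_floor_add_one _
    have hmass : ∀ i, k i * (2 / τ) ≤ ν.real (B i ∩ {z | c i < p z}) := by
      intro i
      calc (k i : ℝ) * (2 / τ) ≤ ν.real (B i ∩ {z | c i < p z}) * (τ / 2) * (2 / τ) := by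
            gcongr
            exact hfl i
        _ = _ := by field_simp
    simp only [Set.mem_iUnion]
    refine ⟨k, ?_, ?_⟩
    · simp only [S, Finset.mem_filter, Fintype.mem_piFinset, Finset.mem_range]
      refine ⟨fun i => ?_, ?_, fun i => (hD i _ _ (hmass i)).2⟩
      · have h1 : ν.real (B i ∩ {z | c i < p z}) ≤ 1 := measureReal_le_one
        have : (k i : ℝ) < τ + 1 := by
          have := hfl i
          nlinarith
        exact_mod_cast this
      · have h1 : ∑ i, ν.real (B i ∩ {z | c i < p z}) * (τ / 2) ≤ ∑ i, ((k i : ℝ) + 1) :=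
          Finset.sum_le_sum fun i _ => (hfl' i).le
        rw [← Finset.sum_mul, Finset.sum_add_distrib, Finset.sum_const, Finset.card_univ,
          Fintype.card_fin, nsmul_eq_mul, mul_one] at h1
        rw [div_lt_iff₀ hτR] at hsum
        linarith
    · intro t ht hmem
      obtain ⟨i, hi⟩ := Set.mem_iUnion.1 hmem
      exact hc t ht i ⟨hDB i _ hi, (hD i _ _ (hmass i)).1 hi⟩
  have hone : ∀ k ∈ S, Measure.infinitePi (fun _ : ℕ => ν) {ω | ∀ t < τ, ω t ∉ Dk k}
      ≤ ENNReal.ofReal (Real.exp (-(n + a)) * Real.exp (-∑ i, (k i : ℝ))) := by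
    intro k hk
    obtain ⟨_, hk1, hk2⟩ := Finset.mem_filter.1 hk
    have hDkm : MeasurableSet (Dk k) := MeasurableSet.iUnion fun i => hDm i _
    rw [infinitePi_forall_lt_notMem hDkm]
    have hreal : ν.real (Dk k) = ∑ i, ν.real (D i (k i * (2 / τ))) := by
      rw [measureReal_def, measure_iUnion, tsum_fintype, ENNReal.toReal_sum]
      · rfl
      · exact fun i _ => measure_ne_top _ _
      · exact fun i j hij => (hd hij).mono (hDB i _) (hDB j _)
      · exact fun i => hDm i _
    have hge : (∑ i, (k i : ℝ)) * (2 / τ) ≤ ν.real (Dk k) := by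
      rw [hreal, Finset.sum_mul]
      exact Finset.sum_le_sum fun i _ => hk2 i
    have h1 : ν (Dk k)ᶜ ≤ ENNReal.ofReal (Real.exp (-ν.real (Dk k))) := by
      rw [← ofReal_measureReal (μ := ν) (s := (Dk k)ᶜ)]
      refine ENNReal.ofReal_le_ofReal ?_
      rw [probReal_compl_eq_one_sub hDkm]
      linarith [Real.add_one_le_exp (-ν.real (Dk k))]
    calc (ν (Dk k)ᶜ) ^ τ ≤ ENNReal.ofReal (Real.exp (-ν.real (Dk k))) ^ τ := by gcongr
      _ = ENNReal.ofReal (Real.exp (τ * -ν.real (Dk k))) := by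
        rw [← ENNReal.ofReal_pow (Real.exp_pos _).le, Real.exp_nat_mul]
      _ ≤ _ := by
        refine ENNReal.ofReal_le_ofReal ?_
        rw [← Real.exp_add, Real.exp_le_exp]
        have : (∑ i, (k i : ℝ)) * 2 ≤ τ * ν.real (Dk k) := by
          calc (∑ i, (k i : ℝ)) * 2 = τ * ((∑ i, (k i : ℝ)) * (2 / τ)) := by field_simp
            _ ≤ _ := by gcongr
        linarith
  calc Measure.infinitePi (fun _ : ℕ => ν) _
      ≤ Measure.infinitePi (fun _ : ℕ => ν) (⋃ k ∈ S, {ω | ∀ t < τ, ω t ∉ Dk k}) :=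
        measure_mono hsub
    _ ≤ ∑ k ∈ S, Measure.infinitePi (fun _ : ℕ => ν) {ω | ∀ t < τ, ω t ∉ Dk k} :=
        measure_biUnion_finset_le _ _
    _ ≤ ∑ k ∈ S, ENNReal.ofReal (Real.exp (-(n + a)) * Real.exp (-∑ i, (k i : ℝ))) :=
        Finset.sum_le_sum hone
    _ = ENNReal.ofReal (∑ k ∈ S, Real.exp (-(n + a)) * Real.exp (-∑ i, (k i : ℝ))) :=
        (ENNReal.ofReal_sum_of_nonneg fun _ _ => by positivity).symm
    _ ≤ ENNReal.ofReal (Real.exp (-a)) := by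
        refine ENNReal.ofReal_le_ofReal ?_
        rw [← Finset.mul_sum]
        have h1 : ∑ k ∈ S, Real.exp (-∑ i, (k i : ℝ)) ≤ Real.exp n :=
          (Finset.sum_le_sum_of_subset_of_nonneg (Finset.filter_subset _ _)
            fun _ _ _ => by positivity).trans (sum_exp_neg_le n (τ + 1))
        calc Real.exp (-(n + a)) * ∑ k ∈ S, Real.exp (-∑ i, (k i : ℝ))
            ≤ Real.exp (-(n + a)) * Real.exp n := by gcongr
          _ = Real.exp (-a) := by rw [← Real.exp_add]; ring_nf

end Coverage

/-! ### The comparator -/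

section Comparator

variable {Ω : Type*} [MeasurableSpace Ω] {n : ℕ} {m : Fin n → ℝ} {τ : ℕ} {past : History n}

/-- The representative policy that the algorithm is compared with: for each mask value the largest
threshold found in the initialization phase that does not exceed the level `m i`. -/
def comparator (m : Fin n → ℝ) (τ : ℕ) (past : History n) (i : Fin n) : ℝ :=
  ((past.reverse.take τ).map
    (fun o => if o.mask = i ∧ o.price ≤ m i then o.price else 0)).foldr max 0

lemma foldr_max_zero_mem (l : List ℝ) : l.foldr max 0 = 0 ∨ l.foldr max 0 ∈ l := by
  induction l with
  | nil => simp
  | cons a l ih =>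
    rw [List.foldr_cons]
    rcases le_total a (l.foldr max 0) with h | h
    · rw [max_eq_right h]
      rcases ih with h0 | h0
      · exact Or.inl h0
      · exact Or.inr (List.mem_cons_of_mem _ h0)
    · rw [max_eq_left h]
      exact Or.inr List.mem_cons_self

lemma le_foldr_max_zero {l : List ℝ} {a : ℝ} (ha : a ∈ l) : a ≤ l.foldr max 0 := by
  induction l with
  | nil => simp at ha
  | cons b l ih =>
    rw [List.foldr_cons]
    rcases List.mem_cons.1 ha with rfl | h
    · exact le_max_left _ _
    · exact (ih h).trans (le_max_right _ _)

lemma comparator_mem (m : Fin n → ℝ) (τ : ℕ) (past : History n) :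
    comparator m τ past ∈ policySet τ past := by
  refine Fintype.mem_piFinset.2 fun i => mem_thresholds.2 ?_
  rcases foldr_max_zero_mem ((past.reverse.take τ).map
    (fun o => if o.mask = i ∧ o.price ≤ m i then o.price else 0)) with h | h
  · exact Or.inl h
  · obtain ⟨o, ho, he⟩ := List.mem_map.1 h
    by_cases hc : o.mask = i ∧ o.price ≤ m i
    · rw [if_pos hc] at he
      exact Or.inr ⟨o, ho, hc.1, he⟩
    · rw [if_neg hc] at he
      exact Or.inl he.symm

lemma comparator_le (hm : ∀ i, 0 ≤ m i) (i : Fin n) : comparator m τ past i ≤ m i := by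
  rcases foldr_max_zero_mem ((past.reverse.take τ).map
    (fun o => if o.mask = i ∧ o.price ≤ m i then o.price else 0)) with h | h
  · exact h.le.trans (hm i)
  · obtain ⟨o, _, he⟩ := List.mem_map.1 h
    unfold comparator
    rw [← he]
    split_ifs with hc
    · exact hc.2
    · exact hm i

lemma le_comparator {o : Observation n} (ho : o ∈ past.reverse.take τ) (hp : o.price ≤ m o.mask) :
    o.price ≤ comparator m τ past o.mask := by
  refine le_foldr_max_zero (List.mem_map.2 ⟨o, ho, ?_⟩)
  rw [if_pos ⟨rfl, hp⟩]

lemma comparator_cons (o : Observation n) (h : τ ≤ past.length) :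
    comparator m τ (o :: past) = comparator m τ past := by
  have : (o :: past).reverse.take τ = past.reverse.take τ := by
    rw [List.reverse_cons, List.take_append_of_le_length (by simpa using h)]
  unfold comparator
  rw [this]

lemma IsRandomHistory.measurable_comparator {L : Ω → History n} (hL : IsRandomHistory L)
    (m : Fin n → ℝ) (τ : ℕ) : Measurable fun ω => comparator m τ (L ω) := by
  rw [measurable_pi_iff]
  intro i
  obtain ⟨l, hl, hlL⟩ := hL.take_reverse τ
  simp only at hlL
  unfold comparator
  simp only [hlL]
  clear hlL
  induction l with
  | nil => simp
  | cons o l ih =>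
    have ho : IsRandomObservation o := hl o (by simp)
    simp only [List.map_cons, List.foldr_cons]
    refine Measurable.max (Measurable.ite ?_ ho.price measurable_const)
      (ih fun o' h => hl o' (by simp [h]))
    exact (ho.mask (measurableSet_singleton i)).inter (measurableSet_le ho.price measurable_const)

/-- The optimal strategy for the levels `m i`, with the ties at the price `m i` broken as in `s`. -/
def regularize (m : Fin n → ℝ) (s : Strategy n) : Strategy n := fun i p =>
  decide (p < m i ∨ (p = m i ∧ s i (m i) = true))

lemma measurable_regularize (m : Fin n → ℝ) (s : Strategy n) {i : Ω → Fin n} (hi : Measurable i)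
    {p : Ω → ℝ} (hp : Measurable p) : Measurable fun ω => regularize m s (i ω) (p ω) := by
  have hmi : Measurable fun ω => m (i ω) := (measurable_of_countable m).comp hi
  refine measurable_decide (MeasurableSet.union (measurableSet_lt hp hmi)
    (MeasurableSet.inter (measurableSet_eq_fun hp hmi) ?_))
  exact ((measurable_of_countable fun j => s j (m j)).comp hi) (measurableSet_singleton true)

lemma ind_eq (b : Bool) : ind b = 0 ∨ ind b = 1 := by cases b <;> simp [ind]

lemma ind_nonneg (b : Bool) : 0 ≤ ind b := by cases b <;> simp [ind]

lemma ind_le_one (b : Bool) : ind b ≤ 1 := by cases b <;> simp [ind]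

lemma mul_regularize_sub_nonneg (m : Fin n → ℝ) (s : Strategy n) (i : Fin n) (p : ℝ) (b : Bool) :
    0 ≤ (m i - p) * (ind (regularize m s i p) - ind b) := by
  rcases lt_trichotomy p (m i) with h | h | h
  · have : regularize m s i p = true := by simp [regularize, h]
    rw [this]
    exact mul_nonneg (by linarith) (by simpa [ind] using ind_le_one b)
  · rw [h]; simp
  · have : regularize m s i p = false := by simp [regularize, h.not_gt, h.ne']
    rw [this]
    refine mul_nonneg_of_nonpos_of_nonpos (by linarith) ?_
    simpa [ind] using ind_nonneg b

/-- The comparator loses against the optimal strategy only at prices between its threshold and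
the level `m i`. -/
lemma mul_regularize_sub_advice_le {c : Fin n → ℝ} {i : Fin n} (hc : c i ≤ m i) (s : Strategy n)
    {p K : ℝ} (hp : 0 ≤ p) (hmK : m i ≤ K) :
    (m i - p) * (ind (regularize m s i p) - advice c i p true)
      ≤ K * (if c i < p ∧ p ≤ m i then 1 else 0) := by
  rcases lt_trichotomy p (m i) with h | h | h
  · have : regularize m s i p = true := by simp [regularize, h]
    rw [this]
    by_cases hpc : p ≤ c i
    · simp [advice, policy, hpc, ind, hpc.not_gt]
    · simp only [advice, policy, hpc, ind, not_le.1 hpc, h.le]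
      simp
      linarith
  · rw [h]
    simp only [sub_self, zero_mul]
    refine mul_nonneg (by linarith) ?_
    split_ifs <;> norm_num
  · have : regularize m s i p = false := by simp [regularize, h.not_gt, h.ne']
    rw [this]
    simp [advice, policy, ind, h.not_ge, (hc.trans_lt h).not_ge]

end Comparator

/-! ### Expected regret of one round -/

section Expected

variable {X : Type*} {n : ℕ} {h : X → Fin n} {v : X → ℝ} {K : ℝ}

lemma roundRegret_eq (s : Strategy n) (T : ℕ) (δ : ℝ) (past : History n) (z : Round X n) :
    roundRegret h v s T δ past z = (v z.1 - postedPrice h z) *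
      (ind (s (h z.1) (postedPrice h z)) - ind (decision h T δ past z)) := by
  unfold roundRegret; ring

variable [MeasurableSpace X] {P : Measure X} {Q : Measure (Fin n → ℝ)}

lemma ae_abs_utility_le (hv : ∀ x, v x ∈ Set.Icc 0 K) (hQ : ∀ᵐ ψ ∂Q, ∀ i, ψ i ∈ Set.Icc 0 K) :
    ∀ᵐ z ∂(roundLaw P Q), |v z.1 - postedPrice h z| ≤ K := by
  filter_upwards [ae_roundLaw_of_ae_price (P := P) hQ] with z hz
  have h1 := hv z.1
  have h2 := hz (h z.1)
  unfold postedPrice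
  rw [abs_le]
  constructor <;> linarith [h1.1, h1.2, h2.1, h2.2]

variable [IsProbabilityMeasure P]

lemma condMean_le (hvm : Measurable v) (hv : ∀ x, v x ∈ Set.Icc 0 K)
    (hK : 0 ≤ K) (i : Fin n) : condMean P h v i ≤ K := by
  by_cases h0 : P (h ⁻¹' {i}) = 0
  · rw [condMean, cond_eq_zero_of_meas_eq_zero h0, integral_zero_measure]
    exact hK
  · have := cond_isProbabilityMeasure h0
    calc condMean P h v i ≤ ∫ _x, K ∂P[|h ⁻¹' {i}] :=
          integral_mono (integrable_of_mem_Icc hvm hv _) (integrable_const _) fun x => (hv x).2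
      _ = K := by simp

/-- Off the mask values of probability zero, an optimal strategy compares the price with the
conditional mean of the valuation. -/
lemma IsOptimal.eq_regularize (hvm : Measurable v)
    (hv : ∀ x, v x ∈ Set.Icc 0 K) {s : Strategy n} (hs : IsOptimal P h v s) {i : Fin n}
    (h0 : P (h ⁻¹' {i}) ≠ 0) (p : ℝ) : s i p = regularize (condMean P h v) s i p := by
  have := cond_isProbabilityMeasure h0
  have hU : ∀ s' : Strategy n, expectedUtility P h v s' i p
      = (condMean P h v i - p) * ind (s' i p) := by
    intro s'
    unfold expectedUtility
    rw [integral_mul_const, integral_sub (integrable_of_mem_Icc hvm hv _) (integrable_const _)]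
    simp [condMean]
  have h1 := hs (fun _ _ => true) i p
  have h2 := hs (fun _ _ => false) i p
  rw [hU, hU] at h1 h2
  simp only [ind, if_true, Bool.false_eq_true, if_false, mul_one, mul_zero] at h1 h2
  rcases lt_trichotomy p (condMean P h v i) with hlt | heq | hgt
  · have e : regularize (condMean P h v) s i p = true := by simp [regularize, hlt]
    rw [e]
    by_contra hne
    rw [Bool.not_eq_true] at hne
    rw [hne] at h1
    simp at h1
    linarith
  · rw [regularize, heq]
    cases s i (condMean P h v i) <;> simp
  · have e : regularize (condMean P h v) s i p = false := by
      simp [regularize, hgt.not_gt, hgt.ne']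
    rw [e]
    by_contra hne
    rw [Bool.not_eq_false] at hne
    rw [hne] at h2
    simp at h2
    linarith

lemma ae_eq_regularize (hvm : Measurable v)
    (hv : ∀ x, v x ∈ Set.Icc 0 K) {s : Strategy n} (hs : IsOptimal P h v s) :
    ∀ᵐ x ∂P, ∀ p, s (h x) p = regularize (condMean P h v) s (h x) p := by
  have h1 : ∀ i : Fin n, ∀ᵐ x ∂P, h x = i → P (h ⁻¹' {i}) ≠ 0 := by
    intro i
    by_cases h0 : P (h ⁻¹' {i}) = 0
    · have : ∀ᵐ x ∂P, x ∉ h ⁻¹' {i} := measure_eq_zero_iff_ae_notMem.1 h0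
      filter_upwards [this] with x hx hxi
      exact absurd hxi hx
    · exact Filter.Eventually.of_forall fun x _ => h0
  filter_upwards [ae_all_iff.2 h1] with x hx p
  exact hs.eq_regularize hvm hv (hx (h x) rfl) p

variable [IsProbabilityMeasure Q]

lemma integrable_utility_mul (hh : Measurable h) (hvm : Measurable v)
    (hv : ∀ x, v x ∈ Set.Icc 0 K) (hQ : ∀ᵐ ψ ∂Q, ∀ i, ψ i ∈ Set.Icc 0 K) {G : Round X n → ℝ}
    (hG : Measurable G) (hG1 : ∀ z, |G z| ≤ 1) :
    Integrable (fun z => (v z.1 - postedPrice h z) * G z) (roundLaw P Q) := by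
  refine Integrable.of_bound
    (((hvm.comp measurable_fst).sub (measurable_postedPrice hh)).mul hG).aestronglyMeasurable K ?_
  filter_upwards [ae_abs_utility_le (P := P) (Q := Q) (h := h) hv hQ] with z hz
  rw [Real.norm_eq_abs, abs_mul]
  have := abs_nonneg (v z.1 - postedPrice h z)
  nlinarith [hG1 z, abs_nonneg (G z)]

lemma integral_utility_mul (hh : Measurable h) (hvm : Measurable v)
    (hv : ∀ x, v x ∈ Set.Icc 0 K) (hK : 0 ≤ K) (hQ : ∀ᵐ ψ ∂Q, ∀ i, ψ i ∈ Set.Icc 0 K)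
    {G : Round X n → ℝ} (hG : Measurable G) (hG1 : ∀ z, |G z| ≤ 1)
    (hGh : ∀ x x' y, h x = h x' → G (x, y) = G (x', y)) :
    Integrable (fun z => (condMean P h v (h z.1) - postedPrice h z) * G z) (roundLaw P Q) ∧
    ∫ z, (v z.1 - postedPrice h z) * G z ∂(roundLaw P Q)
      = ∫ z, (condMean P h v (h z.1) - postedPrice h z) * G z ∂(roundLaw P Q) := by
  have h1 := integrable_utility_mul (P := P) hh hvm hv hQ hG hG1
  have hmh : Measurable fun x => condMean P h v (h x) :=
    (measurable_of_countable (condMean P h v)).comp hh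
  have h2 := integrable_utility_mul (P := P) hh hmh
    (fun x => ⟨condMean_nonneg hv _, condMean_le hvm hv hK _⟩) hQ hG hG1
  refine ⟨h2, ?_⟩
  rw [← sub_eq_zero, ← integral_sub h1 h2,
    ← integral_sub_condMean_mul (P := P) (Q := Q) hh hvm hv hG hG1 hGh]
  congr 1 with z
  ring

lemma integral_roundRegret_nonneg (hh : Measurable h) (hvm : Measurable v)
    (hv : ∀ x, v x ∈ Set.Icc 0 K) (hK : 0 ≤ K) (hQ : ∀ᵐ ψ ∂Q, ∀ i, ψ i ∈ Set.Icc 0 K)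
    (s : Strategy n) {T : ℕ} {δ : ℝ} {past : History n}
    (hd : Measurable fun z : Round X n => decision h T δ past z) :
    0 ≤ ∫ z, roundRegret h v (regularize (condMean P h v) s) T δ past z ∂(roundLaw P Q) := by
  simp only [roundRegret_eq]
  rw [(integral_utility_mul (P := P) (Q := Q) hh hvm hv hK hQ ?_ ?_ ?_).2]
  · exact integral_nonneg fun z => mul_regularize_sub_nonneg _ _ _ _ _
  · exact (measurable_ind.comp (measurable_regularize _ s (hh.comp measurable_fst)
      (measurable_postedPrice hh))).sub (measurable_ind.comp hd)
  · intro z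
    rcases ind_eq (regularize (condMean P h v) s (h z.1) (postedPrice h z)) with h1 | h1 <;>
    rcases ind_eq (decision h T δ past z) with h2 | h2 <;> simp [h1, h2]
  · intro x x' y hx
    have hdec : decision h T δ past (x, y) = decision h T δ past (x', y) := by
      unfold decision
      exact decide_eq_decide.2 (by simp only [postedPrice, hx])
    simp only [postedPrice, hdec, hx]

lemma integral_regularize_sub_advice_le (hh : Measurable h) (hvm : Measurable v)
    (hv : ∀ x, v x ∈ Set.Icc 0 K) (hK : 0 ≤ K) (hQ : ∀ᵐ ψ ∂Q, ∀ i, ψ i ∈ Set.Icc 0 K)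
    (s : Strategy n) {c : Fin n → ℝ} (hc : ∀ i, c i ≤ condMean P h v i) :
    ∫ z, (v z.1 - postedPrice h z) * (ind (regularize (condMean P h v) s (h z.1) (postedPrice h z))
      - advice c (h z.1) (postedPrice h z) true) ∂(roundLaw P Q)
      ≤ K * ∑ i, (roundLaw P Q).real ({z | h z.1 = i ∧ postedPrice h z ≤ condMean P h v i} ∩
          {z | c i < postedPrice h z}) := by
  have hp := measurable_postedPrice (n := n) hh
  have hi : Measurable fun z : Round X n => h z.1 := hh.comp measurable_fst
  have hset : ∀ i, MeasurableSet ({z : Round X n | h z.1 = i ∧ postedPrice h z ≤ condMean P h v i} ∩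
      {z | c i < postedPrice h z}) := fun i =>
    ((hi (measurableSet_singleton i)).inter (measurableSet_le hp measurable_const)).inter
      (measurableSet_lt measurable_const hp)
  have hG := integral_utility_mul (P := P) (Q := Q) (G := fun z =>
      ind (regularize (condMean P h v) s (h z.1) (postedPrice h z))
      - advice c (h z.1) (postedPrice h z) true) hh hvm hv hK hQ
    ((measurable_ind.comp (measurable_regularize _ s hi hp)).sub
      (measurable_advice measurable_const hi hp true)) (by
        intro z
        rcases ind_eq (regularize (condMean P h v) s (h z.1) (postedPrice h z)) with h1 | h1 <;>
        rcases advice_true_eq c (h z.1) (postedPrice h z) with h2 | h2 <;> simp [h1, h2])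
    (by
      intro x x' y hx
      simp only [postedPrice, hx])
  rw [hG.2]
  have hint : ∀ i, Integrable (Set.indicator
      ({z : Round X n | h z.1 = i ∧ postedPrice h z ≤ condMean P h v i} ∩
      {z | c i < postedPrice h z}) (fun _ => (1 : ℝ))) (roundLaw P Q) := fun i =>
    (integrable_const _).indicator (hset i)
  calc _ ≤ ∫ z, K * ∑ i, Set.indicator
        ({z : Round X n | h z.1 = i ∧ postedPrice h z ≤ condMean P h v i} ∩
          {z | c i < postedPrice h z}) (fun _ => (1 : ℝ)) z ∂(roundLaw P Q) := by
        refine integral_mono_ae hG.1 ((integrable_finsetSum _ fun i _ => hint i).const_mul K) ?_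
        filter_upwards [ae_roundLaw_of_ae_price (P := P) hQ] with z hz
        refine (mul_regularize_sub_advice_le (hc _) s (hz _).1 (condMean_le hvm hv hK _)).trans ?_
        refine mul_le_mul_of_nonneg_left ?_ hK
        refine le_trans ?_ (Finset.single_le_sum (f := fun i => Set.indicator
          ({z : Round X n | h z.1 = i ∧ postedPrice h z ≤ condMean P h v i} ∩
          {z | c i < postedPrice h z}) (fun _ => (1 : ℝ)) z)
          (fun i _ => Set.indicator_nonneg (fun _ _ => zero_le_one) _) (Finset.mem_univ (h z.1)))
        split_ifs with hcz
        · rw [Set.indicator_of_mem]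
          exact ⟨⟨rfl, hcz.2⟩, hcz.1⟩
        · exact Set.indicator_nonneg (fun _ _ => zero_le_one) _
    _ = _ := by
        rw [integral_const_mul, integral_finsetSum _ fun i _ => hint i]
        congr 1
        refine Finset.sum_congr rfl fun i _ => ?_
        rw [integral_indicator_const _ (hset i), smul_eq_mul, mul_one]

end Expected

/-! ### Concentration along the interaction -/

section Processes

variable {X : Type*} {n : ℕ} (h : X → Fin n) (v : X → ℝ) (T : ℕ) (δ : ℝ)

/-- The process `F(history, round)` for a function `F` of the past and the current round. -/
def stepProcess (F : History n → Round X n → ℝ) (t : ℕ) (ω : ℕ → Round X n) : ℝ :=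
  F (history h v T δ ω t) (ω t)

lemma adapted_stepProcess (F : History n → Round X n → ℝ) :
    Adapted (stepProcess h v T δ F) := by
  intro s t ω z hst
  unfold stepProcess
  rw [history_update h v T δ hst.le, Function.update_of_ne hst.ne]

lemma stepProcess_update (F : History n → Round X n → ℝ) (t : ℕ) (ω : ℕ → Round X n)
    (z : Round X n) :
    stepProcess h v T δ F t (Function.update ω t z) = F (history h v T δ ω t) z := by
  unfold stepProcess
  rw [history_update h v T δ le_rfl, Function.update_self]

/-- The reward of the comparator minus the reward of the algorithm, after the initialization. -/
def comparatorGain (m : Fin n → ℝ) (past : History n) (z : Round X n) : ℝ :=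
  if past.length < initLength n T δ then 0 else
    (v z.1 - postedPrice h z) *
      (advice (comparator m (initLength n T δ) past) (h z.1) (postedPrice h z) true
        - ind (decision h T δ past z))

/-- The exploration rate times the importance weight, minus twice the exploration rate. -/
def weightExcess (past : History n) (z : Round X n) : ℝ :=
  let τ := initLength n T δ
  let γ := explorationRate T τ (policySet τ past).card
  if past.length < τ then 0 else
    γ * (ind (decision h T δ past z) / mix T τ δ past (h z.1) (postedPrice h z) true) - 2 * γ

/-- The scale of the confidence bound: the exploration rate if there are many policies, and the
confidence width otherwise. -/
def confidenceScale (lvl : ℝ) (past : History n) : ℝ :=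
  let τ := initLength n T δ
  let N := (policySet τ past).card
  if lvl ≤ Real.log N then explorationRate T τ N else confidenceWidth T τ N δ

/-- The amount by which the reward of the comparator exceeds its upper confidence bound, on the
rounds in which the purchase probability is at least `confidenceScale`, in units of
`K ^ 2 / confidenceScale`. -/
def confidenceGap (m : Fin n → ℝ) (lvl K : ℝ) (past : History n) (z : Round X n) : ℝ :=
  let τ := initLength n T δ
  let q := mix T τ δ past (h z.1) (postedPrice h z) true
  let r := v z.1 - postedPrice h z
  let θ := confidenceScale T δ lvl past
  if past.length < τ then 0 else
    if advice (comparator m τ past) (h z.1) (postedPrice h z) true = 1 ∧ θ ≤ q then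
      θ / K ^ 2 * (r - ind (decision h T δ past z) * r / q
        - confidenceWidth T τ (policySet τ past).card δ / q)
    else 0

variable {T δ}

lemma decision_eq {past : History n} (hlen : initLength n T δ ≤ past.length) (z : Round X n) :
    decision h T δ past z =
      decide ((z.2.2 : ℝ) < mix T (initLength n T δ) δ past (h z.1) (postedPrice h z) true) := by
  unfold decision buyProb
  simp only [not_lt.2 hlen, if_false]
  rfl

variable (T δ) [MeasurableSpace X] {h v}

lemma measurable_history_ite (t : ℕ)
    {f : (ℕ → Round X n) → ℝ} (hf : Measurable f) :
    Measurable fun ω => if (history h v T δ ω t).length < initLength n T δ then 0 else f ω := by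
  simp only [history_length]
  split_ifs
  · exact measurable_const
  · exact hf

lemma measurable_roundRegret (hh : Measurable h) (hv : Measurable v) (m : Fin n → ℝ)
    (s : Strategy n) (t : ℕ) :
    Measurable (stepProcess h v T δ (roundRegret h v (regularize m s) T δ) t) := by
  have hL := isRandomHistory_history hh hv T δ t
  have hz : Measurable fun ω : ℕ → Round X n => ω t := measurable_pi_apply t
  have hp := (measurable_postedPrice (n := n) hh).comp hz
  have hi : Measurable fun ω : ℕ → Round X n => h (ω t).1 := hh.comp (measurable_fst.comp hz)
  have hr : Measurable fun ω : ℕ → Round X n => v (ω t).1 - postedPrice h (ω t) :=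
    (hv.comp (measurable_fst.comp hz)).sub hp
  exact (hr.mul (measurable_ind.comp (measurable_regularize m s hi hp))).sub
    (hr.mul (measurable_ind.comp (hL.measurable_decision hh T δ hz)))

lemma measurable_comparatorGain (hh : Measurable h) (hv : Measurable v) (m : Fin n → ℝ) (t : ℕ) :
    Measurable (stepProcess h v T δ (comparatorGain h v T δ m) t) := by
  have hL := isRandomHistory_history hh hv T δ t
  have hz : Measurable fun ω : ℕ → Round X n => ω t := measurable_pi_apply t
  have hp := (measurable_postedPrice (n := n) hh).comp hz
  have hi : Measurable fun ω : ℕ → Round X n => h (ω t).1 := hh.comp (measurable_fst.comp hz)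
  have hr : Measurable fun ω : ℕ → Round X n => v (ω t).1 - postedPrice h (ω t) :=
    (hv.comp (measurable_fst.comp hz)).sub hp
  unfold stepProcess comparatorGain
  exact measurable_history_ite T δ t (hr.mul
    ((measurable_advice (hL.measurable_comparator m _) hi hp true).sub
      (measurable_ind.comp (hL.measurable_decision hh T δ hz))))

lemma measurable_weightExcess (hh : Measurable h) (hv : Measurable v) (t : ℕ) :
    Measurable (stepProcess h v T δ (weightExcess h T δ) t) := by
  have hL := isRandomHistory_history hh hv T δ t
  have hz : Measurable fun ω : ℕ → Round X n => ω t := measurable_pi_apply t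
  have hp := (measurable_postedPrice (n := n) hh).comp hz
  have hi : Measurable fun ω : ℕ → Round X n => h (ω t).1 := hh.comp (measurable_fst.comp hz)
  have hγ := hL.measurable_explorationRate T (initLength n T δ)
  unfold stepProcess weightExcess
  exact measurable_history_ite T δ t ((hγ.mul
    ((measurable_ind.comp (hL.measurable_decision hh T δ hz)).div
      (hL.measurable_mix T _ δ hi hp true))).sub (hγ.const_mul 2))

lemma measurable_confidenceGap (hh : Measurable h) (hv : Measurable v) (m : Fin n → ℝ)
    (lvl K : ℝ) (t : ℕ) :
    Measurable (stepProcess h v T δ (confidenceGap h v T δ m lvl K) t) := by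
  have hL := isRandomHistory_history hh hv T δ t
  have hz : Measurable fun ω : ℕ → Round X n => ω t := measurable_pi_apply t
  have hp := (measurable_postedPrice (n := n) hh).comp hz
  have hi : Measurable fun ω : ℕ → Round X n => h (ω t).1 := hh.comp (measurable_fst.comp hz)
  have hr : Measurable fun ω : ℕ → Round X n => v (ω t).1 - postedPrice h (ω t) :=
    (hv.comp (measurable_fst.comp hz)).sub hp
  have hγ := hL.measurable_explorationRate T (initLength n T δ)
  have hw := hL.measurable_confidenceWidth T (initLength n T δ) δ
  have hq := hL.measurable_mix T (initLength n T δ) δ hi hp true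
  have hθ : Measurable fun ω => confidenceScale T δ lvl (history h v T δ ω t) := by
    unfold confidenceScale
    refine Measurable.ite (measurableSet_le measurable_const ?_) hγ hw
    exact Real.measurable_log.comp (hL.policySet _).measurable_card
  unfold stepProcess confidenceGap
  refine measurable_history_ite T δ t (Measurable.ite ?_ ?_ measurable_const)
  · exact ((measurable_advice (hL.measurable_comparator m _) hi hp true)
      (measurableSet_singleton 1)).inter (measurableSet_le hθ hq)
  · exact (hθ.div_const _).mul ((hr.sub (((measurable_ind.comp
      (hL.measurable_decision hh T δ hz)).mul hr).div hq)).sub (hw.div hq))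

variable {T δ}

lemma measurable_of_stepProcess {F : History n → Round X n → ℝ}
    (hF : ∀ t, Measurable (stepProcess h v T δ F t)) (t : ℕ) (ω : ℕ → Round X n) :
    Measurable fun z => F (history h v T δ ω t) z := by
  have := (hF t).comp ((measurable_update_prod (E := Round X n) t).comp
    (measurable_const (a := ω) |>.prodMk measurable_id))
  simpa only [Function.comp_def, stepProcess_update, id] using this

variable {P : Measure X} [IsProbabilityMeasure P] {Q : Measure (Fin n → ℝ)}
  [IsProbabilityMeasure Q] {K : ℝ}

/-- The maximal inequality for the sums of a function of the past and the current round. -/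
lemma gameLaw_exists_sum_ge_le {F : History n → Round X n → ℝ}
    (hF : ∀ t, Measurable (stepProcess h v T δ F t))
    (hE : ∀ t ω, ∫⁻ z, ENNReal.ofReal (Real.exp (F (history h v T δ ω t) z))
      ∂(roundLaw P Q) ≤ 1) (a : ℝ) (S : ℕ) :
    gameLaw P Q {ω | ∃ t ≤ S, a ≤ ∑ s ∈ Finset.range t, F (history h v T δ ω s) (ω s)}
      ≤ ENNReal.ofReal (Real.exp (-a)) := by
  refine measure_exists_sum_ge_le (ν := roundLaw P Q) hF (adapted_stepProcess h v T δ F) ?_ a S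
  intro t ω
  simp only [stepProcess_update]
  exact hE t ω

lemma gameLaw_exists_compensator_ge_le {F : History n → Round X n → ℝ} {lam a : ℝ} (hK : 0 ≤ K)
    (hF : ∀ t, Measurable (stepProcess h v T δ F t))
    (hb : ∀ past, ∀ᵐ z ∂(roundLaw P Q), F past z ∈ Set.Icc (-K) K) (S : ℕ) :
    gameLaw P Q {ω | ∃ t ≤ S, a + t * (K ^ 2 * lam ^ 2 / 2) ≤
        lam * (∑ s ∈ Finset.range t, F (history h v T δ ω s) (ω s)
          - ∑ s ∈ Finset.range t, ∫ z, F (history h v T δ ω s) z ∂(roundLaw P Q))}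
      ≤ ENNReal.ofReal (Real.exp (-a)) := by
  have := measure_exists_compensator_ge_le (ν := roundLaw P Q) (lam := lam) (a := a) hK hF
    (adapted_stepProcess h v T δ F) (by
      intro t ω
      simp only [stepProcess_update]
      exact hb _) S
  simp only [stepProcess_update] at this
  exact this

lemma lintegral_exp_weightExcess_le (hh : Measurable h) (hvm : Measurable v)
    (hγ : ∀ past : History n, explorationRate T (initLength n T δ)
      (policySet (initLength n T δ) past).card ≤ 1 / 4) (t : ℕ) (ω : ℕ → Round X n) :
    ∫⁻ z, ENNReal.ofReal (Real.exp (weightExcess h T δ (history h v T δ ω t) z))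
      ∂(roundLaw P Q) ≤ 1 := by
  refine lintegral_exp_round_le_one
    (measurable_of_stepProcess (measurable_weightExcess T δ hh hvm) t ω) ?_
  refine Filter.Eventually.of_forall fun ψ x => ?_
  set past := history h v T δ ω t
  by_cases hlen : past.length < initLength n T δ
  · simp [weightExcess, hlen]
  · have hq := mix_mem (T := T) (δ := δ) (hγ past) (h x) (ψ (h x))
    have hγ0 := explorationRate_nonneg T (initLength n T δ)
      (policySet (initLength n T δ) past).card
    refine lintegral_exp_seed_le_one (hγ0.trans hq.1) (hq.2.trans (by linarith)) ?_
      (exp_moment_importanceWeight hγ0 hq.1)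
    intro u
    simp only [weightExcess, hlen, if_false, decision_eq h (not_lt.1 hlen), postedPrice]
    split_ifs with hu <;> simp [ind, hu]

lemma lintegral_exp_confidenceGap_le (hh : Measurable h) (hvm : Measurable v)
    (hv : ∀ x, v x ∈ Set.Icc 0 K) (hK : 1 ≤ K) (hQ : ∀ᵐ ψ ∂Q, ∀ i, ψ i ∈ Set.Icc 0 K)
    (hγ : ∀ past : History n, explorationRate T (initLength n T δ)
      (policySet (initLength n T δ) past).card ≤ 1 / 4)
    (hγw : ∀ N, 1 ≤ N → explorationRate T (initLength n T δ) N
      ≤ confidenceWidth T (initLength n T δ) N δ)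
    (m : Fin n → ℝ) (lvl : ℝ) (t : ℕ) (ω : ℕ → Round X n) :
    ∫⁻ z, ENNReal.ofReal (Real.exp (confidenceGap h v T δ m lvl K (history h v T δ ω t) z))
      ∂(roundLaw P Q) ≤ 1 := by
  refine lintegral_exp_round_le_one
    (measurable_of_stepProcess (measurable_confidenceGap T δ hh hvm m lvl K) t ω) ?_
  filter_upwards [hQ] with ψ hψ x
  set past := history h v T δ ω t
  by_cases hlen : past.length < initLength n T δ
  · simp [confidenceGap, hlen]
  set τ := initLength n T δ with hτ
  set q := mix T τ δ past (h x) (ψ (h x)) true with hqdef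
  set θ := confidenceScale T δ lvl past with hθdef
  by_cases hc : advice (comparator m τ past) (h x) (ψ (h x)) true = 1 ∧ θ ≤ q
  · have hq := mix_mem (T := T) (δ := δ) (hγ past) (h x) (ψ (h x))
    have hγ0 := explorationRate_nonneg T τ (policySet τ past).card
    have hw0 := confidenceWidth_nonneg T τ (policySet τ past).card δ
    have hθ0 : 0 ≤ θ := by
      rw [hθdef]; unfold confidenceScale; simp only; split_ifs <;> assumption
    have hθw : θ ≤ confidenceWidth T τ (policySet τ past).card δ := by
      rw [hθdef]; unfold confidenceScale; simp only
      split_ifs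
      · exact hγw _ (one_le_card_policySet τ past)
      · exact le_rfl
    have hr : |v x - ψ (h x)| ≤ K := by
      have h1 := hv x
      have h2 := hψ (h x)
      rw [abs_le]
      constructor <;> linarith [h1.1, h1.2, h2.1, h2.2]
    refine lintegral_exp_seed_le_one
      (a := θ / K ^ 2 * ((v x - ψ (h x)) - 1 * (v x - ψ (h x)) / q
        - confidenceWidth T τ (policySet τ past).card δ / q))
      (b := θ / K ^ 2 * ((v x - ψ (h x)) - 0 * (v x - ψ (h x)) / q
        - confidenceWidth T τ (policySet τ past).card δ / q))
      (hγ0.trans hq.1) (hq.2.trans (by linarith)) ?_ ?_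
    · intro u
      simp only [confidenceGap, hlen, if_false, decision_eq h (not_lt.1 hlen), postedPrice,
        ← hτ, ← hqdef, ← hθdef, if_pos hc]
      split_ifs with hu <;> simp [ind, hu]
    · rcases hθ0.eq_or_lt with h0 | h0
      · rw [← h0]; simp
      · refine exp_moment_confidence (K := K) (by positivity) (h0.trans_le hc.2) hr ?_ ?_
        · refine le_trans ?_ hc.2
          rw [div_mul_eq_mul_div, div_le_iff₀ (by positivity)]
          exact mul_le_mul_of_nonneg_left (by nlinarith) h0.le
        · rw [div_mul_cancel₀ _ (by positivity)]
          exact hθw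
  · simp only [confidenceGap, hlen, if_false, postedPrice, ← hτ, ← hqdef, ← hθdef, if_neg hc]
    simp

end Processes

/-! ### The regret against the comparator along one path -/

section Path

variable {X : Type*} {n : ℕ} {h : X → Fin n} {v : X → ℝ} {T : ℕ} {δ : ℝ} {ω : ℕ → Round X n}

lemma policySet_history {t τ : ℕ} (ht : τ ≤ t) :
    policySet τ (history h v T δ ω t) = policySet τ (history h v T δ ω τ) := by
  induction t, ht using Nat.le_induction with
  | base => rfl
  | succ t ht ih =>
    rw [← ih, history, policySet_cons _ (by rwa [history_length])]

lemma comparator_history {t τ : ℕ} (ht : τ ≤ t) (m : Fin n → ℝ) :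
    comparator m τ (history h v T δ ω t) = comparator m τ (history h v T δ ω τ) := by
  induction t, ht using Nat.le_induction with
  | base => rfl
  | succ t ht ih =>
    rw [← ih, history, comparator_cons _ (by rwa [history_length])]

lemma sum_range_stepProcess_eq_zero {F : History n → Round X n → ℝ} {τ t : ℕ} (ht : t ≤ τ)
    (hF : ∀ past z, past.length < τ → F past z = 0) :
    ∑ s ∈ Finset.range t, F (history h v T δ ω s) (ω s) = 0 :=
  Finset.sum_eq_zero fun s hs => hF _ _ <| by
    rw [history_length]
    exact (Finset.mem_range.1 hs).trans_le ht

/-- The potential argument along one path, as long as the purchase probability has been at least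
`confidenceScale` whenever the comparator buys. -/
lemma log_share_comparator_ge {τ : ℕ} (hτ : τ = initLength n T δ) {m : Fin n → ℝ} {lvl K : ℝ}
    {γ w θ : ℝ}
    (hγdef : γ = explorationRate T τ (policySet τ (history h v T δ ω τ)).card)
    (hwdef : w = confidenceWidth T τ (policySet τ (history h v T δ ω τ)).card δ)
    (hθdef : θ = confidenceScale T δ lvl (history h v T δ ω τ))
    (hK : 1 ≤ K) (hγ0 : 0 < γ) (hγ : γ ≤ 1 / 4) (hw : w ≤ 1) (hθ : 0 < θ)
    (hr : ∀ s, |v (ω s).1 - postedPrice h (ω s)| ≤ K) {t : ℕ} (ht : τ ≤ t)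
    (hq : ∀ s, τ ≤ s → s < t →
      advice (comparator m τ (history h v T δ ω τ)) (h (ω s).1) (postedPrice h (ω s)) true = 1 →
      θ ≤ mix T τ δ (history h v T δ ω s) (h (ω s).1) (postedPrice h (ω s)) true) :
    -Real.log (policySet τ (history h v T δ ω τ)).card + γ / 2 *
      (∑ s ∈ Finset.range t, comparatorGain h v T δ m (history h v T δ ω s) (ω s)
        - K ^ 2 / θ * ∑ s ∈ Finset.range t,
            confidenceGap h v T δ m lvl K (history h v T δ ω s) (ω s)
        - ((t : ℝ) - τ) * (4 * w + 3 * Real.exp K * w ^ 2 + 8 * K ^ 2 * Real.exp K * γ)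
        - 4 * K ^ 2 * Real.exp K * ∑ s ∈ Finset.range t,
            weightExcess h T δ (history h v T δ ω s) (ω s))
      ≤ Real.log (share T τ δ (history h v T δ ω t)
          (comparator m τ (history h v T δ ω τ))) := by
  induction t, ht using Nat.le_induction with
  | base =>
    rw [sum_range_stepProcess_eq_zero (τ := τ) le_rfl
        (fun past z hp => by rw [comparatorGain, ← hτ, if_pos hp]),
      sum_range_stepProcess_eq_zero (τ := τ) le_rfl
        (fun past z hp => by simp only [confidenceGap, ← hτ, if_pos hp]),
      sum_range_stepProcess_eq_zero (τ := τ) le_rfl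
        (fun past z hp => by simp only [weightExcess, ← hτ, if_pos hp]),
      share_of_length_eq (history_length h v T δ ω τ), Real.log_inv]
    simp
  | succ t ht ih =>
    have ih := ih fun s hs hst => hq s hs (by omega)
    have hV := policySet_history (h := h) (v := v) (T := T) (δ := δ) (ω := ω) ht
    have hC := comparator_history (h := h) (v := v) (T := T) (δ := δ) (ω := ω) ht m
    have hqt := hq t ht (by omega)
    set past := history h v T δ ω t with hpast
    have hlen : τ ≤ past.length := by rw [hpast, history_length]; exact ht
    have hθ' : confidenceScale T δ lvl past = θ := by
      rw [hθdef]
      unfold confidenceScale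
      simp only [← hτ, hV]
    set c := comparator m τ (history h v T δ ω τ) with hc
    set q := mix T τ δ past (h (ω t).1) (postedPrice h (ω t)) true with hqdef
    set r := v (ω t).1 - postedPrice h (ω t) with hrdef
    set b := ind (decision h T δ past (ω t)) with hb
    set π := advice c (h (ω t).1) (postedPrice h (ω t)) true with hπ
    have hb01 : b = 0 ∨ b = 1 := ind_eq _
    have hyb : b * (r * b) = b * r := by rcases hb01 with h0 | h0 <;> simp [h0]
    have hstep := log_share_cons_ge (T := T) (δ := δ) (K := K) (past := past)
      (o := observe h v T δ past (ω t)) hlen hK (by rw [hV, ← hγdef]; exact hγ0)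
      (by rw [hV, ← hγdef]; exact hγ) (by rw [hV, ← hwdef]; exact hw)
      (by
        simp only [observe, ← hb, ← hrdef, hyb]
        rw [abs_mul, abs_of_nonneg (ind_nonneg _), mul_comm]
        exact mul_le_mul_of_nonneg_right (hr t) (ind_nonneg _)) c
    rw [hV, ← hγdef, ← hwdef] at hstep
    simp only [observe, ← hb, ← hrdef, hyb, ← hqdef, ← hπ] at hstep
    have e1 : comparatorGain h v T δ m past (ω t) = r * (π - b) := by
      rw [comparatorGain, ← hτ, if_neg (not_lt.2 hlen), hC]
    have e2 : K ^ 2 / θ * confidenceGap h v T δ m lvl K past (ω t)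
        = π * (r - b * r / q - w / q) := by
      simp only [confidenceGap, ← hτ, if_neg (not_lt.2 hlen), hC, hθ', hV, ← hwdef, ← hqdef,
        ← hrdef, ← hb, ← hπ]
      rcases advice_true_eq c (h (ω t).1) (postedPrice h (ω t)) with h0 | h0
      · rw [← hπ] at h0
        simp [h0]
      · rw [← hπ] at h0
        rw [if_pos ⟨h0, hqt h0⟩, h0]
        have : K ^ 2 ≠ 0 := by positivity
        field_simp
    have e3 : weightExcess h T δ past (ω t) = γ * (b / q) - 2 * γ := by
      simp only [weightExcess, ← hτ, if_neg (not_lt.2 hlen), hV, ← hγdef, ← hqdef, ← hb]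
    rw [Finset.sum_range_succ, Finset.sum_range_succ, Finset.sum_range_succ, ← hpast, e1, e3,
      mul_add (K ^ 2 / θ), e2]
    refine le_trans (le_of_eq ?_) ((add_le_add_left ih _).trans hstep)
    push_cast
    ring

end Path

/-! ### The parameters of the algorithm -/

/-- The regime in which the claimed bound is not trivially true: `n log T` is a small fraction
of `T`. -/
structure Regime (A : ℝ) (n T : ℕ) (δ : ℝ) : Prop where
  hA : 0 < A
  hn : 1 ≤ n
  hT : 2 ≤ T
  hδ0 : 0 < δ
  hδ1 : δ < 1
  hδ : (T : ℝ) ^ (-A) ≤ δ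
  hreg : 512 * (5 + A) ^ 2 * (n * Real.log T) ≤ T

namespace Regime

variable {A : ℝ} {n T : ℕ} {δ : ℝ}

lemma one_le_n (R : Regime A n T δ) : (1 : ℝ) ≤ n := by exact_mod_cast R.hn

lemma two_le_T (R : Regime A n T δ) : (2 : ℝ) ≤ T := by exact_mod_cast R.hT

lemma half_le_log (R : Regime A n T δ) : 1 / 2 ≤ Real.log T := by
  have := Real.log_le_log (by norm_num) R.two_le_T
  have := Real.log_two_gt_d9
  linarith

lemma log_le (R : Regime A n T δ) : Real.log T ≤ n * Real.log T := by
  nlinarith [R.one_le_n, R.half_le_log]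

lemma n_le_T (R : Regime A n T δ) : (n : ℝ) ≤ T := by
  have h1 := R.hreg
  have h2 := R.half_le_log
  have h3 : (n : ℝ) * (1 / 2) ≤ n * Real.log T := by gcongr
  nlinarith [R.hA, R.one_le_n, mul_nonneg R.hA.le (by linarith [R.one_le_n] : (0 : ℝ) ≤ n)]

lemma scale_sq (R : Regime A n T δ) :
    Real.sqrt (T * (n * Real.log T)) ^ 2 = T * (n * Real.log T) := by
  have := R.half_le_log
  exact Real.sq_sqrt (by positivity)

lemma scale_le (R : Regime A n T δ) : (5 + A) * 16 * Real.sqrt (T * (n * Real.log T)) ≤ T := by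
  have hA := R.hA
  have h0 := R.two_le_T
  refine abs_le_of_sq_le_sq' ?_ (by linarith) |>.2
  rw [mul_pow, R.scale_sq]
  nlinarith [R.hreg, R.half_le_log, R.one_le_n, mul_nonneg (by linarith : (0 : ℝ) ≤ (T : ℝ))
    (by linarith [R.log_le, R.half_le_log] : (0 : ℝ) ≤ n * Real.log T), sq_nonneg (5 + A)]

lemma log_le_scale (R : Regime A n T δ) : n * Real.log T ≤ Real.sqrt (T * (n * Real.log T)) := by
  have h0 := R.log_le
  have h1 := R.half_le_log
  refine Real.le_sqrt_of_sq_le ?_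
  have : n * Real.log T ≤ T := by
    have h2 := R.hreg
    have h3 : 1 * (n * Real.log T) ≤ 512 * (5 + A) ^ 2 * (n * Real.log T) :=
      mul_le_mul_of_nonneg_right (by nlinarith [R.hA]) (by linarith)
    linarith
  nlinarith

lemma one_le_scale (R : Regime A n T δ) : 1 ≤ Real.sqrt (T * (n * Real.log T)) := by
  rw [Real.one_le_sqrt]
  nlinarith [R.two_le_T, R.half_le_log, R.log_le]

lemma log_inv_le (R : Regime A n T δ) : Real.log (1 / δ) ≤ A * Real.log T := by
  have hT0 : (0 : ℝ) < T := by linarith [R.two_le_T]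
  have := Real.log_le_log (Real.rpow_pos_of_pos hT0 _) R.hδ
  rw [Real.log_rpow hT0] at this
  rw [one_div, Real.log_inv]
  linarith

lemma log_inv_nonneg (R : Regime A n T δ) : 0 ≤ Real.log (1 / δ) :=
  Real.log_nonneg (by rw [le_div_iff₀ R.hδ0]; linarith [R.hδ1])

lemma log_div_eq (R : Regime A n T δ) {x : ℝ} (hx : 0 < x) :
    Real.log (x / δ) = Real.log x + Real.log (1 / δ) := by
  rw [← Real.log_mul hx.ne' (by have := R.hδ0; positivity), mul_one_div]

lemma log_five_div_le (R : Regime A n T δ) : Real.log (5 / δ) ≤ (4 + A) * Real.log T := by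
  rw [R.log_div_eq (by norm_num)]
  have h1 := R.log_inv_le
  have h2 : Real.log 5 ≤ 3 * Real.log 2 := by
    rw [show (3 : ℝ) * Real.log 2 = Real.log (2 ^ 3) by rw [Real.log_pow]; norm_num]
    exact Real.log_le_log (by norm_num) (by norm_num)
  have h3 := Real.log_le_log (by norm_num) R.two_le_T
  nlinarith [R.half_le_log]

lemma log_five_div_pos (R : Regime A n T δ) : 0 < Real.log (5 / δ) := by
  rw [R.log_div_eq (by norm_num)]
  have := Real.log_pos (show (1 : ℝ) < 5 by norm_num)
  linarith [R.log_inv_nonneg]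

lemma log_five_div_le_scale (R : Regime A n T δ) :
    Real.log (5 / δ) ≤ (4 + A) * Real.sqrt (T * (n * Real.log T)) :=
  R.log_five_div_le.trans <| by
    have := R.hA
    gcongr
    exact R.log_le.trans R.log_le_scale

lemma log_ratio_eq (R : Regime A n T δ) :
    Real.log (Real.exp 1 * T / n) = 1 + Real.log T - Real.log n := by
  have h1 := R.one_le_n
  have h2 := R.two_le_T
  rw [Real.log_div (by positivity) (by positivity), Real.log_mul (by positivity) (by positivity),
    Real.log_exp]

lemma initLength_le (R : Regime A n T δ) :
    (initLength n T δ : ℝ) ≤ (5 + A) * Real.sqrt (T * (n * Real.log T)) := by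
  have hA := R.hA
  have h1 := R.one_le_n
  have h2 := R.two_le_T
  have hL := R.half_le_log
  have hs := R.one_le_scale
  have hlog : Real.log (Real.exp 1 * T / n) ≤ 3 * Real.log T := by
    rw [R.log_ratio_eq]
    linarith [Real.log_nonneg h1]
  have h3 : Real.log (2 / δ) ≤ (1 + A) * Real.log T := by
    rw [R.log_div_eq (by norm_num)]
    linarith [R.log_inv_le, Real.log_le_log (by norm_num) h2]
  have hin : (T : ℝ) * n * Real.log (Real.exp 1 * T / n) + Real.log (2 / δ)
      ≤ ((4 + A) * Real.sqrt (T * (n * Real.log T))) ^ 2 := by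
    rw [mul_pow, R.scale_sq]
    have h4 : (T : ℝ) * n * Real.log (Real.exp 1 * T / n) ≤ T * n * (3 * Real.log T) := by gcongr
    have h5 : (1 + A) * Real.log T ≤ (1 + A) * (T * (n * Real.log T)) := by
      gcongr
      nlinarith [R.log_le]
    have h6 : 0 ≤ T * (n * Real.log T) := by positivity
    have h7 : (4 + A) * (T * (n * Real.log T)) ≤ (4 + A) ^ 2 * (T * (n * Real.log T)) :=
      mul_le_mul_of_nonneg_right (by nlinarith) h6
    linarith
  have h7 := Nat.ceil_lt_add_one
    (Real.sqrt_nonneg ((T : ℝ) * n * Real.log (Real.exp 1 * T / n) + Real.log (2 / δ)))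
  have h8 : Real.sqrt ((T : ℝ) * n * Real.log (Real.exp 1 * T / n) + Real.log (2 / δ))
      ≤ (4 + A) * Real.sqrt (T * (n * Real.log T)) := Real.sqrt_le_iff.2 ⟨by positivity, hin⟩
  unfold initLength
  linarith

lemma two_mul_initLength_le (R : Regime A n T δ) : 2 * (initLength n T δ : ℝ) ≤ T := by
  have := R.initLength_le
  have := R.scale_le
  nlinarith [R.hA, R.one_le_scale]

lemma le_sq_initLength (R : Regime A n T δ) : (T : ℝ) * n ≤ (initLength n T δ : ℝ) ^ 2 ∧
    (T : ℝ) * Real.log T ≤ (initLength n T δ : ℝ) ^ 2 := by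
  have h1 := R.one_le_n
  have h2 := R.two_le_T
  have hL := R.half_le_log
  have hlog2 : 0 ≤ Real.log (2 / δ) := by
    rw [R.log_div_eq (by norm_num)]
    linarith [R.log_inv_nonneg, Real.log_two_gt_d9]
  have hsq : (T : ℝ) * n * Real.log (Real.exp 1 * T / n) ≤ (initLength n T δ : ℝ) ^ 2 := by
    have h3 := Nat.le_ceil
      (Real.sqrt ((T : ℝ) * n * Real.log (Real.exp 1 * T / n) + Real.log (2 / δ)))
    rcases le_or_gt ((T : ℝ) * n * Real.log (Real.exp 1 * T / n) + Real.log (2 / δ)) 0 with h0 | h0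
    · nlinarith [sq_nonneg (initLength n T δ : ℝ)]
    · calc _ ≤ Real.sqrt ((T : ℝ) * n * Real.log (Real.exp 1 * T / n) + Real.log (2 / δ)) ^ 2 := by
            rw [Real.sq_sqrt h0.le]; linarith
        _ ≤ _ := by
            unfold initLength
            gcongr
  have hlogn : Real.log n ≤ Real.log T := Real.log_le_log (by linarith) R.n_le_T
  have hlogn' : Real.log n ≤ n - 1 := by
    have := Real.log_le_sub_one_of_pos (show (0 : ℝ) < n by linarith)
    linarith
  have hr1 : 1 ≤ Real.log (Real.exp 1 * T / n) := by rw [R.log_ratio_eq]; linarith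
  have hr2 : Real.log T ≤ n * Real.log (Real.exp 1 * T / n) := by
    rw [R.log_ratio_eq]; nlinarith
  constructor
  · refine le_trans ?_ hsq
    have : (T : ℝ) * n * 1 ≤ T * n * Real.log (Real.exp 1 * T / n) := by gcongr
    linarith
  · refine le_trans ?_ hsq
    rw [mul_assoc]
    gcongr

lemma initLength_pos (R : Regime A n T δ) : 0 < initLength n T δ := by
  have := R.le_sq_initLength.1
  by_contra h0
  have h0 : initLength n T δ = 0 := by omega
  rw [h0] at this
  have h1 := R.one_le_n
  have h2 := R.two_le_T
  norm_num at this
  nlinarith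

lemma coverage_le (R : Regime A n T δ) : T * ((4 * n + 2 * Real.log (5 / δ)) / initLength n T δ)
    ≤ (16 + 2 * A) * Real.sqrt (T * (n * Real.log T)) := by
  have hA := R.hA
  have hτ : (0 : ℝ) < initLength n T δ := by exact_mod_cast R.initLength_pos
  obtain ⟨h1, h2⟩ := R.le_sq_initLength
  have hn := R.one_le_n
  have hT := R.two_le_T
  have hL := R.half_le_log
  have hS := R.scale_sq
  have hs := R.one_le_scale
  set τ := (initLength n T δ : ℝ)
  set Λ := Real.sqrt (T * (n * Real.log T))
  have e1 : T * n ≤ 2 * Λ * τ := by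
    refine abs_le_of_sq_le_sq' ?_ (by positivity) |>.2
    have : (T * n : ℝ) ≤ 4 * Λ ^ 2 := by
      rw [hS]; nlinarith [mul_pos (by linarith : (0 : ℝ) < T) (by linarith : (0 : ℝ) < n)]
    calc (T * n : ℝ) ^ 2 = (T * n) * (T * n) := sq _
      _ ≤ (4 * Λ ^ 2) * τ ^ 2 := by gcongr
      _ = _ := by ring
  have e2 : T * Real.log T ≤ Λ * τ := by
    refine abs_le_of_sq_le_sq' ?_ (by positivity) |>.2
    have : T * Real.log T ≤ Λ ^ 2 := by
      rw [hS]
      gcongr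
      exact R.log_le
    calc (T * Real.log T) ^ 2 = (T * Real.log T) * (T * Real.log T) := sq _
      _ ≤ Λ ^ 2 * τ ^ 2 := by gcongr
      _ = _ := by ring
  have e3 := R.log_five_div_le
  rw [← mul_div_assoc, div_le_iff₀ hτ]
  have e4 : T * Real.log (5 / δ) ≤ (4 + A) * (Λ * τ) := by
    calc T * Real.log (5 / δ) ≤ T * ((4 + A) * Real.log T) := by gcongr
      _ = (4 + A) * (T * Real.log T) := by ring
      _ ≤ _ := by gcongr
  nlinarith

section Rates

variable {N : ℕ}

lemma log_card_nonneg (hN : 1 ≤ N) : 0 ≤ Real.log N := Real.log_nonneg (by exact_mod_cast hN)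

lemma explorationRate_sq_le (R : Regime A n T δ) (hN : 1 ≤ N) :
    T * explorationRate T (initLength n T δ) N ^ 2 ≤ Real.log N := by
  have h0 := log_card_nonneg hN
  have h1 := R.two_mul_initLength_le
  have h2 := R.two_le_T
  unfold explorationRate
  rw [Real.sq_sqrt (div_nonneg h0 (by linarith)), mul_div_assoc', div_le_iff₀ (by linarith)]
  nlinarith

lemma log_card_le (R : Regime A n T δ) (hN : 1 ≤ N) :
    Real.log N ≤ 2 * T * explorationRate T (initLength n T δ) N ^ 2 := by
  have h0 := log_card_nonneg hN
  have h1 := R.two_mul_initLength_le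
  have h2 := R.two_le_T
  have h3 : (0 : ℝ) ≤ initLength n T δ := Nat.cast_nonneg _
  unfold explorationRate
  rw [Real.sq_sqrt (div_nonneg h0 (by linarith)), mul_div_assoc', le_div_iff₀ (by linarith)]
  nlinarith

lemma confidenceWidth_sq_le (R : Regime A n T δ) (hN : 1 ≤ N) :
    T * confidenceWidth T (initLength n T δ) N δ ^ 2 ≤ Real.log N + A * Real.log T := by
  have h0 := log_card_nonneg hN
  have h1 := R.two_mul_initLength_le
  have h2 := R.two_le_T
  have h3 := R.log_inv_nonneg
  have h4 := R.log_inv_le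
  unfold confidenceWidth
  rw [R.log_div_eq (by exact_mod_cast hN), Real.sq_sqrt (div_nonneg (by linarith) (by linarith)),
    mul_div_assoc', div_le_iff₀ (by linarith)]
  nlinarith

lemma log_five_div_le_confidenceWidth (R : Regime A n T δ) (hN : 1 ≤ N) (hN2 : 2 ≤ N) :
    Real.log (5 / δ) ≤ 6 * T * confidenceWidth T (initLength n T δ) N δ ^ 2 := by
  have h0 := log_card_nonneg hN
  have h1 := R.two_mul_initLength_le
  have h2 := R.two_le_T
  have h3 := R.log_inv_nonneg
  have h5 : (0 : ℝ) ≤ initLength n T δ := Nat.cast_nonneg _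
  have h6 : Real.log 5 ≤ 3 * Real.log N := by
    rw [show (3 : ℝ) * Real.log N = Real.log ((N : ℝ) ^ 3) by rw [Real.log_pow]; norm_num]
    refine Real.log_le_log (by norm_num) ?_
    have : (2 : ℝ) ≤ N := by exact_mod_cast hN2
    calc (5 : ℝ) ≤ 2 ^ 3 := by norm_num
      _ ≤ (N : ℝ) ^ 3 := by gcongr
  unfold confidenceWidth
  rw [R.log_div_eq (x := 5) (by norm_num), R.log_div_eq (x := (N : ℝ)) (by exact_mod_cast hN),
    Real.sq_sqrt (div_nonneg (by linarith) (by linarith)), mul_div_assoc',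
    le_div_iff₀ (by linarith)]
  nlinarith

lemma explorationRate_le_confidenceWidth (R : Regime A n T δ) (hN : 1 ≤ N) :
    explorationRate T (initLength n T δ) N ≤ confidenceWidth T (initLength n T δ) N δ := by
  have h1 := R.two_mul_initLength_le
  have h2 := R.two_le_T
  unfold explorationRate confidenceWidth
  refine Real.sqrt_le_sqrt (div_le_div_of_nonneg_right ?_ (by linarith))
  rw [R.log_div_eq (by exact_mod_cast hN)]
  linarith [R.log_inv_nonneg]

lemma mul_explorationRate_le (R : Regime A n T δ) (hN : 1 ≤ N)
    (hNl : Real.log N ≤ n * Real.log T) :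
    T * explorationRate T (initLength n T δ) N ≤ Real.sqrt (T * (n * Real.log T)) := by
  have h2 := R.two_le_T
  refine Real.le_sqrt_of_sq_le ?_
  have := R.explorationRate_sq_le hN
  nlinarith

lemma explorationRate_le (R : Regime A n T δ) (hN : 1 ≤ N)
    (hNl : Real.log N ≤ n * Real.log T) : explorationRate T (initLength n T δ) N ≤ 1 / 4 := by
  have h1 := R.mul_explorationRate_le hN hNl
  have h2 := R.scale_le
  have h3 := R.two_le_T
  have h4 := R.one_le_scale
  have h5 := R.hA
  by_contra hc
  nlinarith

lemma mul_confidenceWidth_le (R : Regime A n T δ) (hN : 1 ≤ N)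
    (hNl : Real.log N ≤ n * Real.log T) :
    T * confidenceWidth T (initLength n T δ) N δ
      ≤ (1 + A) * Real.sqrt (T * (n * Real.log T)) := by
  have h2 := R.two_le_T
  have hA := R.hA
  have h3 := R.half_le_log
  refine abs_le_of_sq_le_sq' ?_ (by positivity) |>.2
  rw [mul_pow _ (Real.sqrt _), R.scale_sq]
  have h4 := R.confidenceWidth_sq_le hN
  have h5 := R.log_le
  have h6 : T * confidenceWidth T (initLength n T δ) N δ ^ 2 ≤ (1 + A) * (n * Real.log T) := by
    nlinarith
  have h7 : (1 + A) * (n * Real.log T) ≤ (1 + A) ^ 2 * (n * Real.log T) := by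
    gcongr
    nlinarith
  calc _ = T * (T * confidenceWidth T (initLength n T δ) N δ ^ 2) := by ring
    _ ≤ T * ((1 + A) ^ 2 * (n * Real.log T)) :=
      mul_le_mul_of_nonneg_left (h6.trans h7) (by linarith)
    _ = _ := by ring

lemma confidenceWidth_le_one (R : Regime A n T δ) (hN : 1 ≤ N)
    (hNl : Real.log N ≤ n * Real.log T) : confidenceWidth T (initLength n T δ) N δ ≤ 1 := by
  have h1 := R.mul_confidenceWidth_le hN hNl
  have h2 := R.scale_le
  have h3 := R.two_le_T
  have h4 := R.one_le_scale
  have h5 := R.hA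
  by_contra hc
  nlinarith

end Rates

lemma log_card_policySet_le (R : Regime A n T δ) (past : History n) :
    Real.log (policySet (initLength n T δ) past).card ≤ n * Real.log T := by
  have h1 : (policySet (initLength n T δ) past).card ≤ (T ^ n : ℕ) := by
    refine (card_policySet_le _ past).trans (Nat.pow_le_pow_left ?_ n)
    have h2 : 2 * initLength n T δ ≤ T := by exact_mod_cast R.two_mul_initLength_le
    have := R.initLength_pos
    omega
  have h0 : 0 < (policySet (initLength n T δ) past).card := one_le_card_policySet _ _
  rw [← Real.log_pow]
  exact Real.log_le_log (by exact_mod_cast h0) (by exact_mod_cast h1)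

/-- If there are few policies, the confidence width is below `T ^ (-1 / 8) / 2`. -/
lemma confidenceWidth_le_exp (R : Regime A n T δ) {N : ℕ} (hN : 1 ≤ N)
    (hNl : Real.log N ≤ Real.log T) :
    confidenceWidth T (initLength n T δ) N δ ≤ Real.exp (-(Real.log T / 8)) / 2 := by
  have hA := R.hA
  have h2 := R.two_le_T
  have h3 := R.half_le_log
  have h4 := R.confidenceWidth_sq_le hN
  refine abs_le_of_sq_le_sq' ?_ (by positivity) |>.2
  set L := Real.log T
  have hT : (T : ℝ) = Real.exp (L / 2) ^ 2 := by
    rw [← Real.exp_nat_mul]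
    have : ((2 : ℕ) : ℝ) * (L / 2) = L := by push_cast; ring
    rw [this, Real.exp_log (by linarith)]
  have e1 : 16 * (1 + A) ≤ Real.exp (L / 2) := by
    refine abs_le_of_sq_le_sq' ?_ (Real.exp_pos _).le |>.2
    rw [← hT]
    have := R.hreg
    have h5 := R.log_le
    nlinarith [sq_nonneg (5 + A)]
  have e2 : L / 4 ≤ Real.exp (L / 4) := by linarith [Real.add_one_le_exp (L / 4)]
  have e3 : 4 * (1 + A) * L ≤ Real.exp (L / 2) * Real.exp (L / 4) := by
    calc 4 * (1 + A) * L = 16 * (1 + A) * (L / 4) := by ring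
      _ ≤ _ := by gcongr
  have e4 : (Real.exp (-(L / 8)) / 2) ^ 2 * T * 4 = Real.exp (L / 2) * Real.exp (L / 4) := by
    rw [hT, div_pow, ← Real.exp_nat_mul, ← Real.exp_nat_mul, ← Real.exp_add]
    rw [show Real.exp (((2 : ℕ) : ℝ) * -(L / 8)) / 2 ^ 2 * Real.exp (((2 : ℕ) : ℝ) * (L / 2)) * 4
      = Real.exp (((2 : ℕ) : ℝ) * -(L / 8)) * Real.exp (((2 : ℕ) : ℝ) * (L / 2)) by ring,
      ← Real.exp_add]
    congr 1
    push_cast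
    ring
  have e5 : T * confidenceWidth T (initLength n T δ) N δ ^ 2 ≤ (1 + A) * L := by linarith
  have hT0 : (0 : ℝ) < T := by linarith
  refine le_of_mul_le_mul_left ?_ hT0
  linarith

end Regime

/-! ### The regret bound -/

/-- The constant in the bound for the accumulated error terms of the potential argument. -/
def potentialConst (A K : ℝ) : ℝ :=
  4 * (1 + A) + 3 * Real.exp K * (1 + A) + 8 * K ^ 2 * Real.exp K
    + 4 * K ^ 2 * Real.exp K * (4 + A)

/-- The constant in the bound for how much the algorithm can gain on the comparator. -/
def lossConst (A K : ℝ) : ℝ := K * (16 + 2 * A) + (4 + A + K ^ 2)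

/-- The fraction `κ` of `log T` that separates few policies from many policies: there are few if
`log N < κ ^ 2 * log T / n`. -/
def splitConst (A K : ℝ) : ℝ :=
  1 / (8 * (1 + (lossConst A K + (6 * K ^ 2 * (1 + A) + potentialConst A K))))

/-- The constant in the bound for the regret against the comparator. -/
def comparatorConst (A K : ℝ) : ℝ :=
  4 + K ^ 2 * (4 + A) * (2 / splitConst A K) + 6 * K ^ 2 * (1 + A) + potentialConst A K

section Constants

variable {A K : ℝ}

lemma potentialConst_pos (hA : 0 < A) (hK : 1 ≤ K) : 0 < potentialConst A K := by
  unfold potentialConst; positivity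

lemma lossConst_pos (hA : 0 < A) (hK : 1 ≤ K) : 0 < lossConst A K := by
  unfold lossConst; positivity

lemma splitConst_pos (hA : 0 < A) (hK : 1 ≤ K) : 0 < splitConst A K := by
  have := potentialConst_pos hA hK
  have := lossConst_pos hA hK
  unfold splitConst; positivity

lemma splitConst_le_one (hA : 0 < A) (hK : 1 ≤ K) : splitConst A K ≤ 1 := by
  have h1 := potentialConst_pos hA hK
  have h2 := lossConst_pos hA hK
  have h3 : 0 ≤ 6 * K ^ 2 * (1 + A) := by positivity
  unfold splitConst
  rw [div_le_one (by positivity)]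
  linarith

lemma comparatorConst_pos (hA : 0 < A) (hK : 1 ≤ K) : 0 < comparatorConst A K := by
  have := potentialConst_pos hA hK
  have := splitConst_pos hA hK
  unfold comparatorConst; positivity

end Constants

section Path

variable {X : Type*} {n : ℕ} {h : X → Fin n} {v : X → ℝ} {A K : ℝ} {T : ℕ} {δ : ℝ}
  {ω : ℕ → Round X n}

/-- With a single policy the algorithm and the comparator take the same decisions. -/
lemma comparatorGain_eq_zero {τ : ℕ} (hτ : τ = initLength n T δ) {m : Fin n → ℝ}
    (h1 : (policySet τ (history h v T δ ω τ)).card = 1) (hu : ∀ s, ((ω s).2.2 : ℝ) < 1) (s : ℕ) :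
    comparatorGain h v T δ m (history h v T δ ω s) (ω s) = 0 := by
  by_cases hs : s < τ
  · rw [comparatorGain, ← hτ, history_length, if_pos hs]
  · have hlen : τ ≤ (history h v T δ ω s).length := by rw [history_length]; omega
    rw [comparatorGain, ← hτ, if_neg (by omega), decision_eq h (hτ ▸ hlen), ← hτ]
    rw [← policySet_history (not_lt.1 hs)] at h1
    rw [mix_of_card_eq_one h1 (comparator_mem m τ _)]
    rcases advice_true_eq (comparator m τ (history h v T δ ω s)) (h (ω s).1)
      (postedPrice h (ω s)) with h0 | h0
    · rw [h0]
      have : ¬ ((ω s).2.2 : ℝ) < 0 := not_lt.2 (ω s).2.2.2.1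
      simp [ind, this]
    · rw [h0]
      simp [ind, hu s]

set_option maxHeartbeats 1000000 in
/-- The regret against the comparator on the paths on which the concentration inequalities hold.

If there are many policies, the exploration rate is at least of the order of the confidence width
that is needed, so the confidence bounds hold at all times.  If there are few policies, then the
share of the comparator can never fall below `T ^ (-1 / 8)`: the algorithm cannot be much better
than the comparator, so a smaller share would contradict the potential argument.  Hence the
purchase probability stays above the confidence width whenever the comparator buys. -/
lemma sum_comparatorGain_le (R : Regime A n T δ) (hK : 1 ≤ K) {m : Fin n → ℝ}
    (hr : ∀ s, |v (ω s).1 - postedPrice h (ω s)| ≤ K) (hu : ∀ s, ((ω s).2.2 : ℝ) < 1)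
    (hloss : ∀ t ≤ T, -(lossConst A K * Real.sqrt (T * (n * Real.log T)))
      ≤ ∑ s ∈ Finset.range t, comparatorGain h v T δ m (history h v T δ ω s) (ω s))
    (hgap : ∀ t ≤ T, ∑ s ∈ Finset.range t, confidenceGap h v T δ m
      (splitConst A K ^ 2 * Real.log T / n) K (history h v T δ ω s) (ω s) ≤ Real.log (5 / δ))
    (hexc : ∀ t ≤ T, ∑ s ∈ Finset.range t, weightExcess h T δ (history h v T δ ω s) (ω s)
      ≤ Real.log (5 / δ)) :
    ∑ s ∈ Finset.range T, comparatorGain h v T δ m (history h v T δ ω s) (ω s)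
      ≤ comparatorConst A K * Real.sqrt (T * (n * Real.log T)) := by
  have hA := R.hA
  have hκ := splitConst_pos hA hK
  have hκ1 := splitConst_le_one hA hK
  have hpc := potentialConst_pos hA hK
  have hlc := lossConst_pos hA hK
  have hΛ := R.one_le_scale
  have hΛsq := R.scale_sq
  have hL := R.half_le_log
  have hn := R.one_le_n
  have hT2 := R.two_le_T
  obtain ⟨τ, hτ⟩ : ∃ τ, τ = initLength n T δ := ⟨_, rfl⟩
  have hτT : τ ≤ T := by
    have := R.two_mul_initLength_le
    rw [← hτ] at this
    have : (τ : ℝ) ≤ T := by linarith [(Nat.cast_nonneg τ : (0 : ℝ) ≤ τ)]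
    exact_mod_cast this
  obtain ⟨N, hNdef⟩ : ∃ N, N = (policySet τ (history h v T δ ω τ)).card := ⟨_, rfl⟩
  have hN : 1 ≤ N := hNdef ▸ one_le_card_policySet τ _
  rcases hN.eq_or_lt with hN1 | hN2
  · rw [Finset.sum_eq_zero fun s _ => comparatorGain_eq_zero hτ (hNdef ▸ hN1.symm) hu s]
    have := comparatorConst_pos hA hK
    positivity
  have hNl : Real.log N ≤ n * Real.log T := by
    rw [hNdef, hτ]; exact R.log_card_policySet_le _
  have hNpos : 0 < Real.log N := Real.log_pos (by exact_mod_cast hN2)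
  obtain ⟨γ, hγdef⟩ : ∃ γ, γ = explorationRate T τ N := ⟨_, rfl⟩
  obtain ⟨w, hwdef⟩ : ∃ w, w = confidenceWidth T τ N δ := ⟨_, rfl⟩
  have hγ0 : 0 ≤ γ := hγdef ▸ explorationRate_nonneg _ _ _
  have hw0 : 0 ≤ w := hwdef ▸ confidenceWidth_nonneg _ _ _ _
  have hγsq : T * γ ^ 2 ≤ Real.log N := by rw [hγdef, hτ]; exact R.explorationRate_sq_le hN
  have hγlog : Real.log N ≤ 2 * T * γ ^ 2 := by rw [hγdef, hτ]; exact R.log_card_le hN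
  have hγT : T * γ ≤ Real.sqrt (T * (n * Real.log T)) := by
    rw [hγdef, hτ]; exact R.mul_explorationRate_le hN hNl
  have hγ4 : γ ≤ 1 / 4 := by rw [hγdef, hτ]; exact R.explorationRate_le hN hNl
  have hwT : T * w ≤ (1 + A) * Real.sqrt (T * (n * Real.log T)) := by
    rw [hwdef, hτ]; exact R.mul_confidenceWidth_le hN hNl
  have hw1 : w ≤ 1 := by rw [hwdef, hτ]; exact R.confidenceWidth_le_one hN hNl
  have hγw : γ ≤ w := by rw [hγdef, hwdef, hτ]; exact R.explorationRate_le_confidenceWidth hN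
  have hwlog : Real.log (5 / δ) ≤ 6 * T * w ^ 2 := by
    rw [hwdef, hτ]; exact R.log_five_div_le_confidenceWidth hN hN2
  have hγpos : 0 < γ := by
    rcases hγ0.eq_or_lt with h0 | h0
    · rw [← h0] at hγlog; norm_num at hγlog; linarith
    · exact h0
  have hwpos : 0 < w := hγpos.trans_le hγw
  have haL := R.log_five_div_le
  have haΛ := R.log_five_div_le_scale
  have ha0 := R.log_five_div_pos
  set Λ := Real.sqrt (T * (n * Real.log T)) with hΛdef
  set L := Real.log T with hLdef
  set a := Real.log (5 / δ) with hadef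
  set κ := splitConst A K with hκdef
  set c := comparator m τ (history h v T δ ω τ) with hc
  -- The potential argument with all error terms bounded.
  have hpath : ∀ θ, θ = confidenceScale T δ (κ ^ 2 * L / n) (history h v T δ ω τ) → 0 < θ →
      ∀ t, τ ≤ t → t ≤ T → (∀ s, τ ≤ s → s < t →
        advice c (h (ω s).1) (postedPrice h (ω s)) true = 1 →
        θ ≤ mix T τ δ (history h v T δ ω s) (h (ω s).1) (postedPrice h (ω s)) true) →
      -Real.log N + γ / 2 *
        (∑ s ∈ Finset.range t, comparatorGain h v T δ m (history h v T δ ω s) (ω s)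
          - K ^ 2 * (a / θ) - potentialConst A K * Λ)
        ≤ Real.log (share T τ δ (history h v T δ ω t) c) := by
    intro θ hθ hθ0 t ht htT hq
    refine le_trans ?_ (log_share_comparator_ge hτ (by rw [← hNdef]; exact hγdef)
      (by rw [← hNdef]; exact hwdef) hθ hK hγpos hγ4 hw1 hθ0 hr ht hq)
    rw [← hNdef]
    have e1 : K ^ 2 / θ * ∑ s ∈ Finset.range t,
        confidenceGap h v T δ m (κ ^ 2 * L / n) K (history h v T δ ω s) (ω s)
        ≤ K ^ 2 * (a / θ) := by
      calc _ ≤ K ^ 2 / θ * a := mul_le_mul_of_nonneg_left (hgap t htT) (by positivity)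
        _ = _ := by ring
    have e2 : 4 * K ^ 2 * Real.exp K * ∑ s ∈ Finset.range t,
        weightExcess h T δ (history h v T δ ω s) (ω s)
        ≤ 4 * K ^ 2 * Real.exp K * (4 + A) * Λ := by
      calc _ ≤ 4 * K ^ 2 * Real.exp K * a :=
            mul_le_mul_of_nonneg_left (hexc t htT) (by positivity)
        _ ≤ 4 * K ^ 2 * Real.exp K * ((4 + A) * Λ) := by gcongr
        _ = _ := by ring
    have e3 : ((t : ℝ) - τ) * (4 * w + 3 * Real.exp K * w ^ 2 + 8 * K ^ 2 * Real.exp K * γ)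
        ≤ (4 * (1 + A) + 3 * Real.exp K * (1 + A) + 8 * K ^ 2 * Real.exp K) * Λ := by
      have h1 : (t : ℝ) - τ ≤ T := by
        have h2 : (t : ℝ) ≤ T := by exact_mod_cast htT
        linarith [(Nat.cast_nonneg τ : (0 : ℝ) ≤ τ)]
      have h2 : w ^ 2 ≤ w := by nlinarith
      calc ((t : ℝ) - τ) * (4 * w + 3 * Real.exp K * w ^ 2 + 8 * K ^ 2 * Real.exp K * γ)
          ≤ T * (4 * w + 3 * Real.exp K * w + 8 * K ^ 2 * Real.exp K * γ) := by gcongr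
        _ = (4 + 3 * Real.exp K) * (T * w) + 8 * K ^ 2 * Real.exp K * (T * γ) := by ring
        _ ≤ (4 + 3 * Real.exp K) * ((1 + A) * Λ) + 8 * K ^ 2 * Real.exp K * Λ := by gcongr
        _ = _ := by ring
    have e4 : potentialConst A K * Λ
        = (4 * (1 + A) + 3 * Real.exp K * (1 + A) + 8 * K ^ 2 * Real.exp K) * Λ
          + 4 * K ^ 2 * Real.exp K * (4 + A) * Λ := by unfold potentialConst; ring
    refine add_le_add le_rfl (mul_le_mul_of_nonneg_left ?_ (by positivity))
    linarith
  -- At time `T` the share is at most one.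
  have hfinal : ∀ θ, θ = confidenceScale T δ (κ ^ 2 * L / n) (history h v T δ ω τ) → 0 < θ →
      (∀ s, τ ≤ s → s < T → advice c (h (ω s).1) (postedPrice h (ω s)) true = 1 →
        θ ≤ mix T τ δ (history h v T δ ω s) (h (ω s).1) (postedPrice h (ω s)) true) →
      ∑ s ∈ Finset.range T, comparatorGain h v T δ m (history h v T δ ω s) (ω s)
        ≤ 4 * Λ + K ^ 2 * (a / θ) + potentialConst A K * Λ := by
    intro θ hθ hθ0 hq
    have h1 := hpath θ hθ hθ0 T hτT le_rfl hq
    have hmem : c ∈ policySet τ (history h v T δ ω T) := by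
      rw [policySet_history hτT]
      exact comparator_mem m τ _
    have h2 : Real.log (share T τ δ (history h v T δ ω T) c) ≤ 0 :=
      Real.log_nonpos (share_pos _ _ _ _ _).le (share_le_one hmem)
    have h3 : γ / 2 * (∑ s ∈ Finset.range T, comparatorGain h v T δ m (history h v T δ ω s) (ω s)
          - K ^ 2 * (a / θ) - potentialConst A K * Λ) ≤ γ / 2 * (4 * Λ) := by
      have : γ * (T * γ) ≤ γ * Λ := by gcongr
      nlinarith
    have h4 := le_of_mul_le_mul_left h3 (by positivity)
    linarith
  have hconst : comparatorConst A K * Λ = 4 * Λ + K ^ 2 * (4 + A) * (2 / κ) * Λ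
      + 6 * K ^ 2 * (1 + A) * Λ + potentialConst A K * Λ := by
    rw [comparatorConst]; ring
  have hmix : ∀ s, τ ≤ s → explorationRate T τ (policySet τ (history h v T δ ω s)).card = γ := by
    intro s hs
    rw [policySet_history hs, ← hNdef, hγdef]
  by_cases hcase : κ ^ 2 * L / n ≤ Real.log N
  · -- Many policies.
    have hθ : γ = confidenceScale T δ (κ ^ 2 * L / n) (history h v T δ ω τ) := by
      simp only [confidenceScale, ← hτ, ← hNdef, if_pos hcase, ← hγdef]
    have h1 := hfinal γ hθ hγpos fun s hs _ _ => by
      have := (mix_mem (T := T) (τ := τ) (δ := δ) (past := history h v T δ ω s)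
        (by rw [hmix s hs]; exact hγ4) (h (ω s).1) (postedPrice h (ω s))).1
      rwa [hmix s hs] at this
    have h2 : a / γ ≤ (4 + A) * (2 / κ) * Λ := by
      have h3 : κ * L ≤ 2 * (γ * Λ) := by
        refine abs_le_of_sq_le_sq' ?_ (by positivity) |>.2
        have h4 : κ ^ 2 * L ≤ 2 * T * γ ^ 2 * n := by
          rw [div_le_iff₀ (by linarith)] at hcase
          exact hcase.trans (by gcongr)
        calc (κ * L) ^ 2 = κ ^ 2 * L * L := by ring
          _ ≤ 2 * T * γ ^ 2 * n * L := by gcongr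
          _ = 2 * γ ^ 2 * Λ ^ 2 := by rw [hΛsq]; ring
          _ ≤ (2 * (γ * Λ)) ^ 2 := by nlinarith [sq_nonneg (γ * Λ)]
      rw [div_le_iff₀ hγpos]
      calc a ≤ (4 + A) * L := haL
        _ = (4 + A) / κ * (κ * L) := by field_simp
        _ ≤ (4 + A) / κ * (2 * (γ * Λ)) := by gcongr
        _ = _ := by ring
    have h3 : K ^ 2 * (a / γ) ≤ K ^ 2 * ((4 + A) * (2 / κ) * Λ) := by gcongr
    have h4 : 0 ≤ 6 * K ^ 2 * (1 + A) * Λ := by positivity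
    rw [hconst]
    linarith
  · -- Few policies.
    have hcase' := not_le.1 hcase
    have hθ : w = confidenceScale T δ (κ ^ 2 * L / n) (history h v T δ ω τ) := by
      simp only [confidenceScale, ← hτ, ← hNdef, if_neg hcase, ← hwdef]
    have haw : K ^ 2 * (a / w) ≤ 6 * K ^ 2 * (1 + A) * Λ := by
      have : a / w ≤ 6 * ((1 + A) * Λ) := by
        rw [div_le_iff₀ hwpos]
        calc a ≤ 6 * (T * w) * w := by linarith
          _ ≤ 6 * ((1 + A) * Λ) * w := by gcongr
      calc K ^ 2 * (a / w) ≤ K ^ 2 * (6 * ((1 + A) * Λ)) := by gcongr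
        _ = _ := by ring
    have hNκ : Real.log N * n ≤ κ ^ 2 * L := by
      rw [lt_div_iff₀ (by linarith)] at hcase'
      exact hcase'.le
    have hNκ' : Real.log N ≤ κ ^ 2 * L := by nlinarith
    have hκ2 : κ ^ 2 ≤ κ := by nlinarith
    have hγΛ : γ * Λ ≤ κ * L := by
      refine abs_le_of_sq_le_sq' ?_ (by positivity) |>.2
      calc (γ * Λ) ^ 2 = (T * γ ^ 2) * (n * L) := by rw [mul_pow, hΛsq]; ring
        _ ≤ Real.log N * (n * L) := by gcongr
        _ = Real.log N * n * L := by ring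
        _ ≤ κ ^ 2 * L * L := by gcongr
        _ = _ := by ring
    have hwexp : w ≤ Real.exp (-(L / 8)) / 2 := by
      rw [hwdef, hτ]
      refine R.confidenceWidth_le_exp hN (hNκ'.trans ?_)
      nlinarith
    have hq : ∀ t, τ ≤ t → t < T → advice c (h (ω t).1) (postedPrice h (ω t)) true = 1 →
        w ≤ mix T τ δ (history h v T δ ω t) (h (ω t).1) (postedPrice h (ω t)) true := by
      intro t
      induction t using Nat.strong_induction_on with
      | _ t ih =>
        intro ht htT hadv
        have h1 := hpath w hθ hwpos t ht htT.le fun s hs hst => ih s hst hs (hst.trans htT)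
        have h2 := hloss t htT.le
        have hmem : c ∈ policySet τ (history h v T δ ω t) := by
          rw [policySet_history ht]
          exact comparator_mem m τ _
        have h3 := share_le_mix (T := T) (δ := δ) (by rw [hmix t ht]; exact hγ4) hmem hadv
        have h4 : -(L / 8) ≤ Real.log (share T τ δ (history h v T δ ω t) c) := by
          refine le_trans ?_ h1
          set C8 := lossConst A K + (6 * K ^ 2 * (1 + A) + potentialConst A K) with hC8
          have hC8pos : 0 ≤ C8 := by positivity
          have h5 : -(C8 * Λ) ≤ ∑ s ∈ Finset.range t,
              comparatorGain h v T δ m (history h v T δ ω s) (ω s)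
              - K ^ 2 * (a / w) - potentialConst A K * Λ := by
            rw [hC8]; linarith
          have h6 : γ / 2 * -(C8 * Λ) ≤ γ / 2 * (∑ s ∈ Finset.range t,
              comparatorGain h v T δ m (history h v T δ ω s) (ω s)
              - K ^ 2 * (a / w) - potentialConst A K * Λ) := by gcongr
          have h7 : κ * (1 + C8) = 1 / 8 := by
            rw [hκdef, splitConst, ← hC8]; field_simp
          have h8 : γ / 2 * (C8 * Λ) ≤ C8 * (κ * L) := by
            have : C8 * (γ * Λ) ≤ C8 * (κ * L) := by gcongr
            have : 0 ≤ C8 * (γ * Λ) := by positivity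
            linarith
          have h9 : κ ^ 2 * L ≤ κ * L := by gcongr
          have h10 : κ * L + C8 * (κ * L) = L / 8 := by
            calc κ * L + C8 * (κ * L) = κ * (1 + C8) * L := by ring
              _ = L / 8 := by rw [h7]; ring
          linarith
        have h5 : Real.exp (-(L / 8)) ≤ share T τ δ (history h v T δ ω t) c := by
          rw [← Real.exp_log (share_pos T τ δ (history h v T δ ω t) c)]
          exact Real.exp_le_exp.2 h4
        linarith
    have h1 := hfinal w hθ hwpos hq
    have h2 : 0 ≤ K ^ 2 * (4 + A) * (2 / κ) * Λ := by positivity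
    rw [hconst]
    linarith

end Path

/-! ### From the comparator to the optimal strategy -/

section Oracle

variable {X : Type*} {n : ℕ} {h : X → Fin n} {v : X → ℝ} {T : ℕ} {δ : ℝ} {ω : ℕ → Round X n}

lemma observe_mem_history {s t : ℕ} (hst : s < t) :
    observe h v T δ (history h v T δ ω s) (ω s) ∈ history h v T δ ω t := by
  induction t, hst using Nat.le_induction with
  | base => exact List.mem_cons_self
  | succ t _ ih => exact List.mem_cons_of_mem _ ih

/-- No round of the initialization phase has a price between the threshold of the comparator and
the level of its mask value. -/
lemma notMem_of_lt_comparator (m : Fin n → ℝ) {s t : ℕ} (hst : s < t) (i : Fin n) :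
    ω s ∉ {z : Round X n | h z.1 = i ∧ postedPrice h z ≤ m i} ∩
      {z | comparator m t (history h v T δ ω t) i < postedPrice h z} := by
  rintro ⟨⟨rfl, hp⟩, hc⟩
  refine absurd (le_comparator (m := m) (o := observe h v T δ (history h v T δ ω s) (ω s)) ?_ hp)
    (not_le.2 hc)
  rw [List.take_of_length_le (by rw [List.length_reverse, history_length]), List.mem_reverse]
  exact observe_mem_history hst

lemma abs_roundRegret_le {s : Strategy n} {past : History n} {z : Round X n} {K : ℝ}
    (hz : |v z.1 - postedPrice h z| ≤ K) : |roundRegret h v s T δ past z| ≤ K := by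
  rw [roundRegret_eq, abs_mul]
  refine (mul_le_of_le_one_right (abs_nonneg _) ?_).trans hz
  rcases ind_eq (s (h z.1) (postedPrice h z)) with h1 | h1 <;>
  rcases ind_eq (decision h T δ past z) with h2 | h2 <;> simp [h1, h2]

lemma abs_comparatorGain_le {m : Fin n → ℝ} {past : History n} {z : Round X n} {K : ℝ}
    (hz : |v z.1 - postedPrice h z| ≤ K) : |comparatorGain h v T δ m past z| ≤ K := by
  unfold comparatorGain
  split_ifs
  · simpa using (abs_nonneg _).trans hz
  · rw [abs_mul]
    refine (mul_le_of_le_one_right (abs_nonneg _) ?_).trans hz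
    rcases advice_true_eq (comparator m (initLength n T δ) past) (h z.1) (postedPrice h z)
      with h1 | h1 <;>
    rcases ind_eq (decision h T δ past z) with h2 | h2 <;> simp [h1, h2]

variable [MeasurableSpace X] {P : Measure X} [IsProbabilityMeasure P] {Q : Measure (Fin n → ℝ)}
  {K : ℝ}

lemma ae_roundRegret_eq (hvm : Measurable v) (hv : ∀ x, v x ∈ Set.Icc 0 K) {s : Strategy n}
    (hs : IsOptimal P h v s) (T : ℕ) (δ : ℝ) : ∀ᵐ z ∂(roundLaw P Q), ∀ past,
      roundRegret h v s T δ past z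
        = roundRegret h v (regularize (condMean P h v) s) T δ past z := by
  have h1 : ∀ᵐ z ∂(roundLaw P Q), ∀ p,
      s (h z.1) p = regularize (condMean P h v) s (h z.1) p :=
    Measure.quasiMeasurePreserving_fst.ae (ae_eq_regularize hvm hv hs)
  filter_upwards [h1] with z hz past
  simp only [roundRegret, hz]

variable [IsProbabilityMeasure Q]

instance : IsProbabilityMeasure (gameLaw P Q) := by
  unfold gameLaw
  infer_instance

/-- The probability that the next price falls between the threshold of the comparator and the
level of its mask value. -/
def missProb (P : Measure X) (Q : Measure (Fin n → ℝ)) (h : X → Fin n) (m c : Fin n → ℝ) : ℝ :=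
  ∑ i, (roundLaw P Q).real ({z | h z.1 = i ∧ postedPrice h z ≤ m i} ∩
    {z | c i < postedPrice h z})

/-- After the initialization phase the comparator is rarely worse than the optimal strategy. -/
lemma gameLaw_missProb_gt_le (hh : Measurable h) (v : X → ℝ) (m : Fin n → ℝ)
    (hτ : 0 < initLength n T δ) (a : ℝ) :
    gameLaw P Q {ω | (4 * n + 2 * a) / initLength n T δ < missProb P Q h m
      (comparator m (initLength n T δ) (history h v T δ ω (initLength n T δ)))}
      ≤ ENNReal.ofReal (Real.exp (-a)) := by
  refine (measure_mono ?_).trans (measure_exists_unseen_le (roundLaw P Q)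
    (B := fun i => {z | h z.1 = i ∧ postedPrice h z ≤ m i}) (p := postedPrice h) (m := m)
    (fun i => ((hh.comp measurable_fst) (measurableSet_singleton i)).inter
      (measurableSet_le (measurable_postedPrice hh) measurable_const)) ?_
    (measurable_postedPrice hh) (fun i z hz => hz.2) hτ a)
  · intro ω hω
    exact ⟨_, fun t ht i => notMem_of_lt_comparator m ht i, hω⟩
  · intro i j hij
    exact Set.disjoint_left.2 fun z hi hj => hij (hi.1.symm.trans hj.1)

lemma integrable_roundRegret (hh : Measurable h) (hvm : Measurable v)
    (hv : ∀ x, v x ∈ Set.Icc 0 K) (hQ : ∀ᵐ ψ ∂Q, ∀ i, ψ i ∈ Set.Icc 0 K) (m : Fin n → ℝ)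
    (s : Strategy n) (t : ℕ) :
    Integrable (fun z => roundRegret h v (regularize m s) T δ (history h v T δ ω t) z)
      (roundLaw P Q) := by
  refine Integrable.of_bound (measurable_of_stepProcess
    (measurable_roundRegret T δ hh hvm m s) t ω).aestronglyMeasurable K ?_
  filter_upwards [ae_abs_utility_le (P := P) (h := h) hv hQ] with z hz
  exact abs_roundRegret_le hz

lemma integrable_comparatorGain (hh : Measurable h) (hvm : Measurable v)
    (hv : ∀ x, v x ∈ Set.Icc 0 K) (hQ : ∀ᵐ ψ ∂Q, ∀ i, ψ i ∈ Set.Icc 0 K) (m : Fin n → ℝ) (t : ℕ) :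
    Integrable (fun z => comparatorGain h v T δ m (history h v T δ ω t) z) (roundLaw P Q) := by
  refine Integrable.of_bound (measurable_of_stepProcess
    (measurable_comparatorGain T δ hh hvm m) t ω).aestronglyMeasurable K ?_
  filter_upwards [ae_abs_utility_le (P := P) (h := h) hv hQ] with z hz
  exact abs_comparatorGain_le hz

lemma integral_roundRegret_le (hv : ∀ x, v x ∈ Set.Icc 0 K)
    (hQ : ∀ᵐ ψ ∂Q, ∀ i, ψ i ∈ Set.Icc 0 K) (s : Strategy n) (past : History n) :
    ∫ z, roundRegret h v s T δ past z ∂(roundLaw P Q) ≤ K := by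
  refine (le_abs_self _).trans ?_
  have := norm_integral_le_of_norm_le_const (μ := roundLaw P Q)
    (f := fun z => roundRegret h v s T δ past z) (C := K) (by
      filter_upwards [ae_abs_utility_le (P := P) (h := h) hv hQ] with z hz
      exact abs_roundRegret_le hz)
  simpa using this

/-- After the initialization phase the expected regret of a round is the expected regret against
the comparator, up to the loss of the comparator. -/
lemma integral_roundRegret_le_add (hh : Measurable h) (hvm : Measurable v)
    (hv : ∀ x, v x ∈ Set.Icc 0 K) (hK : 0 ≤ K) (hQ : ∀ᵐ ψ ∂Q, ∀ i, ψ i ∈ Set.Icc 0 K)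
    (s : Strategy n) {t : ℕ} (ht : initLength n T δ ≤ t) :
    ∫ z, roundRegret h v (regularize (condMean P h v) s) T δ (history h v T δ ω t) z
        ∂(roundLaw P Q)
      ≤ ∫ z, comparatorGain h v T δ (condMean P h v) (history h v T δ ω t) z ∂(roundLaw P Q)
        + K * missProb P Q h (condMean P h v)
          (comparator (condMean P h v) (initLength n T δ)
            (history h v T δ ω (initLength n T δ))) := by
  have h1 := integral_regularize_sub_advice_le (P := P) hh hvm hv hK hQ s
    (c := comparator (condMean P h v) (initLength n T δ)
      (history h v T δ ω (initLength n T δ)))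
    fun i => comparator_le (fun i => condMean_nonneg hv i) i
  have h2 : ∫ z, roundRegret h v (regularize (condMean P h v) s) T δ (history h v T δ ω t) z
        ∂(roundLaw P Q)
      - ∫ z, comparatorGain h v T δ (condMean P h v) (history h v T δ ω t) z ∂(roundLaw P Q)
      = ∫ z, (v z.1 - postedPrice h z) *
        (ind (regularize (condMean P h v) s (h z.1) (postedPrice h z))
        - advice (comparator (condMean P h v) (initLength n T δ)
      (history h v T δ ω (initLength n T δ))) (h z.1) (postedPrice h z) true) ∂(roundLaw P Q) := by
    rw [← integral_sub (integrable_roundRegret hh hvm hv hQ _ s t)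
      (integrable_comparatorGain hh hvm hv hQ _ t)]
    refine integral_congr_ae (Filter.Eventually.of_forall fun z => ?_)
    simp only [roundRegret_eq, comparatorGain, history_length, if_neg (not_lt.2 ht),
      comparator_history ht]
    ring
  rw [missProb]
  linarith

/-- The algorithm cannot gain much on the comparator in expectation, since no decision rule beats
the optimal strategy. -/
lemma neg_le_integral_comparatorGain (hh : Measurable h) (hvm : Measurable v)
    (hv : ∀ x, v x ∈ Set.Icc 0 K) (hK : 0 ≤ K) (hQ : ∀ᵐ ψ ∂Q, ∀ i, ψ i ∈ Set.Icc 0 K) (t : ℕ) :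
    -(K * missProb P Q h (condMean P h v) (comparator (condMean P h v) (initLength n T δ)
        (history h v T δ ω (initLength n T δ))))
      ≤ ∫ z, comparatorGain h v T δ (condMean P h v) (history h v T δ ω t) z
        ∂(roundLaw P Q) := by
  rcases lt_or_ge t (initLength n T δ) with ht | ht
  · simp only [comparatorGain, history_length, if_pos ht, integral_zero, Left.neg_nonpos_iff]
    exact mul_nonneg hK (Finset.sum_nonneg fun i _ => measureReal_nonneg)
  · have h1 := integral_roundRegret_le_add (P := P) (ω := ω) hh hvm hv hK hQ
      (fun _ _ => true) ht
    have h2 := integral_roundRegret_nonneg (P := P) hh hvm hv hK hQ (fun _ _ => true)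
      (T := T) (δ := δ) (past := history h v T δ ω t)
      (((isRandomHistory_history hh hvm T δ t).comp
        (measurable_const (a := ω))).measurable_decision hh T δ measurable_id)
    linarith

/-- The Azuma-Hoeffding inequality at the scale `Λ = √(T n log T)` of the regret bound, with the
parameter `Λ / T`. -/
lemma Regime.gameLaw_deviation_le {A : ℝ} (R : Regime A n T δ) (hK : 0 ≤ K)
    {F : History n → Round X n → ℝ} (hF : ∀ t, Measurable (stepProcess h v T δ F t))
    (hb : ∀ past, ∀ᵐ z ∂(roundLaw P Q), |F past z| ≤ K) :
    gameLaw P Q {ω | ∃ t ≤ T, (4 + A + K ^ 2) * Real.sqrt (T * (n * Real.log T)) ≤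
        ∑ s ∈ Finset.range t, F (history h v T δ ω s) (ω s)
          - ∑ s ∈ Finset.range t, ∫ z, F (history h v T δ ω s) z ∂(roundLaw P Q)}
      ≤ ENNReal.ofReal (Real.exp (-Real.log (5 / δ))) := by
  set Λ := Real.sqrt (T * (n * Real.log T)) with hΛ
  have hT := R.two_le_T
  have hA := R.hA
  have hΛ1 : 1 ≤ Λ := R.one_le_scale
  refine (measure_mono ?_).trans (gameLaw_exists_compensator_ge_le (lam := Λ / T) hK hF
    (fun past => (hb past).mono fun z hz => abs_le.1 hz) T)
  rintro ω ⟨t, ht, h1⟩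
  refine ⟨t, ht, le_trans ?_ (mul_le_mul_of_nonneg_left h1 (by positivity))⟩
  have h2 : (t : ℝ) ≤ T := by exact_mod_cast ht
  have h3 : Λ / T * ((4 + A + K ^ 2) * Λ) = (4 + A + K ^ 2) * (n * Real.log T) := by
    rw [show Λ / T * ((4 + A + K ^ 2) * Λ) = (4 + A + K ^ 2) * (Λ ^ 2 / T) by ring, R.scale_sq]
    field_simp
  have h4 : T * (K ^ 2 * (Λ / T) ^ 2 / 2) = K ^ 2 / 2 * (n * Real.log T) := by
    rw [div_pow, R.scale_sq]
    field_simp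
  have h5 : t * (K ^ 2 * (Λ / T) ^ 2 / 2) ≤ T * (K ^ 2 * (Λ / T) ^ 2 / 2) := by gcongr
  have h6 : (4 + A) * Real.log T ≤ (4 + A) * (n * Real.log T) := by
    gcongr
    exact R.log_le
  have h7 : 0 ≤ n * Real.log T := by linarith [R.log_le, R.half_le_log]
  rw [h3]
  nlinarith [R.log_five_div_le, mul_nonneg (sq_nonneg K) h7]

/-- The constant in the regret bound. -/
def regretConst (A K : ℝ) : ℝ :=
  K * (5 + A) + K * (16 + 2 * A) + comparatorConst A K + 2 * (4 + A + K ^ 2)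

/-- The regret bounds on the paths on which the concentration inequalities hold. -/
lemma Regime.regret_le {A : ℝ} (R : Regime A n T δ) (hh : Measurable h) (hvm : Measurable v)
    (hv : ∀ x, v x ∈ Set.Icc 0 K) (hK : 1 ≤ K) (hQ : ∀ᵐ ψ ∂Q, ∀ i, ψ i ∈ Set.Icc 0 K)
    (s : Strategy n)
    (hr : ∀ t, |v (ω t).1 - postedPrice h (ω t)| ≤ K) (hu : ∀ t, ((ω t).2.2 : ℝ) < 1)
    (hmiss : missProb P Q h (condMean P h v) (comparator (condMean P h v) (initLength n T δ)
        (history h v T δ ω (initLength n T δ)))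
      ≤ (4 * n + 2 * Real.log (5 / δ)) / initLength n T δ)
    (hgain : ∀ t ≤ T, ∑ s ∈ Finset.range t,
        ∫ z, comparatorGain h v T δ (condMean P h v) (history h v T δ ω s) z ∂(roundLaw P Q)
      - ∑ s ∈ Finset.range t, comparatorGain h v T δ (condMean P h v) (history h v T δ ω s) (ω s)
      ≤ (4 + A + K ^ 2) * Real.sqrt (T * (n * Real.log T)))
    (hreg : realizedRegret h v (regularize (condMean P h v) s) T δ ω
      - conditionalRegret P Q h v (regularize (condMean P h v) s) T δ ω
      ≤ (4 + A + K ^ 2) * Real.sqrt (T * (n * Real.log T)))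
    (hgap : ∀ t ≤ T, ∑ s ∈ Finset.range t, confidenceGap h v T δ (condMean P h v)
      (splitConst A K ^ 2 * Real.log T / n) K (history h v T δ ω s) (ω s) ≤ Real.log (5 / δ))
    (hexc : ∀ t ≤ T, ∑ s ∈ Finset.range t, weightExcess h T δ (history h v T δ ω s) (ω s)
      ≤ Real.log (5 / δ)) :
    realizedRegret h v (regularize (condMean P h v) s) T δ ω
        ≤ regretConst A K * Real.sqrt (T * (n * Real.log T)) ∧
      conditionalRegret P Q h v (regularize (condMean P h v) s) T δ ω
        ≤ regretConst A K * Real.sqrt (T * (n * Real.log T)) := by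
  have hA := R.hA
  have hK0 : 0 ≤ K := by linarith
  have hΛ := R.one_le_scale
  have hτ := R.initLength_le
  have hcov := R.coverage_le
  set Λ := Real.sqrt (T * (n * Real.log T)) with hΛdef
  set β := (4 * n + 2 * Real.log (5 / δ)) / initLength n T δ with hβdef
  have hmissK := mul_le_mul_of_nonneg_left hmiss hK0
  have hβ0 : 0 ≤ β := le_trans (Finset.sum_nonneg fun i _ => measureReal_nonneg) hmiss
  have hKβ : (T : ℝ) * (K * β) ≤ K * (16 + 2 * A) * Λ := by
    calc (T : ℝ) * (K * β) = K * (T * β) := by ring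
      _ ≤ K * ((16 + 2 * A) * Λ) := by gcongr
      _ = _ := by ring
  have hcomp := sum_comparatorGain_le R hK hr hu (m := condMean P h v) (by
    intro t ht
    have h1 := hgain t ht
    have h2 : (t : ℝ) * -(K * β) ≤ ∑ s ∈ Finset.range t,
        ∫ z, comparatorGain h v T δ (condMean P h v) (history h v T δ ω s) z ∂(roundLaw P Q) := by
      rw [← nsmul_eq_mul, ← Finset.card_range t, ← Finset.sum_const, Finset.card_range]
      exact Finset.sum_le_sum fun s _ => (neg_le_neg hmissK).trans
        (neg_le_integral_comparatorGain hh hvm hv hK0 hQ s)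
    have h3 : (t : ℝ) * (K * β) ≤ T * (K * β) := by
      have : (t : ℝ) ≤ T := by exact_mod_cast ht
      gcongr
    rw [lossConst, ← hΛdef]
    linarith) hgap hexc
  have hcond : conditionalRegret P Q h v (regularize (condMean P h v) s) T δ ω
      ≤ initLength n T δ * K + T * (K * β) + ∑ t ∈ Finset.range T,
        ∫ z, comparatorGain h v T δ (condMean P h v) (history h v T δ ω t) z ∂(roundLaw P Q) := by
    have h1 : ∀ t ∈ Finset.range T,
        ∫ z, roundRegret h v (regularize (condMean P h v) s) T δ (history h v T δ ω t) z
          ∂(roundLaw P Q) ≤ (if t < initLength n T δ then K else 0) + K * β +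
        ∫ z, comparatorGain h v T δ (condMean P h v) (history h v T δ ω t) z
          ∂(roundLaw P Q) := by
      intro t _
      split_ifs with ht
      · have e : ∫ z, comparatorGain h v T δ (condMean P h v) (history h v T δ ω t) z
          ∂(roundLaw P Q) = 0 := by
          simp only [comparatorGain, history_length, if_pos ht, integral_zero]
        have := integral_roundRegret_le (P := P) (h := h) (T := T) (δ := δ) hv hQ
          (regularize (condMean P h v) s) (history h v T δ ω t)
        have := mul_nonneg hK0 hβ0
        linarith
      · have := integral_roundRegret_le_add (P := P) (ω := ω) hh hvm hv hK0 hQ s (not_lt.1 ht)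
        linarith
    refine (Finset.sum_le_sum h1).trans ?_
    rw [Finset.sum_add_distrib, Finset.sum_add_distrib, Finset.sum_const, Finset.card_range,
      nsmul_eq_mul]
    gcongr
    rw [← Finset.sum_filter, Finset.sum_const, nsmul_eq_mul]
    gcongr
    calc _ ≤ (Finset.range (initLength n T δ)).card := Finset.card_le_card fun t ht =>
          Finset.mem_range.2 (Finset.mem_filter.1 ht).2
      _ = _ := Finset.card_range _
  have h1 := hgain T le_rfl
  have h2 : initLength n T δ * K ≤ K * (5 + A) * Λ := by
    calc initLength n T δ * K ≤ (5 + A) * Λ * K := by gcongr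
      _ = _ := by ring
  have h3 : 0 ≤ (4 + A + K ^ 2) * Λ := by positivity
  have h4 : regretConst A K * Λ = K * (5 + A) * Λ + K * (16 + 2 * A) * Λ + comparatorConst A K * Λ
      + 2 * ((4 + A + K ^ 2) * Λ) := by rw [regretConst]; ring
  rw [h4]
  constructor <;> linarith

/-- In the nontrivial regime each of the five exceptional events has probability at most
`δ / 5`. -/
lemma Regime.gameLaw_regret_gt_le {A : ℝ} (R : Regime A n T δ) (hh : Measurable h)
    (hvm : Measurable v) (hv : ∀ x, v x ∈ Set.Icc 0 K) (hK : 1 ≤ K)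
    (hQ : ∀ᵐ ψ ∂Q, ∀ i, ψ i ∈ Set.Icc 0 K) (s : Strategy n) :
    gameLaw P Q {ω | ¬ (realizedRegret h v (regularize (condMean P h v) s) T δ ω
        ≤ regretConst A K * Real.sqrt (T * (n * Real.log T)) ∧
      conditionalRegret P Q h v (regularize (condMean P h v) s) T δ ω
        ≤ regretConst A K * Real.sqrt (T * (n * Real.log T)))} ≤ ENNReal.ofReal δ := by
  have hK0 : 0 ≤ K := by linarith
  have hδ0 := R.hδ0
  have habs := ae_abs_utility_le (P := P) (Q := Q) (h := h) hv hQ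
  have hγ : ∀ past : History n, explorationRate T (initLength n T δ)
      (policySet (initLength n T δ) past).card ≤ 1 / 4 := fun past =>
    R.explorationRate_le (one_le_card_policySet _ past) (R.log_card_policySet_le past)
  have E0 := gameLaw_missProb_gt_le (P := P) (Q := Q) hh v (condMean P h v) R.initLength_pos
    (Real.log (5 / δ))
  have E1 := R.gameLaw_deviation_le (P := P) (Q := Q) (h := h) (v := v)
    (F := fun past z => -comparatorGain h v T δ (condMean P h v) past z) hK0
    (fun t => (measurable_comparatorGain T δ hh hvm (condMean P h v) t).neg)
    (fun past => habs.mono fun z hz => by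
      rw [abs_neg]
      exact abs_comparatorGain_le hz)
  have E2 := R.gameLaw_deviation_le (P := P) (Q := Q) (h := h) (v := v)
    (F := roundRegret h v (regularize (condMean P h v) s) T δ) hK0
    (measurable_roundRegret T δ hh hvm (condMean P h v) s)
    (fun past => habs.mono fun z hz => abs_roundRegret_le hz)
  have E3 := gameLaw_exists_sum_ge_le (P := P) (Q := Q)
    (measurable_confidenceGap T δ hh hvm (condMean P h v)
      (splitConst A K ^ 2 * Real.log T / n) K)
    (lintegral_exp_confidenceGap_le hh hvm hv hK hQ hγ
      (fun N hN => R.explorationRate_le_confidenceWidth hN) _ _) (Real.log (5 / δ)) T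
  have E4 := gameLaw_exists_sum_ge_le (P := P) (Q := Q) (measurable_weightExcess T δ hh hvm)
    (lintegral_exp_weightExcess_le hh hvm hγ) (Real.log (5 / δ)) T
  have hexp : Real.exp (-Real.log (5 / δ)) = δ / 5 := by
    rw [Real.exp_neg, Real.exp_log (by positivity), inv_div]
  rw [hexp] at E0 E1 E2 E3 E4
  refine le_trans (measure_mono_ae (t := _ ∪ (_ ∪ (_ ∪ (_ ∪ _)))) ?_)
    ((measure_union_le _ _).trans (add_le_add E0 ((measure_union_le _ _).trans
      (add_le_add E1 ((measure_union_le _ _).trans (add_le_add E2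
        ((measure_union_le _ _).trans (add_le_add E3 E4)))))))) |>.trans ?_
  · have hr : ∀ᵐ ω ∂(gameLaw P Q), ∀ t, |v (ω t).1 - postedPrice h (ω t)| ≤ K :=
      ae_infinitePi_of_ae habs
    have hu : ∀ᵐ ω ∂(gameLaw P Q), ∀ t, ((ω t).2.2 : ℝ) < 1 :=
      ae_infinitePi_of_ae ae_roundLaw_seed_lt_one
    filter_upwards [hr, hu] with ω hr hu hbad
    by_contra hgood
    have hgood : ω ∉ (_ ∪ (_ ∪ (_ ∪ (_ ∪ _))) : Set (ℕ → Round X n)) := hgood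
    simp only [Set.mem_union, Set.mem_ofPred_eq, not_or, not_exists, not_and, not_le, not_lt]
      at hgood
    obtain ⟨g0, g1, g2, g3, g4⟩ := hgood
    refine hbad (R.regret_le hh hvm hv hK hQ s hr hu g0 ?_ (g2 T le_rfl).le
      (fun t ht => (g3 t ht).le) (fun t ht => (g4 t ht).le))
    intro t ht
    have := (g1 t ht).le
    simp only [integral_neg, Finset.sum_neg_distrib] at this
    linarith
  · simp only [← ENNReal.ofReal_add (show 0 ≤ δ / 5 by positivity) (show 0 ≤ δ / 5 by positivity),
      ← ENNReal.ofReal_add (show 0 ≤ δ / 5 by positivity)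
        (show 0 ≤ δ / 5 + δ / 5 by positivity),
      ← ENNReal.ofReal_add (show 0 ≤ δ / 5 by positivity)
        (show 0 ≤ δ / 5 + (δ / 5 + δ / 5) by positivity),
      ← ENNReal.ofReal_add (show 0 ≤ δ / 5 by positivity)
        (show 0 ≤ δ / 5 + (δ / 5 + (δ / 5 + δ / 5)) by positivity)]
    exact ENNReal.ofReal_le_ofReal (by linarith)

/-- The regret never exceeds the number of rounds times the largest possible utility. -/
lemma ae_regret_le_mul (hv : ∀ x, v x ∈ Set.Icc 0 K) (hQ : ∀ᵐ ψ ∂Q, ∀ i, ψ i ∈ Set.Icc 0 K)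
    (s : Strategy n) (T : ℕ) (δ : ℝ) : ∀ᵐ ω ∂(gameLaw P Q),
      realizedRegret h v s T δ ω ≤ K * T ∧ conditionalRegret P Q h v s T δ ω ≤ K * T := by
  have hr : ∀ᵐ ω ∂(gameLaw P Q), ∀ t, |v (ω t).1 - postedPrice h (ω t)| ≤ K :=
    ae_infinitePi_of_ae (ae_abs_utility_le (P := P) (Q := Q) (h := h) hv hQ)
  have hsum : ∀ f : ℕ → ℝ, (∀ t, f t ≤ K) → ∑ t ∈ Finset.range T, f t ≤ K * T := fun f hf => by
    refine (Finset.sum_le_sum fun t _ => hf t).trans_eq ?_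
    simp [mul_comm]
  filter_upwards [hr] with ω hω
  exact ⟨hsum _ fun t => (le_abs_self _).trans (abs_roundRegret_le (hω t)),
    hsum _ fun t => integral_roundRegret_le hv hQ s _⟩

lemma ae_regret_eq (hvm : Measurable v) (hv : ∀ x, v x ∈ Set.Icc 0 K) {s : Strategy n}
    (hs : IsOptimal P h v s) (T : ℕ) (δ : ℝ) : ∀ᵐ ω ∂(gameLaw P Q),
      realizedRegret h v s T δ ω
        = realizedRegret h v (regularize (condMean P h v) s) T δ ω ∧
      conditionalRegret P Q h v s T δ ω
        = conditionalRegret P Q h v (regularize (condMean P h v) s) T δ ω := by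
  have h1 := ae_roundRegret_eq (P := P) (Q := Q) hvm hv hs T δ
  have h2 : ∀ᵐ ω ∂(gameLaw P Q), ∀ t, ∀ past, roundRegret h v s T δ past (ω t)
        = roundRegret h v (regularize (condMean P h v) s) T δ past (ω t) :=
    ae_infinitePi_of_ae h1
  filter_upwards [h2] with ω hω
  exact ⟨Finset.sum_congr rfl fun t _ => hω t _,
    Finset.sum_congr rfl fun t _ => integral_congr_ae (h1.mono fun z hz => hz _)⟩

end Oracle

lemma ofReal_one_sub_le_of_compl_le {Ω : Type*} [MeasurableSpace Ω] {μ : Measure Ω}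
    [IsProbabilityMeasure μ] {S : Set Ω} {δ : ℝ} (hδ : 0 ≤ δ) (hS : μ Sᶜ ≤ ENNReal.ofReal δ) :
    ENNReal.ofReal (1 - δ) ≤ μ S := by
  rw [ENNReal.ofReal_sub _ hδ, ENNReal.ofReal_one, tsub_le_iff_right]
  calc 1 = μ (S ∪ Sᶜ) := by rw [Set.union_compl_self, measure_univ]
    _ ≤ μ S + μ Sᶜ := measure_union_le _ _
    _ ≤ _ := by gcongr

end PartialAuction

end

theorem mainTheorem1 (H : ℝ) (hH : 0 ≤ H) (A : ℝ) (hA : 0 < A) :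
    ∃ C : ℝ, 0 < C ∧
      ∀ (X : Type*) [MeasurableSpace X] (n T : ℕ) (δ : ℝ)
        (P : MeasureTheory.Measure X) [MeasureTheory.IsProbabilityMeasure P]
        (Q : MeasureTheory.Measure (Fin n → ℝ)) [MeasureTheory.IsProbabilityMeasure Q]
        (h : X → Fin n) (v : X → ℝ) (s : PartialAuction.Strategy n),
        2 ≤ T → 0 < δ → δ < 1 → (T : ℝ) ^ (-A) ≤ δ →
        Measurable h → Measurable v → (∀ x, v x ∈ Set.Icc 0 H) →
        (∀ᵐ ψ ∂Q, ∀ i, ψ i ∈ Set.Icc 0 H) →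
        PartialAuction.IsOptimal P h v s →
        ENNReal.ofReal (1 - δ) ≤
          PartialAuction.gameLaw P Q
            {ω | PartialAuction.realizedRegret h v s T δ ω
                    ≤ C * Real.sqrt (T * (n * Real.log T + Real.log (1 / δ))) ∧
                PartialAuction.conditionalRegret P Q h v s T δ ω
                    ≤ C * Real.sqrt (T * (n * Real.log T + Real.log (1 / δ)))} := by
  -- The bound `K = H + 1` on valuations and prices makes `1 ≤ K` available.
  obtain ⟨K, hKdef⟩ : ∃ K, K = H + 1 := ⟨_, rfl⟩
  have hK : 1 ≤ K := by linarith
  have hcc := PartialAuction.comparatorConst_pos hA hK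
  have hrc : 0 < PartialAuction.regretConst A K := by unfold PartialAuction.regretConst; positivity
  refine ⟨PartialAuction.regretConst A K + 23 * (5 + A) * K, by positivity, ?_⟩
  intro X _ n T δ P _ Q _ h v s hT hδ0 hδ1 hδ hh hvm hv hQ hs
  have hvK : ∀ x, v x ∈ Set.Icc 0 K := fun x => ⟨(hv x).1, (hv x).2.trans (by linarith)⟩
  have hQK : ∀ᵐ ψ ∂Q, ∀ i, ψ i ∈ Set.Icc 0 K :=
    hQ.mono fun ψ hψ i => ⟨(hψ i).1, (hψ i).2.trans (by linarith)⟩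
  have hn : 1 ≤ n := by
    obtain ⟨x⟩ := nonempty_of_isProbabilityMeasure P
    exact Nat.one_le_iff_ne_zero.2 fun h0 => (h0 ▸ h x).elim0
  have hTR : (2 : ℝ) ≤ T := by exact_mod_cast hT
  have hL : 0 ≤ Real.log T := Real.log_nonneg (by linarith)
  have hlogδ : 0 ≤ Real.log (1 / δ) :=
    Real.log_nonneg (by rw [le_div_iff₀ hδ0]; linarith)
  have hΛ : Real.sqrt (T * (n * Real.log T))
      ≤ Real.sqrt (T * (n * Real.log T + Real.log (1 / δ))) := by gcongr; linarith
  have hΛ0 := Real.sqrt_nonneg (T * (n * Real.log T))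
  refine PartialAuction.ofReal_one_sub_le_of_compl_le hδ0.le ?_
  by_cases hreg : 512 * (5 + A) ^ 2 * (n * Real.log T) ≤ T
  · have R : PartialAuction.Regime A n T δ := ⟨hA, hn, hT, hδ0, hδ1, hδ, hreg⟩
    refine (measure_mono_ae ?_).trans (R.gameLaw_regret_gt_le (P := P) hh hvm hvK hK hQK s)
    filter_upwards [PartialAuction.ae_regret_eq (P := P) (Q := Q) hvm hvK hs T δ]
      with ω hω hbad hgood
    refine hbad ?_
    have : PartialAuction.regretConst A K * Real.sqrt (T * (n * Real.log T))
        ≤ (PartialAuction.regretConst A K + 23 * (5 + A) * K)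
          * Real.sqrt (T * (n * Real.log T + Real.log (1 / δ))) :=
      mul_le_mul (by linarith [(by positivity : 0 ≤ 23 * (5 + A) * K)]) hΛ hΛ0 (by positivity)
    exact ⟨hω.1 ▸ hgood.1.trans this, hω.2 ▸ hgood.2.trans this⟩
  · -- Here the claimed bound exceeds `K T`.
    have hTΛ : (T : ℝ) ≤ 23 * (5 + A) * Real.sqrt (T * (n * Real.log T)) := by
      refine abs_le_of_sq_le_sq' ?_ (by positivity) |>.2
      rw [mul_pow, Real.sq_sqrt (by positivity)]
      have h1 := mul_le_mul_of_nonneg_left (not_le.1 hreg).le (by positivity : (0 : ℝ) ≤ T)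
      have h2 : 0 ≤ (5 + A) ^ 2 * (T * (n * Real.log T)) := by positivity
      nlinarith
    have hbound : K * T ≤ (PartialAuction.regretConst A K + 23 * (5 + A) * K)
          * Real.sqrt (T * (n * Real.log T + Real.log (1 / δ))) := by
      calc K * T ≤ K * (23 * (5 + A) * Real.sqrt (T * (n * Real.log T))) := by gcongr
        _ = 23 * (5 + A) * K * Real.sqrt (T * (n * Real.log T)) := by ring
        _ ≤ _ := mul_le_mul (by linarith) hΛ hΛ0 (by positivity)
    refine le_of_eq_of_le (measure_eq_zero_iff_ae_notMem.2 ?_) zero_le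
    filter_upwards [PartialAuction.ae_regret_le_mul (P := P) (Q := Q) (h := h) hvK hQK s T δ]
      with ω hω hbad
    exact hbad ⟨hω.1.trans hbound, hω.2.trans hbound⟩
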